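/- Setting. Fix a local dimension $d\ge 1$. For finite $\Lambda\subset\mathbb Z$ let $\mathcal H_\Lambda=\bigotimes_{x\in\Lambda}\mathbb C^d$ and $\mathfrak A_\Lambda=\mathcal B(\mathcal H_\Lambda)$, with the operator norm $\|\cdot\|$; for $X\subset\Lambda$ regard $\mathfrak A_X\subset\mathfrak A_\Lambda$ via $Q\mapsto Q\otimes\mathbb 1_{\Lambda\setminus X}$. An interaction $\Phi=(\Phi_X)_X$ assigns to every finite $X\subset\mathbb Z$ a self-adjoint $\Phi_X\in\mathfrak A_X$. It has range $r>0$ and strength $J>0$ if $\Phi_X=0$ whenever $\operatorname{diam}(X)>r$, and $\|\Phi_X\|\le J$ for all $X$. Put $H_\Lambda=\sum_{X\subset\Lambda}\Phi_X$ and $\rho^\Lambda=e^{-H_\Lambda}/\operatorname{Tr}(e^{-H_\Lambda})$. For a state $\rho$, $\rho_X$ denotes its reduced state on $X$. Write $I=ABC$ when the finite interval $I\subset\mathbb Z$ is split into adjacent subintervals $A,B,C$, in this order (possibly empty). Let $\operatorname{Corr}_\rho(A:C)=\sup\,|\operatorname{Tr}[(O_A\otimes O_C)(\rho_{AC}-\rho_A\otimes\rho_C)]|$,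 the supremum being over $O_A\in\mathfrak A_A$, $O_C\in\mathfrak A_C$ of norm one. For constants $\widetilde{\mathcal K},\widetilde\alpha>0$, $\Phi$ satisfies exponential uniform clustering with these constants if $\operatorname{Corr}_{\rho^I}(A:C)\le\widetilde{\mathcal K}e^{-\widetilde\alpha\ell}$ for every finite interval $I=ABC$ and every real $\ell$ with $0\le\ell\le|B|$. For full-rank states $\rho,\sigma$ let $$D(\rho\|\sigma)=\operatorname{Tr}[\rho(\log\rho-\log\sigma)],\qquad \widehat D(\rho\|\sigma)=\operatorname{Tr}[\rho\log(\rho^{1/2}\sigma^{-1}\rho^{1/2})],$$ $$\widehat D_q(\rho\|\sigma)=\frac1{q-1}\log\operatorname{Tr}\big[\sigma^{1/2}(\sigma^{-1/2}\rho\,\sigma^{-1/2})^q\sigma^{1/2}\big]\quad(q>1),\qquad \widehat D_1:=\widehat D=\lim_{q\to1^+}\widehat D_q,$$ and let $I_\rho(A:C)$, $\widehat I_\rho(A:C)$, $\widehat I^q_\rho(A:C)$ be the values of $D$, $\widehat D$, $\widehat D_q$ at $(\rho_{AC}\,\|\,\rho_A\otimes\rho_C)$. Theorem. For all $d\ge1$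 and $r,J,\widetilde{\mathcal K},\widetilde\alpha>0$ there are constants $\widehat{\mathcal K},\widehat\alpha>0$, depending only on $d,r,J,\widetilde{\mathcal K},\widetilde\alpha$, such that the following holds. Let $\Phi$ be an interaction on $\mathbb Z$ with local dimension $d$, range $r$ and strength $J$ that satisfies exponential uniform clustering with constants $\widetilde{\mathcal K},\widetilde\alpha$. Then for every finite interval $I=ABC$, every real $\ell$ with $|B|\ge3\ell\ge0$ and every $q\ge1$, the Gibbs state $\rho=\rho^I$ satisfies $$I_\rho(A:C)\;\le\;\widehat I_\rho(A:C)\;\le\;\widehat I^q_\rho(A:C)\;\le\;\widehat{\mathcal K}\,e^{-\widehat\alpha\,\ell}.$$ -/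

import Mathlib

open scoped Matrix.Norms.L2Operator

noncomputable section

namespace SpinChain

/-- Configurations of a spin system with `d` levels per site on the finite set `Λ` of sites; they
index the product basis of the Hilbert space `⨂_{x ∈ Λ} ℂ^d`. -/
abbrev Config (d : ℕ) (Λ : Finset ℤ) : Type := Λ → Fin d

/-- The algebra of all operators on `⨂_{x ∈ Λ} ℂ^d`, as matrices in the product basis.
Its norm is the operator norm with respect to the Hilbert space norm. -/
abbrev Obs (d : ℕ) (Λ : Finset ℤ) : Type := Matrix (Config d Λ) (Config d Λ) ℂ

/-- Restriction of a configuration to a smaller set of sites. -/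
def restr {d : ℕ} {X Λ : Finset ℤ} (h : X ⊆ Λ) (s : Config d Λ) : Config d X :=
  fun x => s ⟨x, h x.2⟩

/-- The canonical inclusion `Q ↦ Q ⊗ 1` of the operators on `X` into the operators on `Λ ⊇ X`. -/
def embed {d : ℕ} {X Λ : Finset ℤ} (h : X ⊆ Λ) (Q : Obs d X) : Obs d Λ :=
  Matrix.of fun s t =>
    if ∀ x : Λ, (x : ℤ) ∉ X → s x = t x then Q (restr h s) (restr h t) else 0

/-- The configuration on `Λ` which is `s` on `X` and `u` on `Λ \ X`. -/
def glue {d : ℕ} {X Λ : Finset ℤ} (s : Config d X) (u : Config d (Λ \ X)) : Config d Λ :=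
  fun x => if hx : (x : ℤ) ∈ X then s ⟨x, hx⟩ else u ⟨x, Finset.mem_sdiff.2 ⟨x.2, hx⟩⟩

/-- The (unnormalized) partial trace over `Λ \ X`; for a state `ρ` on `Λ ⊇ X` it is the reduced
state `ρ_X`. -/
def reduced {d : ℕ} {Λ : Finset ℤ} (X : Finset ℤ) (ρ : Obs d Λ) : Obs d X :=
  Matrix.of fun s t => ∑ u : Config d (Λ \ X), ρ (glue s u) (glue t u)

/-- The tensor product `Q ⊗ R` of operators on disjoint sets `A` and `C`, an operator on `A ∪ C`. -/
def tensor {d : ℕ} {A C : Finset ℤ} (Q : Obs d A) (R : Obs d C) : Obs d (A ∪ C) :=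
  Matrix.of fun s t =>
    Q (restr Finset.subset_union_left s) (restr Finset.subset_union_left t) *
      R (restr Finset.subset_union_right s) (restr Finset.subset_union_right t)

/-- A local interaction: a self-adjoint operator `Φ_X` on `X` for each finite set `X` of sites. -/
structure Interaction (d : ℕ) where
  term : (X : Finset ℤ) → Obs d X
  selfAdjoint : ∀ X, (term X).IsHermitian

namespace Interaction

variable {d : ℕ}

/-- `Φ` has range `r`: `Φ_X = 0` whenever the diameter of `X` exceeds `r`. -/
def HasRange (Φ : Interaction d) (r : ℝ) : Prop :=
  ∀ X : Finset ℤ, r < Metric.diam (X : Set ℤ) → Φ.term X = 0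

/-- `Φ` has strength `J`: `‖Φ_X‖ ≤ J` for all `X`. -/
def HasStrength (Φ : Interaction d) (J : ℝ) : Prop :=
  ∀ X : Finset ℤ, ‖Φ.term X‖ ≤ J

/-- The Hamiltonian `H_Λ = ∑_{X ⊆ Λ} Φ_X`. -/
def hamiltonian (Φ : Interaction d) (Λ : Finset ℤ) : Obs d Λ :=
  ∑ X ∈ Λ.powerset.attach, embed (Finset.mem_powerset.1 X.2) (Φ.term X)

/-- The Gibbs state `ρ^Λ = e^{-H_Λ} / Tr e^{-H_Λ}`. -/
def gibbs (Φ : Interaction d) (Λ : Finset ℤ) : Obs d Λ :=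
  (NormedSpace.exp (-Φ.hamiltonian Λ)).trace⁻¹ • NormedSpace.exp (-Φ.hamiltonian Λ)

end Interaction

/-- `IsSplit I A B C`: the finite interval `I` of `ℤ` is split into the adjacent subintervals
`A`, `B`, `C`, in this order. Subintervals may be empty. -/
def IsSplit (I A B C : Finset ℤ) : Prop :=
  ∃ x y z w : ℤ, x ≤ y ∧ y ≤ z ∧ z ≤ w ∧
    I = Finset.Ico x w ∧ A = Finset.Ico x y ∧ B = Finset.Ico y z ∧ C = Finset.Ico z w

/-- The covariance correlation `Corr_ρ(A : C)`: the supremum of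
`|Tr[(O_A ⊗ O_C) (ρ_{AC} - ρ_A ⊗ ρ_C)]|` over operators `O_A`, `O_C` of norm one. -/
def corr {d : ℕ} {I : Finset ℤ} (ρ : Obs d I) (A C : Finset ℤ) : ℝ :=
  sSup {v : ℝ | ∃ (Q : Obs d A) (R : Obs d C), ‖Q‖ = 1 ∧ ‖R‖ = 1 ∧
    v = ‖(tensor Q R *
      (reduced (A ∪ C) ρ - tensor (reduced A ρ) (reduced C ρ))).trace‖}

/-- Uniform clustering of `Φ` with the decay function `ε`, a positive decreasing function on
`[0, ∞)`. -/
def Interaction.UniformClustering {d : ℕ} (Φ : Interaction d) (ε : ℝ → ℝ) : Prop :=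
  (∀ l, 0 ≤ l → 0 < ε l) ∧ AntitoneOn ε (Set.Ici 0) ∧
    ∀ I A B C : Finset ℤ, IsSplit I A B C → ∀ l : ℝ, 0 ≤ l → l ≤ (B.card : ℝ) →
      corr (Φ.gibbs I) A C ≤ ε l

section Entropy

variable {n : Type*} [Fintype n] [DecidableEq n]

/-- The logarithm of a positive definite matrix, by functional calculus. -/
def matLog (M : Matrix n n ℂ) : Matrix n n ℂ := cfc Real.log M

/-- The real power `M ^ p` of a positive definite matrix, by functional calculus. -/
def matPow (M : Matrix n n ℂ) (p : ℝ) : Matrix n n ℂ := cfc (fun x : ℝ => x ^ p) M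

/-- Umegaki relative entropy `Tr[ρ (log ρ - log σ)]` of full-rank states. -/
def relEntropy (ρ σ : Matrix n n ℂ) : ℝ := (ρ * (matLog ρ - matLog σ)).trace.re

/-- Belavkin–Staszewski relative entropy `Tr[ρ log (ρ^{1/2} σ⁻¹ ρ^{1/2})]` of full-rank states. -/
def bsEntropy (ρ σ : Matrix n n ℂ) : ℝ :=
  (ρ * matLog (matPow ρ (1 / 2) * σ⁻¹ * matPow ρ (1 / 2))).trace.re

/-- The `q`-geometric Rényi divergence
`(q - 1)⁻¹ log Tr[σ^{1/2} (σ^{-1/2} ρ σ^{-1/2})^q σ^{1/2}]` of full-rank states for `q > 1`,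
with the usual convention that for `q = 1` it is its limit as `q → 1⁺`, the
Belavkin–Staszewski relative entropy. -/
def geomRenyi (q : ℝ) (ρ σ : Matrix n n ℂ) : ℝ :=
  if q = 1 then bsEntropy ρ σ
  else 1 / (q - 1) * Real.log (matPow σ (1 / 2) *
    matPow (matPow σ (-(1 / 2)) * ρ * matPow σ (-(1 / 2))) q * matPow σ (1 / 2)).trace.re

end Entropy

section MutualInformation

variable {d : ℕ} {I : Finset ℤ}

/-- Mutual information `I_ρ(A : C) = D(ρ_{AC} ‖ ρ_A ⊗ ρ_C)`. -/
def mutualInfo (ρ : Obs d I) (A C : Finset ℤ) : ℝ :=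
  relEntropy (reduced (A ∪ C) ρ) (tensor (reduced A ρ) (reduced C ρ))

/-- The mutual information arising from the Belavkin–Staszewski relative entropy. -/
def bsMutualInfo (ρ : Obs d I) (A C : Finset ℤ) : ℝ :=
  bsEntropy (reduced (A ∪ C) ρ) (tensor (reduced A ρ) (reduced C ρ))

/-- The mutual information arising from the `q`-geometric Rényi divergence. -/
def renyiMutualInfo (q : ℝ) (ρ : Obs d I) (A C : Finset ℤ) : ℝ :=
  geomRenyi q (reduced (A ∪ C) ρ) (tensor (reduced A ρ) (reduced C ρ))

end MutualInformation

end SpinChain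

end

/-! The goal is an operator inequality ρ_AC ≤ (1 + δ) ρ_A ⊗ ρ_C with δ exponentially small. All the
divergences lie below the max-relative entropy, hence below log(1 + δ) ≤ δ, uniformly in q. This is
`relEntropy_le_bsEntropy_le_geomRenyi_le`: the eigenvalues of σ^{-1/2} ρ σ^{-1/2} and the weights of
σ in its eigenbasis make D̂ and D̂_q classical expressions, for which D̂ ≤ D̂_q is Jensen's
inequality and the upper bound is monotonicity. The inequality D ≤ D̂ comes from a variational bound
on the resolvents that generate the logarithm.

To reach the operator inequality, cut the couplings between the three pieces. With H₀ = H_A + H_B +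
H_C, one has e^{-H_I} = e^{-H₀/2} W e^{-H₀/2}, where W = F F* and F = e^{H₀/2} e^{-H_I/2}. The
factor F is a product of two Araki expansionals, one for each cut. In one dimension and for finite
range, the imaginary-time evolution of a boundary term is bounded and quasi-local, since nested
commutators that spread over n shells gain a factor 1/n! (`IsShelling.norm_nestedComm_le`). Hence F
and F⁻¹ are bounded independently of the lengths of the pieces, and W is exponentially close to a
product of operators located near the two cuts (`exists_effective`).

Averaging W over B in the Gibbs state of B alone gives an effective operator S on AC, and ρ_AC is a
multiple of S conjugated by e^{-H_A/2} ⊗ e^{-H_C/2}. Clustering of the Gibbs state of B decouples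
the two cuts, so S is close to a product P ⊗ Q (`exists_slice_approx`), and therefore, after a
scalar normalization, to the product of its own marginals (`norm_marginal_sub_le`). As S is bounded
below, closeness in norm becomes the multiplicative operator inequality, and the conjugation
preserves it (`mutualInfo_chain`). Expanding in matrix units near the cuts costs a power d^{8m};
neighbourhoods of size m equal to a small fraction of ℓ keep this below the decay of correlations.
-/

noncomputable section

namespace SpinChain

open Matrix Finset
open scoped ComplexOrder

/-! ### Integral comparison for the logarithm. -/

section LogComparison

/-- If `∑ w / (x + t) ≤ ∑ w' / (x' + t)` for all `t ≥ 0`, then `∑ w' log x' ≤ ∑ w log x`. -/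
theorem sum_mul_log_le_of_sum_div_le {ι κ : Type*} [Fintype ι] [Fintype κ] (w x : ι → ℝ)
    (w' x' : κ → ℝ) (hx : ∀ i, 0 < x i) (hx' : ∀ i, 0 < x' i) (hw : ∑ i, w i = ∑ i, w' i)
    (h : ∀ t : ℝ, 0 ≤ t → ∑ i, w i / (x i + t) ≤ ∑ i, w' i / (x' i + t)) :
    ∑ i, w' i * Real.log (x' i) ≤ ∑ i, w i * Real.log (x i) := by
  let g : ℝ → ℝ := fun t => ∑ i, w i * (Real.log (t + x i) - Real.log t) -
    ∑ i, w' i * (Real.log (t + x' i) - Real.log t)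
  -- The derivative of `f` is the difference of the two resolvent sums, so `f` decreases. Equal
  -- total weights allow log t to be subtracted everywhere (this is `g`), which gives the limit 0 at
  -- infinity and hence f 0 ≥ 0.
  let f : ℝ → ℝ := fun t => ∑ i, w i * Real.log (t + x i) - ∑ i, w' i * Real.log (t + x' i)
  have hfg : ∀ t, f t = g t := by
    intro t
    simp only [f, g, mul_sub, sum_sub_distrib, ← sum_mul, hw]
    ring
  have hlim : Filter.Tendsto g Filter.atTop (nhds 0) := by
    have h1 := tendsto_finsetSum (univ : Finset ι) (fun i _ =>
      (Real.tendsto_log_comp_add_sub_log (x i)).const_mul (w i))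
    have h2 := tendsto_finsetSum (univ : Finset κ) (fun i _ =>
      (Real.tendsto_log_comp_add_sub_log (x' i)).const_mul (w' i))
    simpa [g] using h1.sub h2
  have hderiv : ∀ t, 0 ≤ t →
      HasDerivAt f (∑ i, w i / (x i + t) - ∑ i, w' i / (x' i + t)) t := by
    intro t ht
    refine HasDerivAt.sub (HasDerivAt.fun_sum fun i _ => ?_) (HasDerivAt.fun_sum fun i _ => ?_)
    · refine ((((hasDerivAt_id t).add_const (x i)).log
        (by have := hx i; positivity)).const_mul (w i)).congr_deriv ?_
      simp [add_comm, div_eq_mul_inv]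
    · refine ((((hasDerivAt_id t).add_const (x' i)).log
        (by have := hx' i; positivity)).const_mul (w' i)).congr_deriv ?_
      simp [add_comm, div_eq_mul_inv]
  have hanti : AntitoneOn f (Set.Ici 0) := by
    refine antitoneOn_of_deriv_nonpos (convex_Ici 0)
      (fun t ht => (hderiv t ht).continuousAt.continuousWithinAt)
      (fun t ht => ?_) (fun t ht => ?_)
    · rw [interior_Ici] at ht
      exact (hderiv t (le_of_lt ht)).differentiableAt.differentiableWithinAt
    · rw [interior_Ici] at ht
      rw [(hderiv t (le_of_lt ht)).deriv]
      linarith [h t (le_of_lt ht)]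
  have h0 : 0 ≤ f 0 := by
    refine le_of_tendsto hlim ?_
    filter_upwards [Filter.eventually_ge_atTop 0] with t ht
    rw [← hfg]
    exact hanti (Set.mem_Ici.2 le_rfl) ht ht
  simp only [f, zero_add] at h0
  linarith

end LogComparison

/-! ### The chain D ≤ D̂ ≤ D̂_q ≤ D_max for matrices. -/

section Matrices

variable {n : Type*} [Fintype n] [DecidableEq n]

theorem trace_mul_cfc {A : Matrix n n ℂ} (hA : A.IsHermitian) (S : Matrix n n ℂ) (f : ℝ → ℝ) :
    (S * cfc f A).trace = ∑ i, ((star (hA.eigenvectorUnitary : Matrix n n ℂ) * S *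
      (hA.eigenvectorUnitary : Matrix n n ℂ)) i i) * (f (hA.eigenvalues i) : ℂ) := by
  rw [hA.cfc_eq, Matrix.IsHermitian.cfc, Unitary.conjStarAlgAut_apply, ← mul_assoc,
    trace_mul_comm, ← mul_assoc, ← mul_assoc, trace]
  refine Finset.sum_congr rfl fun i _ => ?_
  rw [diag_apply, mul_diagonal]
  rfl

/-- On the two finite spectra `f` agrees with one interpolating polynomial, and for monomials the
claim is (Y Y*)^k Y = Y (Y* Y)^k. -/
theorem cfc_mul_conjTranspose_mul (f : ℝ → ℝ) (Y : Matrix n n ℂ) :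
    cfc f (Y * Yᴴ) * Y = Y * cfc f (Yᴴ * Y) := by
  have ha : IsSelfAdjoint (Y * Yᴴ) := isHermitian_mul_conjTranspose_self Y
  have hb : IsSelfAdjoint (Yᴴ * Y) := isHermitian_conjTranspose_mul_self Y
  have hS : (spectrum ℝ (Y * Yᴴ) ∪ spectrum ℝ (Yᴴ * Y)).Finite :=
    finite_real_spectrum.union finite_real_spectrum
  let p := Lagrange.interpolate hS.toFinset id f
  have hp : ∀ x ∈ spectrum ℝ (Y * Yᴴ) ∪ spectrum ℝ (Yᴴ * Y), f x = p.eval x := by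
    intro x hx
    exact (Lagrange.eval_interpolate_at_node f (Set.injOn_id _) (hS.mem_toFinset.2 hx)).symm
  rw [cfc_congr (fun x hx => hp x (Or.inl hx)), cfc_congr (a := Yᴴ * Y) (fun x hx => hp x (Or.inr hx)),
    cfc_polynomial p _ ha, cfc_polynomial p _ hb]
  induction p using Polynomial.induction_on' with
  | add p q hp hq => simp only [map_add, add_mul, mul_add, hp, hq]
  | monomial k c =>
    have : SemiconjBy Y (Yᴴ * Y) (Y * Yᴴ) := by simp [SemiconjBy, mul_assoc]
    simp only [Polynomial.aeval_monomial]
    rw [mul_assoc, ← (this.pow_right k).eq, ← mul_assoc, ← mul_assoc, Algebra.commutes]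

theorem spectrum_pos_of_posDef {A : Matrix n n ℂ} (hA : A.PosDef) {x : ℝ}
    (hx : x ∈ spectrum ℝ A) : 0 < x := by
  rw [hA.isHermitian.spectrum_real_eq_range_eigenvalues] at hx
  obtain ⟨i, rfl⟩ := hx
  exact hA.eigenvalues_pos i

theorem continuousOn_spectrum (A : Matrix n n ℂ) (f : ℝ → ℝ) : ContinuousOn f (spectrum ℝ A) :=
  finite_real_spectrum.continuousOn f

theorem matPow_mul {A : Matrix n n ℂ} (hA : A.PosDef) (p q : ℝ) :
    matPow A p * matPow A q = matPow A (p + q) := by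
  rw [matPow, matPow, matPow, ← cfc_mul _ _ A (continuousOn_spectrum _ _) (continuousOn_spectrum _ _)]
  exact cfc_congr fun x hx => (Real.rpow_add (spectrum_pos_of_posDef hA hx) p q).symm

theorem matPow_one {A : Matrix n n ℂ} (hA : A.PosDef) : matPow A 1 = A := by
  have : IsSelfAdjoint A := hA.isHermitian
  rw [matPow]
  simp only [Real.rpow_one]
  exact cfc_id' ℝ A

theorem matPow_zero {A : Matrix n n ℂ} (hA : A.PosDef) : matPow A 0 = 1 := by
  have : IsSelfAdjoint A := hA.isHermitian
  rw [matPow]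
  simp only [Real.rpow_zero]
  exact cfc_const_one ℝ A

theorem matPow_conjTranspose (A : Matrix n n ℂ) (p : ℝ) : (matPow A p)ᴴ = matPow A p :=
  (cfc_predicate (R := ℝ) (p := IsSelfAdjoint) (fun x : ℝ => x ^ p) A)

omit [DecidableEq n] in
theorem norm_sq_conjTranspose_mul_apply_le (P Q : Matrix n n ℂ) (i : n) :
    ‖(Pᴴ * Q) i i‖ ^ 2 ≤ ((Pᴴ * P) i i).re * ((Qᴴ * Q) i i).re := by
  have e : ∀ P : Matrix n n ℂ, ((Pᴴ * P) i i).re = ∑ j, ‖P j i‖ ^ 2 := by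
    intro P
    simp only [mul_apply, conjTranspose_apply, Complex.re_sum, RCLike.star_def,
      ← Complex.normSq_eq_conj_mul_self, Complex.ofReal_re, Complex.normSq_eq_norm_sq]
  rw [e, e]
  calc ‖(Pᴴ * Q) i i‖ ^ 2 ≤ (∑ j, ‖P j i‖ * ‖Q j i‖) ^ 2 := by
        gcongr
        rw [mul_apply]
        refine (norm_sum_le _ _).trans (Finset.sum_le_sum fun j _ => ?_)
        simp [conjTranspose_apply]
    _ ≤ _ := Finset.sum_mul_sq_le_sq_mul_sq _ _ _

/-- The trial operator `X` bounds a weighted overlap of two states that have the joint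
decomposition `σ = G Gᴴ`, `ρ = G diag(l) Gᴴ`. -/
theorem two_mul_re_trace_sub_le (X G : Matrix n n ℂ) (l : n → ℝ) (hl : ∀ i, 0 < l i)
    (hG : ∀ i, 0 < ((Gᴴ * G) i i).re) (t : ℝ) (ht : 0 ≤ t) :
    2 * (X * (G * diagonal (fun i => (l i : ℂ)) * Gᴴ)).trace.re
      - (Xᴴ * (G * Gᴴ) * X).trace.re
      - t * (X * (G * diagonal (fun i => (l i : ℂ)) * Gᴴ) * Xᴴ).trace.re
      ≤ ∑ i, l i * ((Gᴴ * G) i i).re / (1 / l i + t) := by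
  have e1 : (X * (G * diagonal (fun i => (l i : ℂ)) * Gᴴ)).trace.re
      = ∑ i, l i * ((Gᴴ * (X * G)) i i).re := by
    rw [← mul_assoc, trace_mul_comm, ← mul_assoc X, ← mul_assoc, trace, Complex.re_sum]
    refine sum_congr rfl fun i _ => ?_
    rw [diag_apply, mul_diagonal, mul_comm, Complex.re_ofReal_mul]
  have e2 : (Xᴴ * (G * Gᴴ) * X).trace.re = ∑ i, (((Xᴴ * G)ᴴ * (Xᴴ * G)) i i).re := by
    rw [← mul_assoc, mul_assoc, trace_mul_comm, trace, Complex.re_sum]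
    simp [conjTranspose_mul]
  have e3 : (X * (G * diagonal (fun i => (l i : ℂ)) * Gᴴ) * Xᴴ).trace.re
      = ∑ i, l i * (((X * G)ᴴ * (X * G)) i i).re := by
    rw [show X * (G * diagonal (fun i => (l i : ℂ)) * Gᴴ) * Xᴴ
      = (X * G * diagonal (fun i => (l i : ℂ))) * (Gᴴ * Xᴴ) by simp only [mul_assoc],
      trace_mul_comm, ← mul_assoc, trace, Complex.re_sum]
    refine sum_congr rfl fun i _ => ?_
    rw [diag_apply, mul_diagonal, mul_comm, Complex.re_ofReal_mul, conjTranspose_mul]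
  rw [e1, e2, e3, mul_sum, mul_sum, ← sum_sub_distrib, ← sum_sub_distrib]
  refine sum_le_sum fun i _ => ?_
  have c1 := norm_sq_conjTranspose_mul_apply_le G (X * G) i
  have c2 := norm_sq_conjTranspose_mul_apply_le (Xᴴ * G) G i
  rw [conjTranspose_mul, conjTranspose_conjTranspose] at c2
  rw [mul_assoc Gᴴ X G] at c2
  rw [conjTranspose_mul Xᴴ, conjTranspose_conjTranspose]
  have hq := hG i
  have hli := hl i
  have hre : ((Gᴴ * (X * G)) i i).re ^ 2 ≤ ‖(Gᴴ * (X * G)) i i‖ ^ 2 := by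
    rw [← sq_abs]
    gcongr
    exact Complex.abs_re_le_norm _
  generalize ((Gᴴ * (X * G)) i i).re = z at *
  generalize ‖(Gᴴ * (X * G)) i i‖ = y at *
  generalize ((Gᴴ * G) i i).re = q at *
  generalize ((Gᴴ * X * (Xᴴ * G)) i i).re = a at *
  generalize (((X * G)ᴴ * (X * G)) i i).re = b at *
  have hq' : q ≠ 0 := hq.ne'
  have ha : z ^ 2 / q ≤ a := by rw [div_le_iff₀ hq]; linarith
  have hb : z ^ 2 / q ≤ b := by rw [div_le_iff₀ hq]; linarith
  have hD : 0 < 1 + t * l i := by positivity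
  -- Cauchy–Schwarz has reduced both quadratic terms to z² / q. What remains is a concave quadratic
  -- in z, and completing the square gives its maximum.
  have key : 2 * (l i * z) - z ^ 2 / q - t * (l i * (z ^ 2 / q)) ≤ l i * q / (1 / l i + t) := by
    have : l i * q / (1 / l i + t) = l i ^ 2 * q / (1 + t * l i) := by field_simp
    rw [this, le_div_iff₀ hD]
    have : (2 * (l i * z) - z ^ 2 / q - t * (l i * (z ^ 2 / q))) * (1 + t * l i)
      = l i ^ 2 * q - (l i * q - (1 + t * l i) * z) ^ 2 / q := by field_simp; ring
    rw [this]
    have : 0 ≤ (l i * q - (1 + t * l i) * z) ^ 2 / q := by positivity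
    linarith
  have : t * (l i * (z ^ 2 / q)) ≤ t * (l i * b) := by gcongr
  linarith

theorem conj_apply_self_pos {A : Matrix n n ℂ} (hA : A.PosDef) {U : Matrix n n ℂ}
    (hU : IsUnit U) (i : n) : 0 < ((Uᴴ * A * U) i i).re := by
  have h := (hA.conjTranspose_mul_mul_same (mulVec_injective_of_isUnit hU)).diag_pos (i := i)
  exact (Complex.pos_iff.1 h).1

theorem eq_conj_diagonal {A : Matrix n n ℂ} (hA : A.IsHermitian) :
    A = (hA.eigenvectorUnitary : Matrix n n ℂ) * diagonal (fun i => (hA.eigenvalues i : ℂ)) *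
      (hA.eigenvectorUnitary : Matrix n n ℂ)ᴴ := by
  conv_lhs => rw [hA.spectral_theorem, Unitary.conjStarAlgAut_apply]
  rfl

theorem conj_eigenvectorUnitary_mul {A : Matrix n n ℂ} (hA : A.IsHermitian) :
    (hA.eigenvectorUnitary : Matrix n n ℂ)ᴴ * (hA.eigenvectorUnitary : Matrix n n ℂ) = 1 :=
  Unitary.coe_star_mul_self _

theorem eigenvectorUnitary_mul_conj {A : Matrix n n ℂ} (hA : A.IsHermitian) :
    (hA.eigenvectorUnitary : Matrix n n ℂ) * (hA.eigenvectorUnitary : Matrix n n ℂ)ᴴ = 1 :=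
  Unitary.coe_mul_star_self _

theorem conj_diagonal_mul_apply_self (P : Matrix n n ℂ) (r : n → ℝ) (b : n) :
    (P * diagonal (fun i => (r i : ℂ)) * Pᴴ) b b = ((∑ a, ‖P b a‖ ^ 2 * r a : ℝ) : ℂ) := by
  rw [mul_apply]
  push_cast
  refine sum_congr rfl fun a _ => ?_
  rw [mul_diagonal, conjTranspose_apply, RCLike.star_def, mul_right_comm, Complex.mul_conj,
    Complex.normSq_eq_norm_sq]
  push_cast
  rfl

/-- The ratios s_b / r_a are the eigenvalues of the relative modular operator, and |⟨b|a⟩|² r_a are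
their weights in the vector ρ^{1/2}. In this classical form the logarithm comparison applies. -/
theorem relEntropy_eq {ρ σ : Matrix n n ℂ} (hρ : ρ.PosDef) (hσ : σ.PosDef) (U V : Matrix n n ℂ)
    (hU : U = hρ.isHermitian.eigenvectorUnitary) (hV : V = hσ.isHermitian.eigenvectorUnitary) :
    relEntropy ρ σ = - ∑ ab : n × n, ‖(Vᴴ * U) ab.2 ab.1‖ ^ 2 * hρ.isHermitian.eigenvalues ab.1 *
      Real.log (hσ.isHermitian.eigenvalues ab.2 / hρ.isHermitian.eigenvalues ab.1) := by
  have hUU : Uᴴ * U = 1 := hU ▸ conj_eigenvectorUnitary_mul _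
  have hVV : V * Vᴴ = 1 := hV ▸ eigenvectorUnitary_mul_conj _
  have hρe := hU ▸ eq_conj_diagonal hρ.isHermitian
  have e1 : ∀ a, (Uᴴ * ρ * U) a a = (hρ.isHermitian.eigenvalues a : ℂ) := by
    intro a
    have : Uᴴ * ρ * U = (Uᴴ * U) * diagonal (fun i => (hρ.isHermitian.eigenvalues i : ℂ)) *
        (Uᴴ * U) := by
      conv_lhs => rw [hρe]
      simp only [mul_assoc]
    rw [this, hUU, one_mul, mul_one, diagonal_apply_eq]
  have e2 : Vᴴ * ρ * V = (Vᴴ * U) * diagonal (fun i => (hρ.isHermitian.eigenvalues i : ℂ)) *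
      (Vᴴ * U)ᴴ := by
    conv_lhs => rw [hρe]
    simp only [mul_assoc, conjTranspose_mul, conjTranspose_conjTranspose]
  have hP : ∀ a, ∑ b, ‖(Vᴴ * U) b a‖ ^ 2 = 1 := by
    intro a
    have : ((Vᴴ * U)ᴴ * (Vᴴ * U)) a a = 1 := by
      rw [conjTranspose_mul, conjTranspose_conjTranspose, mul_assoc, ← mul_assoc V, hVV, one_mul,
        hUU, one_apply_eq]
    rw [mul_apply] at this
    simp only [conjTranspose_apply, RCLike.star_def, ← Complex.normSq_eq_conj_mul_self,
      Complex.normSq_eq_norm_sq] at this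
    exact_mod_cast this
  rw [relEntropy, mul_sub, trace_sub, matLog, matLog, trace_mul_cfc hρ.isHermitian,
    trace_mul_cfc hσ.isHermitian, ← hU, ← hV]
  simp only [star_eq_conjTranspose, e1, e2, conj_diagonal_mul_apply_self]
  rw [← sum_neg_distrib, Fintype.sum_prod_type, Complex.sub_re, Complex.re_sum, Complex.re_sum]
  simp only [← Complex.ofReal_mul, Complex.ofReal_re]
  simp only [sum_mul]
  rw [sum_comm (s := univ) (t := univ) (f := fun b a => ‖(Vᴴ * U) b a‖ ^ 2 *
    hρ.isHermitian.eigenvalues a * Real.log (hσ.isHermitian.eigenvalues b)), ← sum_sub_distrib]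
  refine sum_congr rfl fun a _ => ?_
  rw [← one_mul (hρ.isHermitian.eigenvalues a * _), ← hP a, sum_mul, ← sum_sub_distrib]
  refine sum_congr rfl fun b _ => ?_
  rw [Real.log_div (hσ.eigenvalues_pos b).ne' (hρ.eigenvalues_pos a).ne']
  ring

/-- The weighted overlap of the eigenbases, as the value of a quadratic functional. -/
theorem sum_overlap_eq (P : Matrix n n ℂ) (r s : n → ℝ) (hr : ∀ i, 0 < r i) (hs : ∀ i, 0 < s i)
    (t : ℝ) (ht : 0 ≤ t) (Y : Matrix n n ℂ)
    (hY : ∀ b a, Y b a = ((r a / (s b + t * r a) : ℝ) : ℂ) * P b a) :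
    ∑ ab : n × n, ‖P ab.2 ab.1‖ ^ 2 * r ab.1 / (s ab.2 / r ab.1 + t) =
      2 * (Y * diagonal (fun i => (r i : ℂ)) * Pᴴ).trace.re
      - (Yᴴ * diagonal (fun i => (s i : ℂ)) * Y).trace.re
      - t * (Y * diagonal (fun i => (r i : ℂ)) * Yᴴ).trace.re := by
  have e1 : ∀ Q : Matrix n n ℂ, (Y * diagonal (fun i => (r i : ℂ)) * Qᴴ).trace.re =
      ∑ a, ∑ b, r a * (Y b a * star (Q b a)).re := by
    intro Q
    rw [trace, Complex.re_sum, sum_comm]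
    refine sum_congr rfl fun b _ => ?_
    rw [diag_apply, mul_apply, Complex.re_sum]
    refine sum_congr rfl fun a _ => ?_
    rw [mul_diagonal, conjTranspose_apply, mul_right_comm, mul_comm, Complex.re_ofReal_mul]
  have e2 : (Yᴴ * diagonal (fun i => (s i : ℂ)) * Y).trace.re =
      ∑ a, ∑ b, s b * (Y b a * star (Y b a)).re := by
    rw [trace, Complex.re_sum]
    refine sum_congr rfl fun b _ => ?_
    rw [diag_apply, mul_apply, Complex.re_sum]
    refine sum_congr rfl fun a _ => ?_
    rw [mul_diagonal, conjTranspose_apply, mul_right_comm, mul_comm, Complex.re_ofReal_mul,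
      mul_comm (star _)]
  rw [e1, e1, e2, Fintype.sum_prod_type]
  simp only [mul_sum, ← sum_sub_distrib]
  refine sum_congr rfl fun a _ => sum_congr rfl fun b _ => ?_
  have h1 := hr a
  have h2 := hs b
  have h3 : 0 < s b + t * r a := by positivity
  rw [hY]
  have n1 : P b a * star (P b a) = ((‖P b a‖ ^ 2 : ℝ) : ℂ) := by
    rw [RCLike.star_def, Complex.mul_conj, Complex.normSq_eq_norm_sq]
  rw [star_mul', mul_mul_mul_comm, n1, mul_assoc, n1, RCLike.star_def, Complex.conj_ofReal,
    ← Complex.ofReal_mul, ← Complex.ofReal_mul, ← Complex.ofReal_mul, Complex.ofReal_re,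
    Complex.ofReal_re]
  generalize ‖P b a‖ ^ 2 = p
  have : s b / r a + t = (s b + t * r a) / r a := by field_simp
  rw [this]
  field_simp
  ring

/-- The Umegaki relative entropy is at most `∑ λᵢ qᵢ log λᵢ` if `σ = G Gᴴ`,
`ρ = G diag(λ) Gᴴ` and `qᵢ = (Gᴴ G)ᵢᵢ`. -/
theorem relEntropy_le_sum {ρ σ : Matrix n n ℂ} (hρ : ρ.PosDef) (hσ : σ.PosDef)
    (G : Matrix n n ℂ) (l : n → ℝ) (hl : ∀ i, 0 < l i)
    (hG : ∀ i, 0 < ((Gᴴ * G) i i).re) (hσG : σ = G * Gᴴ)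
    (hρG : ρ = G * diagonal (fun i => (l i : ℂ)) * Gᴴ) :
    relEntropy ρ σ ≤ ∑ i, l i * ((Gᴴ * G) i i).re * Real.log (l i) := by
  obtain ⟨U, hU⟩ : ∃ U : Matrix n n ℂ, U = hρ.isHermitian.eigenvectorUnitary := ⟨_, rfl⟩
  obtain ⟨V, hV⟩ : ∃ V : Matrix n n ℂ, V = hσ.isHermitian.eigenvectorUnitary := ⟨_, rfl⟩
  have hUU : Uᴴ * U = 1 := hU ▸ conj_eigenvectorUnitary_mul _
  have hUU' : U * Uᴴ = 1 := hU ▸ eigenvectorUnitary_mul_conj _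
  have hVV : Vᴴ * V = 1 := hV ▸ conj_eigenvectorUnitary_mul _
  have hVV' : V * Vᴴ = 1 := hV ▸ eigenvectorUnitary_mul_conj _
  have hρe := hU ▸ eq_conj_diagonal hρ.isHermitian
  have hσe := hV ▸ eq_conj_diagonal hσ.isHermitian
  rw [relEntropy_eq hρ hσ U V hU hV, neg_le]
  have hr := hρ.eigenvalues_pos
  have hs := hσ.eigenvalues_pos
  generalize hρ.isHermitian.eigenvalues = r at *
  generalize hσ.isHermitian.eigenvalues = s at *
  have htr : ∑ ab : n × n, ‖(Vᴴ * U) ab.2 ab.1‖ ^ 2 * r ab.1 =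
      ∑ i, l i * ((Gᴴ * G) i i).re := by
    have h1 : ρ.trace.re = ∑ ab : n × n, ‖(Vᴴ * U) ab.2 ab.1‖ ^ 2 * r ab.1 := by
      rw [← mul_one ρ, ← hVV', ← mul_assoc, trace_mul_comm, ← mul_assoc]
      have : Vᴴ * ρ * V = (Vᴴ * U) * diagonal (fun i => (r i : ℂ)) * (Vᴴ * U)ᴴ := by
        conv_lhs => rw [hρe]
        simp only [mul_assoc, conjTranspose_mul, conjTranspose_conjTranspose]
      rw [this, trace, Fintype.sum_prod_type, sum_comm]
      simp only [diag_apply, conj_diagonal_mul_apply_self]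
      rw [← Complex.ofReal_sum, Complex.ofReal_re]
    rw [← h1, hρG, trace_mul_comm, ← mul_assoc, trace, Complex.re_sum]
    refine sum_congr rfl fun i _ => ?_
    rw [diag_apply, mul_diagonal, mul_comm, Complex.re_ofReal_mul]
  -- The modular spectrum s_b / r_a is compared with the points 1 / λᵢ; both weight families sum to
  -- Tr ρ.
  have key := sum_mul_log_le_of_sum_div_le
    (fun ab : n × n => ‖(Vᴴ * U) ab.2 ab.1‖ ^ 2 * r ab.1) (fun ab => s ab.2 / r ab.1)
    (fun i => l i * ((Gᴴ * G) i i).re) (fun i => 1 / l i)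
    (fun ab => div_pos (hs _) (hr _)) (fun i => one_div_pos.2 (hl i)) htr ?_
  · simpa [Real.log_inv] using key
  · intro t ht
    -- This is the stationary point of the functional 2 Re Tr(Xρ) - Tr(X*σX) - t Tr(XρX*), written
    -- in the eigenbases of σ and ρ. There the functional equals the modular resolvent, while every
    -- trial operator stays below the sum over λ.
    let Y : Matrix n n ℂ :=
      Matrix.of fun b a => ((r a / (s b + t * r a) : ℝ) : ℂ) * (Vᴴ * U) b a
    rw [sum_overlap_eq (Vᴴ * U) r s hr hs t ht Y fun b a => rfl]
    convert two_mul_re_trace_sub_le (V * Y * Uᴴ) G l hl hG t ht using 3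
    · rw [← hρG, hρe, conjTranspose_mul, conjTranspose_conjTranspose]
      congr 2
      rw [show V * Y * Uᴴ * (U * diagonal (fun i => (r i : ℂ)) * Uᴴ) =
        V * (Y * (Uᴴ * U) * diagonal (fun i => (r i : ℂ)) * Uᴴ) by simp only [mul_assoc],
        trace_mul_comm V, hUU, mul_one, mul_assoc _ Uᴴ V]
    · rw [← hσG, hσe, conjTranspose_mul, conjTranspose_mul, conjTranspose_conjTranspose]
      rw [show U * (Yᴴ * Vᴴ) * (V * diagonal (fun i => (s i : ℂ)) * Vᴴ) * (V * Y * Uᴴ) =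
        U * (Yᴴ * (Vᴴ * V) * diagonal (fun i => (s i : ℂ)) * (Vᴴ * V) * Y * Uᴴ) by
          simp only [mul_assoc], trace_mul_comm U, hVV, mul_one, mul_one, mul_assoc _ Uᴴ U, hUU,
        mul_one]
    · rw [← hρG, hρe, conjTranspose_mul, conjTranspose_mul, conjTranspose_conjTranspose]
      rw [show V * Y * Uᴴ * (U * diagonal (fun i => (r i : ℂ)) * Uᴴ) * (U * (Yᴴ * Vᴴ)) =
        V * (Y * (Uᴴ * U) * diagonal (fun i => (r i : ℂ)) * (Uᴴ * U) * Yᴴ * Vᴴ) by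
          simp only [mul_assoc], trace_mul_comm V, hUU, mul_one, mul_one, mul_assoc _ Vᴴ V, hVV,
        mul_one]

/-- The eigenvalues `λᵢ` of `σ^{-1/2} ρ σ^{-1/2}` and the weights `qᵢ` of `σ` in its eigenbasis
determine the Belavkin–Staszewski entropy and the geometric Rényi divergences. -/
theorem exists_reverse_test {ρ σ : Matrix n n ℂ} (hρ : ρ.PosDef) (hσ : σ.PosDef) {Λ : ℝ}
    (hΛ : (((Λ : ℝ) : ℂ) • σ - ρ).PosSemidef) :
    ∃ (G : Matrix n n ℂ) (l : n → ℝ), (∀ i, 0 < l i) ∧ (∀ i, 0 < ((Gᴴ * G) i i).re) ∧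
      σ = G * Gᴴ ∧ ρ = G * diagonal (fun i => (l i : ℂ)) * Gᴴ ∧ (∀ i, l i ≤ Λ) ∧
      bsEntropy ρ σ = ∑ i, l i * ((Gᴴ * G) i i).re * Real.log (l i) ∧
      ∀ q : ℝ, (matPow σ (1 / 2) * matPow (matPow σ (-(1 / 2)) * ρ * matPow σ (-(1 / 2))) q *
        matPow σ (1 / 2)).trace.re = ∑ i, ((Gᴴ * G) i i).re * l i ^ q := by
  obtain ⟨s, hs⟩ : ∃ s, s = matPow σ (1 / 2) := ⟨_, rfl⟩
  obtain ⟨s', hs'⟩ : ∃ s', s' = matPow σ (-(1 / 2)) := ⟨_, rfl⟩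
  obtain ⟨r, hr⟩ : ∃ r, r = matPow ρ (1 / 2) := ⟨_, rfl⟩
  have hss : s * s = σ := by
    rw [hs, matPow_mul hσ]; norm_num
    rw [matPow_one hσ]
  have hss' : s * s' = 1 := by rw [hs, hs', matPow_mul hσ, ← matPow_zero hσ]; norm_num
  have hs's : s' * s = 1 := by rw [hs, hs', matPow_mul hσ, ← matPow_zero hσ]; norm_num
  have hrr : r * r = ρ := by
    rw [hr, matPow_mul hρ]; norm_num
    rw [matPow_one hρ]
  have hsH : sᴴ = s := hs ▸ matPow_conjTranspose _ _
  have hs'H : s'ᴴ = s' := hs' ▸ matPow_conjTranspose _ _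
  have hrH : rᴴ = r := hr ▸ matPow_conjTranspose _ _
  have hs'u : IsUnit s' := IsUnit.of_mul_eq_one _ hs's
  have hsu : IsUnit s := IsUnit.of_mul_eq_one _ hss'
  obtain ⟨M, hM⟩ : ∃ M, M = s' * ρ * s' := ⟨_, rfl⟩
  have hMpos : M.PosDef := by
    have := hρ.conjTranspose_mul_mul_same (mulVec_injective_of_isUnit hs'u)
    rwa [hs'H, ← hM] at this
  obtain ⟨W, hW⟩ : ∃ W : Matrix n n ℂ, W = hMpos.isHermitian.eigenvectorUnitary := ⟨_, rfl⟩
  have hWW : Wᴴ * W = 1 := hW ▸ conj_eigenvectorUnitary_mul _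
  have hWW' : W * Wᴴ = 1 := hW ▸ eigenvectorUnitary_mul_conj _
  have hWu : IsUnit W := IsUnit.of_mul_eq_one _ hWW'
  have hMe := hW ▸ eq_conj_diagonal hMpos.isHermitian
  have hGG : (s * W)ᴴ * (s * W) = Wᴴ * σ * W := by
    rw [conjTranspose_mul, hsH, ← hss]; simp only [mul_assoc]
  have htr : ∀ f : ℝ → ℝ, (σ * cfc f M).trace.re =
      ∑ i, ((Wᴴ * σ * W) i i).re * f (hMpos.isHermitian.eigenvalues i) := by
    intro f
    rw [trace_mul_cfc hMpos.isHermitian, Complex.re_sum, ← hW]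
    refine sum_congr rfl fun i _ => ?_
    rw [mul_comm, Complex.re_ofReal_mul, mul_comm]
    rfl
  refine ⟨s * W, hMpos.isHermitian.eigenvalues, hMpos.eigenvalues_pos, ?_, ?_, ?_, ?_, ?_, ?_⟩
  · intro i
    rw [hGG]
    exact conj_apply_self_pos hσ hWu i
  · rw [conjTranspose_mul, hsH, ← mul_assoc, mul_assoc s, hWW', mul_one, hss]
  · rw [conjTranspose_mul, hsH]
    rw [show s * W * diagonal (fun i => (hMpos.isHermitian.eigenvalues i : ℂ)) * (Wᴴ * s) =
      s * (W * diagonal (fun i => (hMpos.isHermitian.eigenvalues i : ℂ)) * Wᴴ) * s by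
        simp only [mul_assoc], ← hMe, hM]
    rw [show s * (s' * ρ * s') * s = (s * s') * ρ * (s' * s) by simp only [mul_assoc], hss', hs's,
      one_mul, mul_one]
  · intro i
    have h1 := (hΛ.conjTranspose_mul_mul_same s').conjTranspose_mul_mul_same W
    have h2 : Wᴴ * (s'ᴴ * (((Λ : ℝ) : ℂ) • σ - ρ) * s') * W =
        diagonal (fun i => ((Λ - hMpos.isHermitian.eigenvalues i : ℝ) : ℂ)) := by
      rw [hs'H, mul_sub, sub_mul, ← hM, mul_smul_comm, smul_mul_assoc, ← hss, ← mul_assoc, hs's,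
        one_mul, hss', mul_sub, sub_mul, mul_smul_comm, smul_mul_assoc, mul_one, hWW]
      conv_lhs => rw [hMe]
      rw [show Wᴴ * (W * diagonal (fun i => (hMpos.isHermitian.eigenvalues i : ℂ)) * Wᴴ) * W =
        (Wᴴ * W) * diagonal (fun i => (hMpos.isHermitian.eigenvalues i : ℂ)) * (Wᴴ * W) by
          simp only [mul_assoc], hWW, one_mul, mul_one]
      ext a b
      by_cases hab : a = b
      · subst hab; simp
      · simp [hab]
    rw [h2] at h1
    have h3 := h1.diag_nonneg (i := i)
    rw [diagonal_apply_eq, Complex.zero_le_real] at h3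
    linarith
  · have hinv : σ⁻¹ = s' * s' := by
      refine inv_eq_right_inv ?_
      rw [← hss, mul_assoc, ← mul_assoc s s' s', hss', one_mul, hss']
    have hYs : r * s' * s = r := by rw [mul_assoc, hs's, mul_one]
    have hsY : s * (r * s')ᴴ = r := by
      rw [conjTranspose_mul, hs'H, hrH, ← mul_assoc, hss', one_mul]
    have hYY : (r * s')ᴴ * (r * s') = M := by
      rw [conjTranspose_mul, hs'H, hrH, hM, ← hrr]; simp only [mul_assoc]
    have hYY' : r * (s' * s') * r = (r * s') * (r * s')ᴴ := by
      rw [conjTranspose_mul, hs'H, hrH]; simp only [mul_assoc]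
    -- With Y = ρ^{1/2} σ^{-1/2}, the argument of the logarithm in D̂ is Y Y*, while M = Y* Y. The
    -- intertwining relation moves the logarithm from one to the other.
    have e : (ρ * matLog (r * (s' * s') * r)).trace = (σ * cfc (fun x => x * Real.log x) M).trace := by
      rw [hYY', ← hrr, mul_assoc, trace_mul_comm]
      generalize r * s' = Y at *
      calc (r * matLog (Y * Yᴴ) * r).trace
          = (s * Yᴴ * matLog (Y * Yᴴ) * (Y * s)).trace := by rw [hsY, hYs]
        _ = (s * (Yᴴ * (cfc Real.log (Y * Yᴴ) * Y) * s)).trace := by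
            simp only [mul_assoc, matLog]
        _ = (σ * (M * cfc Real.log M)).trace := by
            rw [cfc_mul_conjTranspose_mul, trace_mul_comm, mul_assoc, hss, trace_mul_comm,
              ← mul_assoc Yᴴ, hYY]
        _ = _ := by
            rw [cfc_mul _ _ M (continuousOn_spectrum _ _) (continuousOn_spectrum _ _),
              cfc_id' ℝ M (show IsSelfAdjoint M from hMpos.isHermitian)]
    rw [bsEntropy, ← hr, hinv, e, htr, hGG]
    refine sum_congr rfl fun i _ => ?_
    ring
  · intro q
    rw [← hs, ← hs', ← hM, trace_mul_comm, ← mul_assoc, hss, matPow, htr, hGG]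

/-- The chain of relative entropies, with the bound by the max-relative entropy. -/
theorem relEntropy_le_bsEntropy_le_geomRenyi_le {ρ σ : Matrix n n ℂ} (hρ : ρ.PosDef)
    (hσ : σ.PosDef) (htr : ρ.trace = 1) {Λ : ℝ}
    (hΛ : (((Λ : ℝ) : ℂ) • σ - ρ).PosSemidef) {q : ℝ} (hq : 1 ≤ q) :
    relEntropy ρ σ ≤ bsEntropy ρ σ ∧ bsEntropy ρ σ ≤ geomRenyi q ρ σ ∧
      geomRenyi q ρ σ ≤ Real.log Λ := by
  obtain ⟨G, l, hl, hG, hσG, hρG, hlΛ, hbs, hren⟩ := exists_reverse_test hρ hσ hΛ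
  have hsum : ∑ i, l i * ((Gᴴ * G) i i).re = 1 := by
    rw [hρG, trace_mul_comm, ← mul_assoc, trace] at htr
    have := congrArg Complex.re htr
    rw [Complex.re_sum] at this
    refine Eq.trans (sum_congr rfl fun i _ => ?_) this
    rw [diag_apply, mul_diagonal, mul_comm, Complex.re_mul_ofReal, mul_comm]
  have hw : ∀ i, 0 < l i * ((Gᴴ * G) i i).re := fun i => mul_pos (hl i) (hG i)
  refine ⟨hbs ▸ relEntropy_le_sum hρ hσ G l hl hG hσG hρG, ?_⟩
  have hbsΛ : bsEntropy ρ σ ≤ Real.log Λ := by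
    rw [hbs, ← one_mul (Real.log Λ), ← hsum, sum_mul]
    exact sum_le_sum fun i _ => mul_le_mul_of_nonneg_left
      (Real.log_le_log (hl i) (hlΛ i)) (hw i).le
  by_cases h1 : q = 1
  · rw [geomRenyi, if_pos h1]
    exact ⟨le_rfl, hbsΛ⟩
  have hq1 : 0 < q - 1 := sub_pos.2 (lt_of_le_of_ne hq (Ne.symm h1))
  have hpow : ∑ i, ((Gᴴ * G) i i).re * l i ^ q =
      ∑ i, l i * ((Gᴴ * G) i i).re * l i ^ (q - 1) := by
    refine sum_congr rfl fun i _ => ?_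
    rw [Real.rpow_sub_one (hl i).ne']
    have := (hl i).ne'
    field_simp
  have hne : Nonempty n := by
    by_contra h
    rw [not_nonempty_iff] at h
    simp at hsum
  rw [geomRenyi, if_neg h1, hren, hpow, hbs, one_div, inv_mul_eq_div, le_div_iff₀ hq1,
    div_le_iff₀ hq1]
  constructor
  -- Jensen for log with the probability weights λᵢ qᵢ, at the points λᵢ^{q-1}.
  · have := strictConcaveOn_log_Ioi.concaveOn.le_map_sum (t := univ)
      (w := fun i => l i * ((Gᴴ * G) i i).re) (p := fun i => l i ^ (q - 1))
      (fun i _ => (hw i).le) hsum (fun i _ => Real.rpow_pos_of_pos (hl i) _)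
    simp only [smul_eq_mul] at this
    refine le_trans (le_of_eq ?_) this
    rw [sum_mul]
    refine sum_congr rfl fun i _ => ?_
    rw [Real.log_rpow (hl i)]
    ring
  · have hΛ0 : 0 < Λ := hne.elim fun i => (hl i).trans_le (hlΛ i)
    rw [mul_comm, ← Real.log_rpow hΛ0]
    refine Real.log_le_log
      (sum_pos (fun i _ => mul_pos (hw i) (Real.rpow_pos_of_pos (hl i) _)) univ_nonempty) ?_
    refine le_of_le_of_eq ?_ (one_mul (Λ ^ (q - 1)))
    rw [← congrArg (· * Λ ^ (q - 1)) hsum, sum_mul]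
    exact sum_le_sum fun i _ => mul_le_mul_of_nonneg_left
      (Real.rpow_le_rpow (hl i).le (hlΛ i) hq1.le) (hw i).le

end Matrices
end SpinChain
end

noncomputable section

namespace SpinChain

/-! ### Conjugation by exponentials as the exponential of a derivation. -/

section ExpConj

open NormedSpace Finset

variable {𝔸 : Type*} [NormedRing 𝔸] [NormedAlgebra ℝ 𝔸] [CompleteSpace 𝔸]

/-- The inner derivation `x ↦ H x - x H` as a continuous linear map. -/
def adL (H : 𝔸) : 𝔸 →L[ℝ] 𝔸 := ContinuousLinearMap.mul ℝ 𝔸 H - (ContinuousLinearMap.mul ℝ 𝔸).flip H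

omit [CompleteSpace 𝔸] in
theorem adL_apply (H x : 𝔸) : adL H x = H * x - x * H := rfl

theorem exp_add_of_commute_real {x y : 𝔸} (h : Commute x y) : exp (x + y) = exp x * exp y := by
  let : NormedAlgebra ℚ 𝔸 := .restrictScalars ℚ ℝ 𝔸
  exact exp_add_of_commute h

theorem exp_mul_exp_neg (x : 𝔸) : exp x * exp (-x) = 1 := by
  rw [← exp_add_of_commute_real (Commute.neg_right rfl), add_neg_cancel, exp_zero]

theorem exp_neg_mul_exp (x : 𝔸) : exp (-x) * exp x = 1 := by
  rw [← exp_add_of_commute_real (Commute.neg_left rfl), neg_add_cancel, exp_zero]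

theorem exp_mulLeft_apply (H x : 𝔸) : exp (ContinuousLinearMap.mul ℝ 𝔸 H) x = exp H * x := by
  have h1 := (exp_series_hasSum_exp' (𝕂 := ℝ) (ContinuousLinearMap.mul ℝ 𝔸 H)).mapL
    (ContinuousLinearMap.apply ℝ 𝔸 x)
  have h2 := (exp_series_hasSum_exp' (𝕂 := ℝ) H).mul_right x
  refine h1.unique (h2.congr_fun fun k => ?_)
  have : ∀ k : ℕ, ((ContinuousLinearMap.mul ℝ 𝔸 H) ^ k) x = H ^ k * x := by
    intro k
    induction k with
    | zero => simp
    | succ k ih => 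
      rw [pow_succ', pow_succ', mul_assoc, ← ih]
      rfl
  simp [this]

theorem exp_mulRight_apply (H x : 𝔸) :
    exp ((ContinuousLinearMap.mul ℝ 𝔸).flip H) x = x * exp H := by
  have h1 := (exp_series_hasSum_exp' (𝕂 := ℝ) ((ContinuousLinearMap.mul ℝ 𝔸).flip H)).mapL
    (ContinuousLinearMap.apply ℝ 𝔸 x)
  have h2 := (exp_series_hasSum_exp' (𝕂 := ℝ) H).mul_left x
  refine h1.unique (h2.congr_fun fun k => ?_)
  have : ∀ k : ℕ, (((ContinuousLinearMap.mul ℝ 𝔸).flip H) ^ k) x = x * H ^ k := by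
    intro k
    induction k with
    | zero => simp
    | succ k ih => 
      rw [pow_succ', pow_succ, ← mul_assoc, ← ih]
      rfl
  simp [this]

/-- Left and right multiplication commute, so the exponential of their difference factors into
multiplication by e^{sH} on the left and by e^{-sH} on the right. -/
theorem hasSum_exp_mul_mul_exp_neg (H x : 𝔸) (s : ℝ) :
    HasSum (fun k : ℕ => (s ^ k / k.factorial) • ((adL H) ^ k) x)
      (exp (s • H) * x * exp (-(s • H))) := by
  have h1 := (exp_series_hasSum_exp' (𝕂 := ℝ) (s • adL H)).mapL (ContinuousLinearMap.apply ℝ 𝔸 x)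
  have hc : Commute (ContinuousLinearMap.mul ℝ 𝔸 (s • H))
      ((ContinuousLinearMap.mul ℝ 𝔸).flip (-(s • H))) := by
    ext y
    simp [mul_assoc]
  have h2 : exp (s • adL H) x = exp (s • H) * x * exp (-(s • H)) := by
    have : s • adL H = ContinuousLinearMap.mul ℝ 𝔸 (s • H) +
        (ContinuousLinearMap.mul ℝ 𝔸).flip (-(s • H)) := by
      ext y
      simp [adL_apply, sub_eq_add_neg, smul_add]
    rw [this, exp_add_of_commute_real hc]
    refine (exp_mulLeft_apply _ _).trans ?_
    rw [mul_assoc]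
    exact congrArg _ (exp_mulRight_apply _ _)
  rw [← h2]
  refine h1.congr_fun fun k => ?_
  have hk : ((s • adL H) ^ k) x = s ^ k • ((adL H) ^ k) x := by
    induction k with
    | zero => simp
    | succ k ih =>
      calc ((s • adL H) ^ (k + 1)) x = s • adL H (((s • adL H) ^ k) x) := by rw [pow_succ']; rfl
        _ = s ^ (k + 1) • adL H (((adL H) ^ k) x) := by
          rw [ih, map_smul, smul_smul, ← pow_succ']
        _ = _ := by rw [pow_succ' (adL H)]; rfl
  rw [div_eq_inv_mul, ← smul_smul, ← hk]
  rfl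

end ExpConj

/-! ### Araki's locality estimates for imaginary-time evolution and expansionals. -/

section Shells

open NormedSpace Finset

variable {𝔸 : Type*} [NormedRing 𝔸]

/-- The part of `[H, ·]^k V` that has spread exactly to the `n`-th neighbourhood, for a Hamiltonian
`H = ∑ D k` that is decomposed into shells. -/
def nestedComm (D : ℕ → 𝔸) (V : 𝔸) : ℕ → ℕ → 𝔸
  | 0, 0 => V
  | 0, _ + 1 => 0
  | _ + 1, 0 => 0
  | k + 1, n + 1 => ((∑ j ∈ range (n + 1), D j) * nestedComm D V k (n + 1) -
      nestedComm D V k (n + 1) * ∑ j ∈ range (n + 1), D j) +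
      (D n * nestedComm D V k n - nestedComm D V k n * D n)

/-- A Hamiltonian `∑ D k` in shells around a local operator `V`, with the algebras `S n` of
operators on increasing neighbourhoods. -/
structure IsShelling (D : ℕ → 𝔸) (V : 𝔸) (S : ℕ → Subring 𝔸) (b : ℝ) : Prop where
  mono : Monotone S
  mem_zero : V ∈ S 0
  mem_succ : ∀ k, D k ∈ S (k + 1)
  commute : ∀ k n, n < k → ∀ x ∈ S n, Commute (D k) x
  norm_le : ∀ k, ‖D k‖ ≤ b

variable {D : ℕ → 𝔸} {V : 𝔸} {S : ℕ → Subring 𝔸} {b : ℝ}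

theorem IsShelling.sum_mem (h : IsShelling D V S b) (n : ℕ) : ∑ j ∈ range n, D j ∈ S n :=
  _root_.sum_mem fun j hj => h.mono (mem_range.1 hj) (h.mem_succ j)

theorem IsShelling.nestedComm_mem (h : IsShelling D V S b) (k n : ℕ) :
    nestedComm D V k n ∈ S n := by
  induction k generalizing n with
  | zero => cases n with
    | zero => exact h.mem_zero
    | succ n => exact zero_mem _
  | succ k ih => cases n with
    | zero => exact zero_mem _
    | succ n =>
      have h1 := h.sum_mem (n + 1)
      have h2 := ih (n + 1)
      have h3 := h.mem_succ n
      have h4 := h.mono (Nat.le_succ n) (ih n)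
      exact add_mem (sub_mem (mul_mem h1 h2) (mul_mem h2 h1))
        (sub_mem (mul_mem h3 h4) (mul_mem h4 h3))

theorem norm_comm_le (x y : 𝔸) {b : ℝ} (h : ‖x‖ ≤ b) : ‖x * y - y * x‖ ≤ 2 * b * ‖y‖ := by
  have h1 := norm_mul_le x y
  have h2 := norm_mul_le y x
  have h3 := norm_sub_le (x * y) (y * x)
  nlinarith [norm_nonneg y]

theorem IsShelling.norm_sum_le (h : IsShelling D V S b) (n : ℕ) :
    ‖∑ j ∈ range n, D j‖ ≤ n * b := by
  refine (norm_sum_le_of_le _ fun j _ => h.norm_le j).trans ?_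
  simp

/-- Induction on k. A commutator that leaves the spread at n costs 2nb, but reaching n from n - 1
uses a single shell and costs only 2b. The saved factor n pays for the passage from (n-1)! to n!.
Each of the two contributions is then at most half of the new bound. -/
theorem IsShelling.norm_nestedComm_le (h : IsShelling D V S b) (k n : ℕ) :
    ‖nestedComm D V k n‖ ≤ ‖V‖ * ((4 * b * n) ^ k / n.factorial) := by
  have hb : 0 ≤ b := (norm_nonneg _).trans (h.norm_le 0)
  induction k generalizing n with
  | zero => cases n with
    | zero => simp [nestedComm]
    | succ n =>
      simp only [nestedComm, norm_zero]
      positivity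
  | succ k ih => cases n with
    | zero =>
      simp only [nestedComm, norm_zero]
      positivity
    | succ n =>
      rw [nestedComm]
      have h1 := norm_comm_le _ (nestedComm D V k (n + 1)) (h.norm_sum_le (n + 1))
      have h2 := norm_comm_le _ (nestedComm D V k n) (h.norm_le n)
      have h3 := norm_add_le ((∑ j ∈ range (n + 1), D j) * nestedComm D V k (n + 1) -
        nestedComm D V k (n + 1) * ∑ j ∈ range (n + 1), D j)
        (D n * nestedComm D V k n - nestedComm D V k n * D n)
      have h4 : 2 * (((n + 1 : ℕ) : ℝ) * b) * ‖nestedComm D V k (n + 1)‖ ≤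
          2 * (((n + 1 : ℕ) : ℝ) * b) *
            (‖V‖ * ((4 * b * (n + 1 : ℕ)) ^ k / (n + 1).factorial)) := by
        gcongr
        exact ih (n + 1)
      have h5 : 2 * b * ‖nestedComm D V k n‖ ≤
          2 * (((n + 1 : ℕ) : ℝ) * b) *
            (‖V‖ * ((4 * b * (n + 1 : ℕ)) ^ k / (n + 1).factorial)) := by
        calc 2 * b * ‖nestedComm D V k n‖
            ≤ 2 * b * (‖V‖ * ((4 * b * (n + 1 : ℕ)) ^ k / n.factorial)) := by
              gcongr
              refine (ih n).trans ?_
              gcongr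
              omega
          _ = _ := by
              rw [Nat.factorial_succ]
              have : (n.factorial : ℝ) ≠ 0 := by positivity
              push_cast
              field_simp
      calc _ ≤ 2 * (((n + 1 : ℕ) : ℝ) * b) *
            (‖V‖ * ((4 * b * (n + 1 : ℕ)) ^ k / (n + 1).factorial)) + 2 * (((n + 1 : ℕ) : ℝ) * b) *
            (‖V‖ * ((4 * b * (n + 1 : ℕ)) ^ k / (n + 1).factorial)) := by linarith
        _ = _ := by ring

/-- The recursion books each commutator under the neighbourhood it reaches. When shell N is added,
its commutators with all parts of spread below N vanish, so only the top part contributes a new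
term. -/
theorem IsShelling.sum_nestedComm_succ (h : IsShelling D V S b) (N k : ℕ) :
    ∑ n ∈ range (N + 1), nestedComm D V (k + 1) n =
      (∑ j ∈ range N, D j) * (∑ n ∈ range (N + 1), nestedComm D V k n) -
      (∑ n ∈ range (N + 1), nestedComm D V k n) * ∑ j ∈ range N, D j := by
  induction N with
  | zero => simp [nestedComm]
  | succ N ih =>
    have hc : ∀ n ∈ range N, D N * nestedComm D V k n - nestedComm D V k n * D N = 0 := by
      intro n hn
      rw [(h.commute N n (mem_range.1 hn) _ (h.nestedComm_mem k n)).eq, sub_self]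
    have hc' : D N * (∑ n ∈ range (N + 1), nestedComm D V k n) -
        (∑ n ∈ range (N + 1), nestedComm D V k n) * D N =
        D N * nestedComm D V k N - nestedComm D V k N * D N := by
      rw [mul_sum, sum_mul, ← sum_sub_distrib, sum_range_succ, sum_eq_zero hc, zero_add]
    rw [sum_range_succ _ (N + 1), ih, nestedComm, ← hc',
      sum_range_succ (nestedComm D V k) (N + 1), sum_range_succ D N]
    generalize ∑ n ∈ range (N + 1), nestedComm D V k n = x
    generalize ∑ j ∈ range N, D j = y
    noncomm_ring

variable [NormedAlgebra ℝ 𝔸]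

theorem IsShelling.adL_pow_apply (h : IsShelling D V S b) (N k : ℕ) :
    ((adL (∑ j ∈ range N, D j)) ^ k) V = ∑ n ∈ range (N + 1), nestedComm D V k n := by
  induction k with
  | zero =>
    rw [sum_range_succ']
    simp [nestedComm]
  | succ k ih =>
    rw [h.sum_nestedComm_succ, ← ih, pow_succ']
    rfl

/-- The constant in the locality estimate for the complex time evolution. -/
def shellConst (b : ℝ) : ℝ := Real.exp (Real.exp (4 * b + 1))

/-- Since n ≥ M, a factor e^n can be traded for e^{-M}; the factorial still makes the remaining
series converge to a double exponential. -/
theorem sum_exp_mul_div_factorial_le (x : ℝ) (M N : ℕ) :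
    ∑ n ∈ Ico M N, Real.exp (x * n) / n.factorial ≤
      Real.exp (Real.exp (x + 1)) * Real.exp (-M) := by
  calc ∑ n ∈ Ico M N, Real.exp (x * n) / n.factorial
      ≤ ∑ n ∈ Ico M N, Real.exp (x + 1) ^ n / n.factorial * Real.exp (-M) := by
        refine sum_le_sum fun n hn => ?_
        rw [div_mul_eq_mul_div]
        gcongr
        rw [← Real.exp_nat_mul, ← Real.exp_add]
        gcongr
        have : (M : ℝ) ≤ n := by exact_mod_cast (mem_Ico.1 hn).1
        linarith
    _ = (∑ n ∈ Ico M N, Real.exp (x + 1) ^ n / n.factorial) * Real.exp (-M) := by rw [sum_mul]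
    _ ≤ _ := by
        gcongr
        refine le_trans ?_ (Real.sum_le_exp_of_nonneg (Real.exp_pos _).le N)
        refine sum_le_sum_of_subset_of_nonneg ?_ fun i _ _ => by positivity
        intro i hi
        exact mem_range.2 (mem_Ico.1 hi).2

/-- The operator `V` in imaginary time, evolved with the first `N` shells. -/
def evolve (D : ℕ → 𝔸) (V : 𝔸) (N : ℕ) (s : ℝ) : 𝔸 :=
  exp (s • ∑ j ∈ range N, D j) * V * exp (-(s • ∑ j ∈ range N, D j))

/-- Summing over k turns (4bn)^k / k! into e^{4bn}, leaving the factor 1/n! for the sum over n. A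
general index set `T` covers both a truncated evolution and the difference of two truncations. -/
theorem IsShelling.norm_sum_series_le (h : IsShelling D V S b) {s : ℝ} (h0 : 0 ≤ s) (h1 : s ≤ 1)
    (T : Finset ℕ) (a : 𝔸)
    (ha : HasSum (fun k : ℕ => (s ^ k / k.factorial) • ∑ n ∈ T, nestedComm D V k n) a) :
    ‖a‖ ≤ ‖V‖ * ∑ n ∈ T, Real.exp (4 * b * n) / n.factorial := by
  have hb : 0 ≤ b := (norm_nonneg _).trans (h.norm_le 0)
  have hs : HasSum (fun k : ℕ => ‖V‖ * ∑ n ∈ T, ((4 * b * n) ^ k / k.factorial) / n.factorial)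
      (‖V‖ * ∑ n ∈ T, Real.exp (4 * b * n) / n.factorial) := by
    refine HasSum.mul_left _ (hasSum_sum fun n _ => HasSum.div_const ?_ _)
    rw [Real.exp_eq_exp_ℝ]
    exact expSeries_div_hasSum_exp (4 * b * n)
  refine ha.norm_le_of_bounded hs fun k => ?_
  rw [norm_smul, mul_sum]
  calc ‖s ^ k / k.factorial‖ * ‖∑ n ∈ T, nestedComm D V k n‖
      ≤ (1 / k.factorial) * ∑ n ∈ T, ‖V‖ * ((4 * b * n) ^ k / n.factorial) := by
        gcongr
        · rw [norm_div, norm_pow, Real.norm_of_nonneg h0]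
          simp only [RCLike.norm_natCast]
          gcongr
          exact pow_le_one₀ h0 h1
        · exact norm_sum_le_of_le _ fun n _ => h.norm_nestedComm_le k n
    _ = _ := by
        rw [mul_sum]
        refine sum_congr rfl fun n _ => ?_
        field_simp

variable [CompleteSpace 𝔸]

theorem IsShelling.hasSum_evolve (h : IsShelling D V S b) (N : ℕ) (s : ℝ) :
    HasSum (fun k : ℕ => (s ^ k / k.factorial) • ∑ n ∈ range (N + 1), nestedComm D V k n)
      (evolve D V N s) := by
  refine (hasSum_exp_mul_mul_exp_neg (∑ j ∈ range N, D j) V s).congr_fun fun k => ?_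
  rw [h.adL_pow_apply]

theorem IsShelling.norm_evolve_le (h : IsShelling D V S b) {s : ℝ} (h0 : 0 ≤ s) (h1 : s ≤ 1)
    (N : ℕ) : ‖evolve D V N s‖ ≤ ‖V‖ * shellConst b := by
  refine (h.norm_sum_series_le h0 h1 _ _ (h.hasSum_evolve N s)).trans ?_
  gcongr
  rw [range_eq_Ico]
  refine (sum_exp_mul_div_factorial_le (4 * b) 0 (N + 1)).trans ?_
  simp [shellConst]

theorem IsShelling.norm_evolve_sub_le (h : IsShelling D V S b) {s : ℝ} (h0 : 0 ≤ s) (h1 : s ≤ 1)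
    {M N : ℕ} (hMN : M ≤ N) :
    ‖evolve D V N s - evolve D V M s‖ ≤ ‖V‖ * shellConst b * Real.exp (-M) := by
  -- The two truncations share all parts of spread at most M, so only n from M + 1 to N survives.
  have hs := (h.hasSum_evolve N s).sub (h.hasSum_evolve M s)
  have hs' := h.norm_sum_series_le h0 h1 (Ico (M + 1) (N + 1)) _ (hs.congr_fun fun k => by
    rw [← smul_sub, ← sum_Ico_eq_sub _ (by omega)])
  refine hs'.trans ?_
  rw [mul_assoc]
  gcongr
  refine (sum_exp_mul_div_factorial_le (4 * b) (M + 1) (N + 1)).trans ?_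
  rw [shellConst]
  gcongr
  simp

/-- `e^{s H} e^{-s (H + V)}` for the Hamiltonian `H` of the first `N` shells. -/
def expansional (D : ℕ → 𝔸) (V : 𝔸) (N : ℕ) (s : ℝ) : 𝔸 :=
  exp (s • ∑ j ∈ range N, D j) * exp (-(s • (∑ j ∈ range N, D j + V)))

/-- The inverse `e^{s (H + V)} e^{-s H}` of the expansional. -/
def expansionalInv (D : ℕ → 𝔸) (V : 𝔸) (N : ℕ) (s : ℝ) : 𝔸 :=
  exp (s • (∑ j ∈ range N, D j + V)) * exp (-(s • ∑ j ∈ range N, D j))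

theorem expansional_mul_inv (D : ℕ → 𝔸) (V : 𝔸) (N : ℕ) (s : ℝ) :
    expansional D V N s * expansionalInv D V N s = 1 := by
  rw [expansional, expansionalInv, mul_assoc, ← mul_assoc (exp (-_)), exp_neg_mul_exp, one_mul,
    exp_mul_exp_neg]

theorem hasDerivAt_exp_smul_mul_exp_neg_smul (H K : 𝔸) (s : ℝ) :
    HasDerivAt (fun s : ℝ => exp (s • H) * exp (-(s • K)))
      (exp (s • H) * (H - K) * exp (-(s • K))) s := by
  have h1 := hasDerivAt_exp_smul_const (𝕂 := ℝ) H s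
  have h2 := hasDerivAt_exp_smul_const' (𝕂 := ℝ) (-K) s
  have h3 := h1.mul h2
  simp only [smul_neg] at h3
  refine h3.congr_deriv ?_
  simp only [mul_add, add_mul, mul_assoc, neg_mul, mul_neg, sub_eq_add_neg]

theorem hasDerivAt_expansional (D : ℕ → 𝔸) (V : 𝔸) (N : ℕ) (s : ℝ) :
    HasDerivAt (expansional D V N) (-(evolve D V N s * expansional D V N s)) s := by
  refine (hasDerivAt_exp_smul_mul_exp_neg_smul _ _ s).congr_deriv ?_
  rw [evolve, expansional, mul_assoc _ (exp (-_)), ← mul_assoc (exp (-_)), exp_neg_mul_exp,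
    one_mul]
  simp only [sub_add_cancel_left, mul_neg, neg_mul]

theorem hasDerivAt_expansionalInv (D : ℕ → 𝔸) (V : 𝔸) (N : ℕ) (s : ℝ) :
    HasDerivAt (expansionalInv D V N) (expansionalInv D V N s * evolve D V N s) s := by
  refine (hasDerivAt_exp_smul_mul_exp_neg_smul _ _ s).congr_deriv ?_
  rw [evolve, expansionalInv, add_sub_cancel_left]
  generalize s • ∑ j ∈ range N, D j = H
  rw [mul_assoc, mul_assoc, mul_assoc (exp H), ← mul_assoc (exp (-H)), exp_neg_mul_exp, one_mul]

variable [NormOneClass 𝔸]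

omit [CompleteSpace 𝔸] in
-- Grönwall for a linear equation. The rate is the bound on the evolved boundary term, so the result
-- does not depend on the number of shells.
theorem norm_le_exp_of_norm_deriv_le {f f' : ℝ → 𝔸} {c : ℝ} (hf : ∀ s, HasDerivAt f (f' s) s)
    (h0 : f 0 = 1) (hc : 0 ≤ c) (hb : ∀ s, 0 ≤ s → s ≤ 1 → ‖f' s‖ ≤ c * ‖f s‖) {s : ℝ} (hs : 0 ≤ s)
    (hs1 : s ≤ 1) : ‖f s‖ ≤ Real.exp c := by
  have h := norm_le_gronwallBound_of_norm_deriv_right_le (f := f) (f' := f') (δ := 1) (K := c)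
    (ε := 0) (a := 0) (b := 1) (fun x _ => (hf x).continuousAt.continuousWithinAt)
    (fun x _ => (hf x).hasDerivWithinAt) (by rw [h0, norm_one])
    (fun x hx => by rw [add_zero]; exact hb x hx.1 hx.2.le) s ⟨hs, hs1⟩
  rw [gronwallBound_ε0, one_mul, sub_zero] at h
  refine h.trans (Real.exp_le_exp.2 ?_)
  nlinarith

omit [CompleteSpace 𝔸] [NormOneClass 𝔸] in
theorem expansional_zero (D : ℕ → 𝔸) (V : 𝔸) (N : ℕ) : expansional D V N 0 = 1 := by
  simp [expansional]

omit [CompleteSpace 𝔸] [NormOneClass 𝔸] in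
theorem expansionalInv_zero (D : ℕ → 𝔸) (V : 𝔸) (N : ℕ) : expansionalInv D V N 0 = 1 := by
  simp [expansionalInv]

theorem IsShelling.norm_expansional_le (h : IsShelling D V S b) {s : ℝ} (h0 : 0 ≤ s) (h1 : s ≤ 1)
    (N : ℕ) : ‖expansional D V N s‖ ≤ Real.exp (‖V‖ * shellConst b) := by
  refine norm_le_exp_of_norm_deriv_le (hasDerivAt_expansional D V N) (expansional_zero D V N)
    (by have := Real.exp_pos (Real.exp (4 * b + 1)); rw [shellConst]; positivity) ?_ h0 h1
  intro s h0 h1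
  rw [norm_neg]
  refine (norm_mul_le _ _).trans ?_
  gcongr
  exact h.norm_evolve_le h0 h1 N

theorem IsShelling.norm_expansionalInv_le (h : IsShelling D V S b) {s : ℝ} (h0 : 0 ≤ s)
    (h1 : s ≤ 1) (N : ℕ) : ‖expansionalInv D V N s‖ ≤ Real.exp (‖V‖ * shellConst b) := by
  refine norm_le_exp_of_norm_deriv_le (hasDerivAt_expansionalInv D V N)
    (expansionalInv_zero D V N)
    (by have := Real.exp_pos (Real.exp (4 * b + 1)); rw [shellConst]; positivity) ?_ h0 h1
  intro s h0 h1
  refine (norm_mul_le _ _).trans ?_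
  rw [mul_comm]
  gcongr
  exact h.norm_evolve_le h0 h1 N

/-- Duhamel: with F_N the expansional of N shells, F_M⁻¹ F_N starts at 1 and its derivative contains
the difference of two evolutions, of order e^{-M}. The cube comes from the bounds on F_M, F_M⁻¹ and
F_N. -/
theorem IsShelling.norm_expansional_sub_le (h : IsShelling D V S b) {s : ℝ} (h0 : 0 ≤ s)
    (h1 : s ≤ 1) {M N : ℕ} (hMN : M ≤ N) :
    ‖expansional D V N s - expansional D V M s‖ ≤
      Real.exp (‖V‖ * shellConst b) ^ 3 * (‖V‖ * shellConst b) * Real.exp (-M) := by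
  set g := Real.exp (‖V‖ * shellConst b) with hg
  set c := ‖V‖ * shellConst b with hc
  have hc0 : 0 ≤ c := by
    have := Real.exp_pos (Real.exp (4 * b + 1)); rw [hc, shellConst]; positivity
  have hd : ∀ s, HasDerivAt (fun s => expansionalInv D V M s * expansional D V N s)
      (expansionalInv D V M s * (evolve D V M s - evolve D V N s) * expansional D V N s) s := by
    intro s
    refine ((hasDerivAt_expansionalInv D V M s).mul (hasDerivAt_expansional D V N s)).congr_deriv ?_
    noncomm_ring
  have hb : ∀ x ∈ Set.Ico (0 : ℝ) 1,
      ‖expansionalInv D V M x * (evolve D V M x - evolve D V N x) * expansional D V N x‖ ≤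
        g * (c * Real.exp (-M)) * g := by
    intro x hx
    refine (norm_mul_le _ _).trans ?_
    gcongr
    · refine (norm_mul_le _ _).trans ?_
      gcongr
      · exact h.norm_expansionalInv_le hx.1 hx.2.le M
      · rw [norm_sub_rev]
        exact h.norm_evolve_sub_le hx.1 hx.2.le hMN
    · exact h.norm_expansional_le hx.1 hx.2.le N
  have key := norm_image_sub_le_of_norm_deriv_le_segment'
    (fun x _ => (hd x).hasDerivWithinAt) hb s ⟨h0, h1⟩
  rw [expansional_zero, expansionalInv_zero, one_mul, sub_zero] at key
  have e : expansional D V N s - expansional D V M s = expansional D V M s *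
      (expansionalInv D V M s * expansional D V N s - 1) := by
    rw [mul_sub, ← mul_assoc, expansional_mul_inv, one_mul, mul_one]
  rw [e]
  calc _ ≤ g * (g * (c * Real.exp (-M)) * g * s) := by
        refine (norm_mul_le _ _).trans ?_
        gcongr
        exact h.norm_expansional_le h0 h1 M
    _ ≤ g * (g * (c * Real.exp (-M)) * g * 1) := by gcongr
    _ = _ := by ring

end Shells
end SpinChain
end

noncomputable section

namespace SpinChain

open Matrix Finset
open scoped ComplexOrder MatrixOrder Kronecker

/-! ### Embeddings of local algebras and tensor products. -/

section Embedding

variable {d : ℕ} {X Y Λ : Finset ℤ}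

/-- Configurations on a disjoint union. -/
def configEquiv (d : ℕ) (hX : X ⊆ Λ) (hY : Y ⊆ Λ) (hd : Disjoint X Y) (hu : Λ ⊆ X ∪ Y) :
    Config d Λ ≃ Config d X × Config d Y where
  toFun s := (restr hX s, restr hY s)
  invFun p x := if hx : (x : ℤ) ∈ X then p.1 ⟨x, hx⟩
    else p.2 ⟨x, (mem_union.1 (hu x.2)).resolve_left hx⟩
  left_inv s := by
    funext x
    by_cases hx : (x : ℤ) ∈ X <;> simp [hx, restr]
  right_inv p := by
    ext x
    · simp [restr]
    · have : (x : ℤ) ∉ X := fun h => (disjoint_left.1 hd h) x.2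
      simp [restr, this]

theorem restr_glue (h : X ⊆ Λ) (p : Config d X) (u : Config d (Λ \ X)) :
    restr h (glue p u) = p := by
  funext x
  simp [restr, glue]

theorem restr_sdiff_glue (p : Config d X) (u : Config d (Λ \ X)) :
    restr sdiff_subset (glue p u) = u := by
  funext x
  have := (mem_sdiff.1 x.2).2
  simp [restr, glue, this]

/-- Splitting off the sites outside of `X`. -/
def glueEquiv (d : ℕ) (h : X ⊆ Λ) : Config d X × Config d (Λ \ X) ≃ Config d Λ where
  toFun p := glue p.1 p.2
  invFun s := (restr h s, restr sdiff_subset s)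
  left_inv p := Prod.ext (restr_glue h p.1 p.2) (restr_sdiff_glue p.1 p.2)
  right_inv s := by
    funext x
    by_cases hx : (x : ℤ) ∈ X <;> simp [hx, restr, glue]

theorem embed_apply_eq (h : X ⊆ Λ) (Q : Obs d X) (s t : Config d Λ) :
    embed h Q s t = if restr (sdiff_subset (t := X)) s = restr sdiff_subset t then
      Q (restr h s) (restr h t) else 0 := by
  rw [embed, of_apply]
  congr 1
  refine propext ⟨fun H => funext fun x => ?_, fun H x hx => ?_⟩
  · exact H ⟨x, (mem_sdiff.1 x.2).1⟩ (mem_sdiff.1 x.2).2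
  · exact congrFun H ⟨x, mem_sdiff.2 ⟨x.2, hx⟩⟩

theorem embed_glue (h : X ⊆ Λ) (Q : Obs d X) (p p' : Config d X) (u u' : Config d (Λ \ X)) :
    embed h Q (glue p u) (glue p' u') = if u = u' then Q p p' else 0 := by
  rw [embed_apply_eq]
  simp only [restr_glue, restr_sdiff_glue]

theorem embed_eq_kronecker (h : X ⊆ Λ) (Q : Obs d X) :
    embed h Q = (Q ⊗ₖ (1 : Obs d (Λ \ X))).submatrix
      (glueEquiv d h).symm (glueEquiv d h).symm := by
  ext s t
  obtain ⟨⟨p, u⟩, rfl⟩ := (glueEquiv d h).surjective s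
  obtain ⟨⟨p', u'⟩, rfl⟩ := (glueEquiv d h).surjective t
  rw [submatrix_apply, Equiv.symm_apply_apply, Equiv.symm_apply_apply]
  refine (embed_glue h Q p p' u u').trans ?_
  simp [one_apply]

/-- `embed` as a homomorphism of `*`-algebras. -/
def embedHom (d : ℕ) (h : X ⊆ Λ) : Obs d X →⋆ₐ[ℂ] Obs d Λ where
  toFun := embed h
  map_one' := by rw [embed_eq_kronecker, one_kronecker_one, submatrix_one_equiv]
  map_mul' Q R := by
    rw [embed_eq_kronecker, embed_eq_kronecker, embed_eq_kronecker, submatrix_mul_equiv,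
      ← mul_kronecker_mul, mul_one]
  map_zero' := by rw [embed_eq_kronecker, zero_kronecker]; rfl
  map_add' Q R := by
    rw [embed_eq_kronecker, embed_eq_kronecker, embed_eq_kronecker, add_kronecker]; rfl
  commutes' c := by
    rw [Algebra.algebraMap_eq_smul_one, Algebra.algebraMap_eq_smul_one, embed_eq_kronecker,
      smul_kronecker, one_kronecker_one]
    ext s t
    simp [one_apply]
  map_star' Q := by
    ext s t
    rw [star_eq_conjTranspose, star_eq_conjTranspose, conjTranspose_apply, embed_apply_eq,
      embed_apply_eq]
    by_cases H : restr (sdiff_subset (t := X)) s = restr sdiff_subset t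
    · rw [if_pos H, if_pos H.symm, conjTranspose_apply]
    · rw [if_neg H, if_neg (Ne.symm H), star_zero]

theorem embedHom_apply (h : X ⊆ Λ) (Q : Obs d X) : embedHom d h Q = embed h Q := rfl

theorem embed_mul (h : X ⊆ Λ) (Q R : Obs d X) : embed h (Q * R) = embed h Q * embed h R :=
  map_mul (embedHom d h) Q R

theorem embed_one (h : X ⊆ Λ) : embed h (1 : Obs d X) = 1 := map_one (embedHom d h)

theorem embed_add (h : X ⊆ Λ) (Q R : Obs d X) : embed h (Q + R) = embed h Q + embed h R :=
  map_add (embedHom d h) Q R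

theorem embed_sub (h : X ⊆ Λ) (Q R : Obs d X) : embed h (Q - R) = embed h Q - embed h R :=
  map_sub (embedHom d h) Q R

theorem embed_smul (h : X ⊆ Λ) (c : ℂ) (Q : Obs d X) : embed h (c • Q) = c • embed h Q :=
  map_smul (embedHom d h) c Q

theorem embed_conjTranspose (h : X ⊆ Λ) (Q : Obs d X) : embed h Qᴴ = (embed h Q)ᴴ :=
  map_star (embedHom d h) Q

theorem embed_isHermitian (h : X ⊆ Λ) {Q : Obs d X} (hQ : Q.IsHermitian) :
    (embed h Q).IsHermitian := by
  rw [IsHermitian, ← embed_conjTranspose, hQ.eq]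

theorem embed_nonneg (h : X ⊆ Λ) {Q : Obs d X} (hQ : 0 ≤ Q) : 0 ≤ embed h Q :=
  map_nonneg (embedHom d h) hQ

theorem continuous_embed (h : X ⊆ Λ) : Continuous (embed (d := d) h) :=
  (embedHom d h).toLinearMap.continuous_of_finiteDimensional

theorem embed_exp (h : X ⊆ Λ) (Q : Obs d X) :
    embed h (NormedSpace.exp Q) = NormedSpace.exp (embed h Q) := by
  let : NormedAlgebra ℚ (Obs d X) := .restrictScalars ℚ ℂ _
  exact NormedSpace.map_exp (embedHom d h) (continuous_embed h) Q

theorem embed_injective [NeZero d] (h : X ⊆ Λ) : Function.Injective (embed (d := d) h) := by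
  intro Q R hQR
  ext p p'
  have := congrFun₂ hQR (glue p 0) (glue p' 0)
  simpa only [embed_glue, if_true] using this

theorem norm_embed [NeZero d] (h : X ⊆ Λ) (Q : Obs d X) : ‖embed h Q‖ = ‖Q‖ :=
  NonUnitalStarAlgHom.norm_map (embedHom d h) (embed_injective h) Q

theorem embed_embed (h : X ⊆ Y) (h' : Y ⊆ Λ) (Q : Obs d X) :
    embed h' (embed h Q) = embed (h.trans h') Q := by
  ext s t
  simp only [embed, of_apply]
  by_cases h1 : ∀ x : Λ, (x : ℤ) ∉ X → s x = t x
  · rw [if_pos h1, if_pos fun x hx => h1 x fun hx' => hx (h hx')]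
    exact if_pos fun (x : Y) hx => h1 ⟨x, h' x.2⟩ hx
  · rw [if_neg h1]
    split_ifs with h2 h3
    · refine absurd (fun x hx => ?_) h1
      by_cases hxY : (x : ℤ) ∈ Y
      · exact h3 ⟨x, hxY⟩ hx
      · exact h2 x hxY
    · rfl
    · rfl

theorem embed_mul_embed_apply (hX : X ⊆ Λ) (hY : Y ⊆ Λ) (hd : Disjoint X Y) (Q : Obs d X)
    (R : Obs d Y) (s t : Config d Λ) :
    (embed hX Q * embed hY R) s t =
      if ∀ x : Λ, (x : ℤ) ∉ X → (x : ℤ) ∉ Y → s x = t x then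
        Q (restr hX s) (restr hX t) * R (restr hY s) (restr hY t) else 0 := by
  rw [mul_apply]
  -- The only intermediate configuration with a possibly nonzero contribution: the first factor
  -- fixes it outside X, and the second, acting on the disjoint set Y, fixes it on X.
  let u : Config d Λ := fun x => if (x : ℤ) ∈ X then t x else s x
  rw [sum_eq_single u]
  · have e1 : ∀ x : Λ, (x : ℤ) ∉ X → s x = u x := fun x hx => by simp [u, hx]
    have e2 : restr hX u = restr hX t := by funext x; simp [u, restr]
    have e3 : restr hY u = restr hY s := by
      funext x
      have : (x : ℤ) ∉ X := fun h => (disjoint_left.1 hd h) x.2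
      simp [u, restr, this]
    simp only [embed, of_apply]
    rw [if_pos e1, e2, e3, mul_ite, mul_zero]
    congr 1
    refine propext ⟨fun H x hx hx' => (e1 x hx).trans (H x hx'), fun H x hx => ?_⟩
    by_cases hxX : (x : ℤ) ∈ X
    · simp [u, hxX]
    · rw [← e1 x hxX]
      exact H x hxX hx
  · intro v _ hv
    simp only [embed, of_apply]
    split_ifs with h1 h2
    · refine absurd (funext fun x => ?_) hv
      by_cases hxX : (x : ℤ) ∈ X
      · simp only [u, hxX, if_true]
        exact h2 x fun h => (disjoint_left.1 hd hxX) h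
      · simp only [u, hxX, if_false]
        exact (h1 x hxX).symm
    all_goals simp
  · simp

theorem embed_commute (hX : X ⊆ Λ) (hY : Y ⊆ Λ) (hd : Disjoint X Y) (Q : Obs d X)
    (R : Obs d Y) : Commute (embed hX Q) (embed hY R) := by
  ext s t
  rw [embed_mul_embed_apply hX hY hd, embed_mul_embed_apply hY hX hd.symm]
  have : (∀ x : Λ, (x : ℤ) ∉ X → (x : ℤ) ∉ Y → s x = t x) ↔
    (∀ x : Λ, (x : ℤ) ∉ Y → (x : ℤ) ∉ X → s x = t x) :=
    ⟨fun H x h1 h2 => H x h2 h1, fun H x h1 h2 => H x h2 h1⟩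
  simp only [this, mul_comm]

theorem tensor_eq (hd : Disjoint X Y) (Q : Obs d X) (R : Obs d Y) :
    tensor Q R = embed subset_union_left Q * embed subset_union_right R := by
  ext s t
  rw [embed_mul_embed_apply _ _ hd, if_pos, tensor, of_apply]
  intro x h1 h2
  exact ((mem_union.1 x.2).elim h1 h2).elim

theorem trace_embed_mul_embed (hX : X ⊆ Λ) (hY : Y ⊆ Λ) (hd : Disjoint X Y) (hu : Λ ⊆ X ∪ Y)
    (Q : Obs d X) (R : Obs d Y) : (embed hX Q * embed hY R).trace = Q.trace * R.trace := by
  rw [trace, trace, trace, sum_mul_sum, ← Fintype.sum_prod_type',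
    ← Equiv.sum_comp (configEquiv d hX hY hd hu)]
  refine sum_congr rfl fun s _ => ?_
  rw [diag_apply, embed_mul_embed_apply hX hY hd, if_pos fun _ _ _ => rfl]
  rfl

end Embedding

/-! ### The partial trace as the adjoint of the embedding. -/

section PartialTrace

variable {d : ℕ} {X Y Z Λ : Finset ℤ}

/-- This duality characterizes the partial trace, because the trace pairing is nondegenerate. The
module, tower and cyclicity rules below follow from it without computing entries. -/
theorem trace_reduced_mul (h : X ⊆ Λ) (M : Obs d Λ) (Q : Obs d X) :
    (reduced X M * Q).trace = (M * embed h Q).trace := by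
  simp only [trace, diag_apply, mul_apply]
  rw [← Equiv.sum_comp (glueEquiv d h), Fintype.sum_prod_type]
  refine sum_congr rfl fun p _ => ?_
  simp_rw [reduced, of_apply, sum_mul]
  rw [sum_comm]
  refine sum_congr rfl fun u _ => ?_
  rw [← Equiv.sum_comp (glueEquiv d h), Fintype.sum_prod_type]
  refine sum_congr rfl fun p' _ => ?_
  simp only [glueEquiv, Equiv.coe_fn_mk, embed_glue, mul_ite, mul_zero, sum_ite_eq', mem_univ,
    if_true]

theorem ext_of_trace_mul {M N : Obs d X} (H : ∀ Q : Obs d X, (M * Q).trace = (N * Q).trace) :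
    M = N := Matrix.ext_iff_trace_mul_right.2 H

theorem reduced_add (M N : Obs d Λ) : reduced X (M + N) = reduced X M + reduced X N := by
  ext s t
  simp [reduced, sum_add_distrib]

theorem reduced_smul (c : ℂ) (M : Obs d Λ) : reduced X (c • M) = c • reduced X M := by
  ext s t
  simp [reduced, mul_sum]

theorem reduced_posSemidef {M : Obs d Λ} (hM : M.PosSemidef) : (reduced X M).PosSemidef := by
  have : reduced X M = ∑ u : Config d (Λ \ X), M.submatrix (glue · u) (glue · u) := by
    ext s t
    simp [reduced, Matrix.sum_apply]
  rw [this]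
  exact posSemidef_sum _ fun u _ => hM.submatrix _

theorem reduced_embed_mul (h : X ⊆ Λ) (a : Obs d X) (M : Obs d Λ) :
    reduced X (embed h a * M) = a * reduced X M := by
  refine ext_of_trace_mul fun Q => ?_
  rw [trace_reduced_mul h, mul_assoc, trace_mul_comm, mul_assoc, ← embed_mul, ← trace_reduced_mul,
    ← mul_assoc, trace_mul_comm, mul_assoc]

theorem reduced_mul_embed (h : X ⊆ Λ) (a : Obs d X) (M : Obs d Λ) :
    reduced X (M * embed h a) = reduced X M * a := by
  refine ext_of_trace_mul fun Q => ?_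
  rw [trace_reduced_mul h, mul_assoc, ← embed_mul, ← trace_reduced_mul, ← mul_assoc]

theorem reduced_mul_comm (hX : X ⊆ Λ) (hY : Y ⊆ Λ) (hd : Disjoint X Y) (b : Obs d Y)
    (M : Obs d Λ) : reduced X (M * embed hY b) = reduced X (embed hY b * M) := by
  refine ext_of_trace_mul fun Q => ?_
  rw [trace_reduced_mul hX, trace_reduced_mul hX, mul_assoc,
    ← (embed_commute hX hY hd Q b).eq, ← mul_assoc, trace_mul_comm, mul_assoc]

theorem reduced_reduced (h : X ⊆ Y) (h' : Y ⊆ Λ) (M : Obs d Λ) :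
    reduced X (reduced Y M) = reduced X M := by
  refine ext_of_trace_mul fun Q => ?_
  rw [trace_reduced_mul h, trace_reduced_mul h', trace_reduced_mul (h.trans h'), embed_embed]

theorem trace_reduced (h : X ⊆ Λ) (M : Obs d Λ) : (reduced X M).trace = M.trace := by
  have := trace_reduced_mul h M 1
  rwa [mul_one, embed_one, mul_one] at this

theorem reduced_embed (hX : X ⊆ Λ) (hY : Y ⊆ Λ) (hd : Disjoint X Y) (hu : Λ ⊆ X ∪ Y)
    (b : Obs d Y) : reduced X (embed hY b) = b.trace • (1 : Obs d X) := by
  refine ext_of_trace_mul fun Q => ?_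
  rw [trace_reduced_mul hX, trace_embed_mul_embed hY hX hd.symm (by rwa [union_comm]), smul_mul,
    one_mul, trace_smul, smul_eq_mul]

end PartialTrace

end SpinChain
end

noncomputable section

namespace SpinChain

open Matrix Finset NormedSpace

/-! ### Shells of a finite-range Hamiltonian around a cut. -/

section LocalExpansionals

variable {d : ℕ}

/-- Half of the term `Φ_Z`, as an operator on `I`. -/
def halfTerm (Φ : Interaction d) (I Z : Finset ℤ) : Obs d I :=
  if h : Z ⊆ I then embed h ((1 / 2 : ℂ) • Φ.term Z) else 0

/-- Half of the Hamiltonian that contains the terms of the family `T`. -/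
def halfSum (Φ : Interaction d) (I : Finset ℤ) (T : Finset (Finset ℤ)) : Obs d I :=
  ∑ Z ∈ T, halfTerm Φ I Z

theorem halfTerm_isHermitian (Φ : Interaction d) (I Z : Finset ℤ) :
    (halfTerm Φ I Z).IsHermitian := by
  rw [halfTerm]
  split_ifs with h
  · refine embed_isHermitian h ?_
    rw [IsHermitian, conjTranspose_smul, (Φ.selfAdjoint Z).eq]
    simp
  · exact isHermitian_zero

theorem halfSum_isHermitian (Φ : Interaction d) (I : Finset ℤ) (T : Finset (Finset ℤ)) :
    (halfSum Φ I T).IsHermitian := by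
  rw [halfSum, IsHermitian, conjTranspose_sum]
  exact sum_congr rfl fun Z _ => (halfTerm_isHermitian Φ I Z).eq

variable {Φ : Interaction d} {r J : ℝ}

/-- An integer length that exceeds the range. -/
def rangeLen (r : ℝ) : ℕ := ⌈r⌉₊ + 1

theorem abs_sub_lt_rangeLen (hr : Φ.HasRange r) {Z : Finset ℤ} (hZ : Φ.term Z ≠ 0) {a b : ℤ}
    (ha : a ∈ Z) (hb : b ∈ Z) : |a - b| < rangeLen r := by
  have h1 : Metric.diam (Z : Set ℤ) ≤ r := not_lt.1 fun h => hZ (hr Z h)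
  have h2 := Metric.dist_le_diam_of_mem Z.finite_toSet.isBounded (mem_coe.2 ha) (mem_coe.2 hb)
  rw [Int.dist_eq] at h2
  have h3 := Nat.le_ceil r
  have : ((|a - b| : ℤ) : ℝ) < ((rangeLen r : ℕ) : ℝ) := by
    push_cast [rangeLen]
    linarith
  exact_mod_cast this

theorem term_ne_zero_of_halfTerm {I Z : Finset ℤ} (h : halfTerm Φ I Z ≠ 0) : Φ.term Z ≠ 0 := by
  intro h0
  apply h
  rw [halfTerm, h0, smul_zero]
  split_ifs with hZ
  · exact map_zero (embedHom d hZ)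
  · rfl

theorem norm_halfTerm_le [NeZero d] (hJ : Φ.HasStrength J) (I Z : Finset ℤ) :
    ‖halfTerm Φ I Z‖ ≤ J := by
  have h0 := norm_nonneg (Φ.term Z)
  have h1 := hJ Z
  rw [halfTerm]
  split_ifs with hZ
  · rw [norm_embed, norm_smul]
    norm_num
    linarith
  · rw [norm_zero]
    exact h0.trans h1

/-- A counting bound: by the finite range, a contributing set through p lies in a window of 2
`rangeLen r` + 1 sites, so each p accounts for at most 2^(2 `rangeLen r` + 1) sets. -/
theorem norm_halfSum_le [NeZero d] (hr : Φ.HasRange r) (hJ : Φ.HasStrength J) (I : Finset ℤ)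
    (T : Finset (Finset ℤ)) (P : Finset ℤ)
    (hP : ∀ Z ∈ T, Φ.term Z ≠ 0 → ∃ p ∈ P, p ∈ Z) :
    ‖halfSum Φ I T‖ ≤ P.card * 2 ^ (2 * rangeLen r + 1) * J := by
  classical
  have hJ0 : 0 ≤ J := (norm_nonneg _).trans (hJ ∅)
  have e : halfSum Φ I T = ∑ Z ∈ T.filter (fun Z => halfTerm Φ I Z ≠ 0), halfTerm Φ I Z :=
    (sum_filter_ne_zero T).symm
  have hsub : T.filter (fun Z => halfTerm Φ I Z ≠ 0) ⊆
      P.biUnion fun p => (Icc (p - (rangeLen r : ℤ)) (p + rangeLen r)).powerset := by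
    intro Z hZ
    obtain ⟨hZT, hZ0⟩ := mem_filter.1 hZ
    have hne := term_ne_zero_of_halfTerm hZ0
    obtain ⟨p, hp, hpZ⟩ := hP Z hZT hne
    refine mem_biUnion.2 ⟨p, hp, mem_powerset.2 fun a ha => ?_⟩
    have := abs_lt.1 (abs_sub_lt_rangeLen hr hne ha hpZ)
    rw [mem_Icc]
    constructor <;> linarith [this.1, this.2]
  have hcard : (T.filter (fun Z => halfTerm Φ I Z ≠ 0)).card ≤
      P.card * 2 ^ (2 * rangeLen r + 1) := by
    refine (card_le_card hsub).trans (card_biUnion_le_card_mul _ _ _ fun p _ => ?_)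
    rw [card_powerset, Int.card_Icc]
    refine le_of_eq (congrArg _ ?_)
    omega
  rw [e]
  calc _ ≤ ∑ Z ∈ T.filter (fun Z => halfTerm Φ I Z ≠ 0), J :=
        norm_sum_le_of_le _ fun Z _ => norm_halfTerm_le hJ I Z
    _ = (T.filter (fun Z => halfTerm Φ I Z ≠ 0)).card * J := by rw [sum_const, nsmul_eq_mul]
    _ ≤ ((P.card * 2 ^ (2 * rangeLen r + 1) : ℕ) : ℝ) * J := by gcongr
    _ = _ := by push_cast; rfl

/-- The `n`-th neighbourhood of the cut between `y - 1` and `y` in `I`. -/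
def nbhd (r : ℝ) (I : Finset ℤ) (y : ℤ) (n : ℕ) : Finset ℤ :=
  I ∩ Ico (y - (n + 1) * rangeLen r) (y + (n + 1) * rangeLen r)

theorem nbhd_subset (r : ℝ) (I : Finset ℤ) (y : ℤ) (n : ℕ) : nbhd r I y n ⊆ I :=
  inter_subset_left

theorem nbhd_mono (r : ℝ) (I : Finset ℤ) (y : ℤ) : Monotone (nbhd r I y) := by
  intro m n hmn
  refine inter_subset_inter_left (Ico_subset_Ico ?_ ?_)
  all_goals
    have : (m : ℤ) ≤ n := by exact_mod_cast hmn
    have : ((m : ℤ) + 1) * rangeLen r ≤ (n + 1) * rangeLen r := by gcongr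
    linarith

/-- The number of the first neighbourhood of the cut that meets `Z`. -/
def level (r : ℝ) (I : Finset ℤ) (y : ℤ) (Z : Finset ℤ) : ℕ :=
  sInf {n | ¬ Disjoint Z (nbhd r I y n)}

theorem not_disjoint_level {I Z : Finset ℤ} (hZ : Z ⊆ I) (hne : Z.Nonempty) (y : ℤ) :
    ¬ Disjoint Z (nbhd r I y (level r I y Z)) := by
  refine Nat.sInf_mem (s := {n | ¬ Disjoint Z (nbhd r I y n)}) ?_
  obtain ⟨a, ha⟩ := hne
  -- The neighbourhood with number n = |a - y| reaches at least n + 1 sites to both sides, because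
  -- `rangeLen r` ≥ 1.
  refine ⟨(a - y).natAbs, fun h => disjoint_left.1 h ha (mem_inter.2 ⟨hZ ha, mem_Ico.2 ?_⟩)⟩
  have h1 : (1 : ℤ) ≤ rangeLen r := by simp [rangeLen]
  have h2 : ((a - y).natAbs : ℤ) + 1 ≤ (((a - y).natAbs : ℤ) + 1) * rangeLen r :=
    le_mul_of_one_le_right (by positivity) h1
  omega

theorem disjoint_of_lt_level {I Z : Finset ℤ} {y : ℤ} {n : ℕ} (h : n < level r I y Z) :
    Disjoint Z (nbhd r I y n) := by
  by_contra H
  exact (Nat.sInf_le (s := {n | ¬ Disjoint Z (nbhd r I y n)}) H).not_gt h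

/-- The operators on the `n`-th neighbourhood, as a subring of the operators on `I`. -/
def localRing (d : ℕ) (r : ℝ) (I : Finset ℤ) (y : ℤ) (n : ℕ) : Subring (Obs d I) :=
  (embedHom d (nbhd_subset r I y n) : Obs d (nbhd r I y n) →+* Obs d I).range

theorem mem_localRing {I : Finset ℤ} {y : ℤ} {n : ℕ} {M : Obs d I} :
    M ∈ localRing d r I y n ↔ ∃ Q, embed (nbhd_subset r I y n) Q = M := Iff.rfl

theorem halfTerm_mem_localRing {I Z : Finset ℤ} {y : ℤ} {n : ℕ} (h : Z ⊆ nbhd r I y n) :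
    halfTerm Φ I Z ∈ localRing d r I y n := by
  refine mem_localRing.2 ⟨embed h ((1 / 2 : ℂ) • Φ.term Z), ?_⟩
  rw [embed_embed, halfTerm, dif_pos]

/-- The shells of the family `T` around the cut at `y`. -/
def shell (Φ : Interaction d) (r : ℝ) (I : Finset ℤ) (y : ℤ) (T : Finset (Finset ℤ)) (k : ℕ) :
    Obs d I :=
  halfSum Φ I (T.filter fun Z => level r I y Z = k)

theorem sum_shell (Φ : Interaction d) (r : ℝ) (I : Finset ℤ) (y : ℤ) (T : Finset (Finset ℤ))
    {N : ℕ} (hN : ∀ Z ∈ T, level r I y Z < N) :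
    ∑ k ∈ range N, shell Φ r I y T k = halfSum Φ I T :=
  sum_fiberwise_of_maps_to (fun Z hZ => mem_range.2 (hN Z hZ)) _

/-- The constant that bounds the norm of the shells. -/
def shellBound (r J : ℝ) : ℝ := (2 * rangeLen r) * 2 ^ (2 * rangeLen r + 1) * J

/-- A set of level k misses all earlier neighbourhoods, which gives commutation. It meets
neighbourhood k, and its diameter is below one block length, so it fits in neighbourhood k + 1. The
boundary term consists of sets that straddle the cut, hence lie in neighbourhood 0. -/
theorem isShelling_shell [NeZero d] (hr : Φ.HasRange r) (hJ : Φ.HasStrength J) {I : Finset ℤ}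
    {T T' : Finset (Finset ℤ)} (hT : ∀ Z ∈ T, Z ⊆ I ∧ Z.Nonempty) (hT' : ∀ Z ∈ T', Z ⊆ I) {y : ℤ}
    (hcross : ∀ Z ∈ T', (∃ a ∈ Z, a < y) ∧ ∃ b ∈ Z, y ≤ b) :
    IsShelling (shell Φ r I y T) (halfSum Φ I T') (localRing d r I y) (shellBound r J) where
  mono := by
    intro m n hmn M hM
    obtain ⟨Q, rfl⟩ := mem_localRing.1 hM
    exact mem_localRing.2 ⟨embed (nbhd_mono r I y hmn) Q, embed_embed _ _ _⟩
  mem_zero := by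
    refine sum_mem fun Z hZ => ?_
    by_cases h0 : halfTerm Φ I Z = 0
    · rw [h0]; exact zero_mem _
    have hne := term_ne_zero_of_halfTerm h0
    obtain ⟨⟨a, ha, hay⟩, b, hb, hby⟩ := hcross Z hZ
    refine halfTerm_mem_localRing fun x hx => mem_inter.2 ⟨hT' Z hZ hx, mem_Ico.2 ?_⟩
    have h1 := abs_lt.1 (abs_sub_lt_rangeLen hr hne hx ha)
    have h2 := abs_lt.1 (abs_sub_lt_rangeLen hr hne hx hb)
    push_cast
    constructor <;> linarith [h1.1, h1.2, h2.1, h2.2]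
  mem_succ k := by
    refine sum_mem fun Z hZ => ?_
    obtain ⟨hZT, hk⟩ := mem_filter.1 hZ
    by_cases h0 : halfTerm Φ I Z = 0
    · rw [h0]; exact zero_mem _
    have hne := term_ne_zero_of_halfTerm h0
    have hnd := not_disjoint_level (r := r) (hT Z hZT).1 (hT Z hZT).2 y
    rw [hk, not_disjoint_iff] at hnd
    obtain ⟨a, ha, hak⟩ := hnd
    have hak' := mem_Ico.1 (mem_inter.1 hak).2
    refine halfTerm_mem_localRing fun x hx => mem_inter.2 ⟨(hT Z hZT).1 hx, mem_Ico.2 ?_⟩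
    have h1 := abs_lt.1 (abs_sub_lt_rangeLen hr hne hx ha)
    push_cast
    constructor <;> linarith [h1.1, h1.2, hak'.1, hak'.2]
  commute k n hnk M hM := by
    obtain ⟨Q, rfl⟩ := mem_localRing.1 hM
    refine Commute.sum_left _ _ _ fun Z hZ => ?_
    obtain ⟨hZT, hk⟩ := mem_filter.1 hZ
    rw [halfTerm, dif_pos (hT Z hZT).1]
    exact embed_commute _ _ (disjoint_of_lt_level (hk ▸ hnk)) _ _
  norm_le k := by
    have hJ0 : 0 ≤ J := (norm_nonneg _).trans (hJ ∅)
    -- The sites that neighbourhood k adds to its predecessor: one block on each side of the cut. A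
    -- set of level k has a site among them, so the norm of a shell is bounded uniformly in k.
    let P : Finset ℤ := Ico (y - (k + 1) * rangeLen r) (y - k * rangeLen r) ∪
      Ico (y + k * rangeLen r) (y + (k + 1) * rangeLen r)
    have hPc : P.card ≤ 2 * rangeLen r := by
      refine (card_union_le _ _).trans ?_
      rw [Int.card_Ico, Int.card_Ico, show y - (k : ℤ) * rangeLen r - (y - (k + 1) * rangeLen r) =
        rangeLen r by ring, show y + ((k : ℤ) + 1) * rangeLen r - (y + k * rangeLen r) =
        rangeLen r by ring, Int.toNat_natCast]
      omega
    refine (norm_halfSum_le hr hJ I _ P fun Z hZ _ => ?_).trans ?_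
    · obtain ⟨hZT, hk⟩ := mem_filter.1 hZ
      have hnd := not_disjoint_level (r := r) (hT Z hZT).1 (hT Z hZT).2 y
      rw [hk, not_disjoint_iff] at hnd
      obtain ⟨a, ha, hak⟩ := hnd
      have hak' := mem_Ico.1 (mem_inter.1 hak).2
      refine ⟨a, ?_, ha⟩
      by_contra hP
      simp only [P, mem_union, mem_Ico, not_or, not_and, not_lt] at hP
      have h1 := hP.1 hak'.1
      have h2 : a < y + k * rangeLen r := by
        by_contra h
        exact absurd (hP.2 (not_lt.1 h)) (not_le.2 hak'.2)
      rcases Nat.eq_zero_or_pos k with hk0 | hk0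
      · subst hk0
        simp at h1 h2
        omega
      · have hlt : k - 1 < level r I y Z := by omega
        refine disjoint_left.1 (disjoint_of_lt_level hlt) ha
          (mem_inter.2 ⟨(hT Z hZT).1 ha, mem_Ico.2 ?_⟩)
        have : ((k - 1 : ℕ) : ℤ) + 1 = k := by omega
        rw [this]
        exact ⟨h1, h2⟩
    · rw [shellBound]
      gcongr
      exact_mod_cast hPc

theorem norm_halfSum_le_of_cross [NeZero d] (hr : Φ.HasRange r) (hJ : Φ.HasStrength J)
    {I : Finset ℤ} {T' : Finset (Finset ℤ)} {y : ℤ}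
    (hcross : ∀ Z ∈ T', (∃ a ∈ Z, a < y) ∧ ∃ b ∈ Z, y ≤ b) :
    ‖halfSum Φ I T'‖ ≤ shellBound r J := by
  have hJ0 : 0 ≤ J := (norm_nonneg _).trans (hJ ∅)
  refine (norm_halfSum_le hr hJ I T' (Ico (y - rangeLen r) y) fun Z hZ hne => ?_).trans ?_
  · obtain ⟨⟨a, ha, hay⟩, b, hb, hby⟩ := hcross Z hZ
    have h1 := abs_lt.1 (abs_sub_lt_rangeLen hr hne ha hb)
    exact ⟨a, mem_Ico.2 ⟨by linarith [h1.1], hay⟩, ha⟩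
  · rw [shellBound, Int.card_Ico, sub_sub_cancel, Int.toNat_natCast]
    gcongr
    have : (0 : ℝ) ≤ rangeLen r := by positivity
    linarith

/-- The constant in the estimates for the expansionals. -/
def expansionalBound (r J : ℝ) : ℝ :=
  Real.exp (shellBound r J * shellConst (shellBound r J)) ^ 3 *
    (shellBound r J * shellConst (shellBound r J) + 1)

/-- The expansional of a cut is bounded, with bounded inverse, and local near the cut. -/
theorem expansional_estimates [NeZero d] (hr : Φ.HasRange r) (hJ : Φ.HasStrength J) {I : Finset ℤ}
    {T₀ T₁ : Finset (Finset ℤ)} (hsub : T₀ ⊆ T₁) (hT : ∀ Z ∈ T₁, Z ⊆ I ∧ Z.Nonempty) {y : ℤ}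
    (hcross : ∀ Z ∈ T₁ \ T₀, (∃ a ∈ Z, a < y) ∧ ∃ b ∈ Z, y ≤ b) :
    ‖exp (halfSum Φ I T₀) * exp (-halfSum Φ I T₁)‖ ≤ expansionalBound r J ∧
    ‖exp (halfSum Φ I T₁) * exp (-halfSum Φ I T₀)‖ ≤ expansionalBound r J ∧
    ∀ M : ℕ, ∃ f : Obs d (nbhd r I y M), ‖f‖ ≤ expansionalBound r J ∧
      ‖exp (halfSum Φ I T₀) * exp (-halfSum Φ I T₁) - embed (nbhd_subset r I y M) f‖ ≤
        expansionalBound r J * Real.exp (-M) := by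
  have hJ0 : 0 ≤ J := (norm_nonneg _).trans (hJ ∅)
  have hsh := isShelling_shell (T := T₀) (T' := T₁ \ T₀) hr hJ (fun Z hZ => hT Z (hsub hZ))
    (fun Z hZ => (hT Z (mem_sdiff.1 hZ).1).1) hcross
  have hV := norm_halfSum_le_of_cross (I := I) hr hJ hcross
  have hsum : halfSum Φ I T₀ + halfSum Φ I (T₁ \ T₀) = halfSum Φ I T₁ := by
    rw [add_comm]
    exact sum_sdiff hsub
  -- The interval is finite, so N₀ shells exhaust the Hamiltonian and the expansional no longer
  -- changes for N ≥ N₀.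
  obtain ⟨N₀, hN₀⟩ : ∃ N₀, ∀ Z ∈ T₀, level r I y Z < N₀ :=
    ⟨T₀.sup (level r I y) + 1, fun Z hZ => Nat.lt_succ_of_le (le_sup (f := level r I y) hZ)⟩
  have hF : ∀ N, N₀ ≤ N → exp (halfSum Φ I T₀) * exp (-halfSum Φ I T₁) =
      expansional (shell Φ r I y T₀) (halfSum Φ I (T₁ \ T₀)) N 1 := by
    intro N hN
    rw [expansional, sum_shell Φ r I y T₀ fun Z hZ => (hN₀ Z hZ).trans_le hN, hsum, one_smul,
      one_smul]
  have hF' : exp (halfSum Φ I T₁) * exp (-halfSum Φ I T₀) =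
      expansionalInv (shell Φ r I y T₀) (halfSum Φ I (T₁ \ T₀)) N₀ 1 := by
    rw [expansionalInv, sum_shell Φ r I y T₀ hN₀, hsum, one_smul, one_smul]
  have hb0 : 0 ≤ shellBound r J := by rw [shellBound]; positivity
  have hc0 : 0 ≤ shellConst (shellBound r J) := (Real.exp_pos _).le
  have hb : Real.exp (‖halfSum Φ I (T₁ \ T₀)‖ * shellConst (shellBound r J)) ≤
      expansionalBound r J := by
    rw [expansionalBound]
    have h1 : Real.exp (‖halfSum Φ I (T₁ \ T₀)‖ * shellConst (shellBound r J)) ≤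
      Real.exp (shellBound r J * shellConst (shellBound r J)) := by gcongr
    have h2 : 1 ≤ Real.exp (shellBound r J * shellConst (shellBound r J)) :=
      Real.one_le_exp (by positivity)
    have h3 : Real.exp (shellBound r J * shellConst (shellBound r J)) ≤
        Real.exp (shellBound r J * shellConst (shellBound r J)) ^ 3 :=
      le_self_pow₀ h2 (by norm_num)
    refine (h1.trans h3).trans (le_mul_of_one_le_right (by positivity) ?_)
    have := mul_nonneg hb0 hc0
    linarith
  refine ⟨?_, ?_, fun M => ?_⟩
  · rw [hF N₀ le_rfl]
    exact (hsh.norm_expansional_le zero_le_one le_rfl N₀).trans hb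
  · rw [hF']
    exact (hsh.norm_expansionalInv_le zero_le_one le_rfl N₀).trans hb
  · obtain ⟨h, hh⟩ := mem_localRing.1 (hsh.sum_mem M)
    obtain ⟨v, hv⟩ := mem_localRing.1 (hsh.mono (Nat.zero_le M) hsh.mem_zero)
    have hf : embed (nbhd_subset r I y M) (exp h * exp (-(h + v))) =
        expansional (shell Φ r I y T₀) (halfSum Φ I (T₁ \ T₀)) M 1 := by
      rw [expansional, one_smul, one_smul, ← hh, ← hv, embed_mul, embed_exp, embed_exp,
        ← embed_add]
      exact congrArg (fun x => _ * exp x) (map_neg (embedHom d _) _)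
    -- The local approximant is the expansional of the first M shells, computed within neighbourhood
    -- M.
    refine ⟨exp h * exp (-(h + v)), ?_, ?_⟩
    · rw [← norm_embed (nbhd_subset r I y M), hf]
      exact (hsh.norm_expansional_le zero_le_one le_rfl M).trans hb
    · rw [hf, hF (max N₀ M) (le_max_left _ _)]
      refine (hsh.norm_expansional_sub_le zero_le_one le_rfl (le_max_right N₀ M)).trans ?_
      rw [expansionalBound]
      gcongr ?_ * _
      gcongr
      have : ‖halfSum Φ I (T₁ \ T₀)‖ * shellConst (shellBound r J) ≤
        shellBound r J * shellConst (shellBound r J) := by gcongr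
      linarith

end LocalExpansionals

end SpinChain
end

noncomputable section

namespace SpinChain

open Matrix Finset
open scoped ComplexOrder MatrixOrder

/-! ### Operator order and operator norm. -/

section Order

variable {n : Type*} [Fintype n] [DecidableEq n]

/-- The commuting nonnegative factors c - a and c + a multiply to c² - a² ≥ 0, and the C*-identity
converts a² ≤ c² into the norm bound. -/
theorem norm_le_of_neg_le_of_le {a : Matrix n n ℂ} {c : ℝ} (hc : 0 ≤ c) (ha : a.IsHermitian)
    (h1 : -((c : ℂ) • (1 : Matrix n n ℂ)) ≤ a) (h2 : a ≤ (c : ℂ) • (1 : Matrix n n ℂ)) :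
    ‖a‖ ≤ c := by
  have hcomm : Commute ((c : ℂ) • (1 : Matrix n n ℂ) - a) ((c : ℂ) • (1 : Matrix n n ℂ) + a) := by
    have : Commute ((c : ℂ) • (1 : Matrix n n ℂ)) a := (Commute.one_left a).smul_left _
    exact ((Commute.refl _).add_right this).sub_left (this.symm.add_right (Commute.refl _))
  have h3 := hcomm.mul_nonneg (sub_nonneg.2 h2) (by
    have := sub_nonneg.2 h1; rwa [sub_neg_eq_add, add_comm] at this)
  have h4 : a * a ≤ algebraMap ℝ (Matrix n n ℂ) (c ^ 2) := by
    rw [← sub_nonneg]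
    refine h3.trans_eq ?_
    have : algebraMap ℝ (Matrix n n ℂ) (c ^ 2) = ((c : ℂ) * (c : ℂ)) • (1 : Matrix n n ℂ) := by
      rw [Algebra.algebraMap_eq_smul_one, pow_two]
      ext i j
      simp [one_apply]
    rw [this, sub_mul, mul_add, mul_add, smul_mul_smul_comm, mul_one, smul_mul_assoc, one_mul,
      mul_smul_comm, mul_one]
    abel
  have h5 : 0 ≤ a * a := by
    have := star_mul_self_nonneg a
    rwa [star_eq_conjTranspose, ha.eq] at this
  have h6 := (CStarAlgebra.norm_le_iff_le_algebraMap (a * a) (sq_nonneg c) h5).2 h4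
  have h7 : ‖a * a‖ = ‖a‖ * ‖a‖ := by
    have := CStarRing.norm_star_mul_self (x := a)
    rwa [star_eq_conjTranspose, ha.eq] at this
  rw [h7, ← pow_two] at h6
  exact abs_le_of_sq_le_sq' h6 hc |>.2

theorem le_norm_smul_one {a : Matrix n n ℂ} (ha : a.IsHermitian) :
    a ≤ ((‖a‖ : ℝ) : ℂ) • (1 : Matrix n n ℂ) := by
  have h := IsSelfAdjoint.le_algebraMap_norm_self (a := a) ha
  refine h.trans_eq ?_
  rw [Algebra.algebraMap_eq_smul_one]
  ext i j
  simp [one_apply]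

theorem neg_norm_smul_one_le {a : Matrix n n ℂ} (ha : a.IsHermitian) :
    -(((‖a‖ : ℝ) : ℂ) • (1 : Matrix n n ℂ)) ≤ a := by
  have := le_norm_smul_one ha.neg
  rw [norm_neg] at this
  exact neg_le.1 this

theorem norm_single_one (s t : n) : ‖single s t (1 : ℂ)‖ = 1 := by
  have h := l2_opNorm_conjTranspose_mul_self (single s t (1 : ℂ))
  have h2 : (single s t (1 : ℂ))ᴴ * single s t (1 : ℂ) = diagonal (Pi.single t (1 : ℂ)) := by
    rw [conjTranspose_single, star_one, single_mul_single_same, mul_one, diagonal_single]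
  rw [h2, l2_opNorm_diagonal, Pi.norm_single, norm_one] at h
  nlinarith [norm_nonneg (single s t (1 : ℂ))]

theorem norm_apply_le_norm (M : Matrix n n ℂ) (s t : n) : ‖M s t‖ ≤ ‖M‖ := by
  have h : single s s (1 : ℂ) * M * single t t (1 : ℂ) = M s t • single s t (1 : ℂ) := by
    rw [single_mul_mul_single]
    simp
  calc ‖M s t‖ = ‖single s s (1 : ℂ) * M * single t t (1 : ℂ)‖ := by
        rw [h, norm_smul, norm_single_one, mul_one]
    _ ≤ ‖single s s (1 : ℂ)‖ * ‖M‖ * ‖single t t (1 : ℂ)‖ :=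
        (norm_mul_le _ _).trans (by gcongr; exact norm_mul_le _ _)
    _ = ‖M‖ := by rw [norm_single_one, norm_single_one, one_mul, mul_one]

end Order

/-! ### Averaging over one tensor factor in a state. -/

section Slice

variable {d : ℕ} {X Y Λ : Finset ℤ}

/-- The map `M ↦ Tr_Y[τ M]` to the operators on `X` for a state `τ` on `Y`. -/
def slice (X : Finset ℤ) (hY : Y ⊆ Λ) (τ : Obs d Y) (M : Obs d Λ) : Obs d X :=
  reduced X (embed hY τ * M)

/-- A density matrix, presented as the square of a Hermitian matrix. -/
def IsState (τ : Obs d Y) : Prop := τ.trace = 1 ∧ ∃ b : Obs d Y, b.IsHermitian ∧ τ = b * b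

theorem slice_sub (hY : Y ⊆ Λ) (τ : Obs d Y) (M N : Obs d Λ) :
    slice X hY τ (M - N) = slice X hY τ M - slice X hY τ N := by
  rw [slice, slice, slice, mul_sub, sub_eq_add_neg, ← neg_one_smul ℂ, reduced_add, reduced_smul,
    neg_one_smul, sub_eq_add_neg]

theorem slice_smul (hY : Y ⊆ Λ) (τ : Obs d Y) (c : ℂ) (M : Obs d Λ) :
    slice X hY τ (c • M) = c • slice X hY τ M := by
  rw [slice, slice, mul_smul_comm, reduced_smul]

theorem slice_sum {ι : Type*} (hY : Y ⊆ Λ) (τ : Obs d Y) (T : Finset ι) (M : ι → Obs d Λ) :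
    slice X hY τ (∑ i ∈ T, M i) = ∑ i ∈ T, slice X hY τ (M i) := by
  classical
  induction T using Finset.induction_on with
  | empty =>
    have := slice_smul (X := X) hY τ 0 0
    simpa using this
  | insert a T ha ih =>
    rw [sum_insert ha, sum_insert ha, ← ih]
    simp only [slice, mul_add, reduced_add]

theorem slice_embed_mul (hX : X ⊆ Λ) (hY : Y ⊆ Λ) (hd : Disjoint X Y) (τ : Obs d Y) (a : Obs d X)
    (M : Obs d Λ) : slice X hY τ (embed hX a * M) = a * slice X hY τ M := by
  rw [slice, ← mul_assoc, ← (embed_commute hX hY hd a τ).eq, mul_assoc, reduced_embed_mul]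
  rfl

theorem slice_embed (hX : X ⊆ Λ) (hY : Y ⊆ Λ) (hd : Disjoint X Y) (hu : Λ ⊆ X ∪ Y) (τ m : Obs d Y) :
    slice X hY τ (embed hY m) = (τ * m).trace • (1 : Obs d X) := by
  rw [slice, ← embed_mul, reduced_embed hX hY hd hu]

theorem slice_one (hX : X ⊆ Λ) (hY : Y ⊆ Λ) (hd : Disjoint X Y) (hu : Λ ⊆ X ∪ Y) {τ : Obs d Y}
    (hτ : IsState τ) : slice X hY τ 1 = 1 := by
  have := slice_embed hX hY hd hu τ 1
  rwa [embed_one, mul_one, hτ.1, one_smul] at this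

/-- Cyclicity over Y moves one factor b to the right, and the resulting sandwich makes positivity
visible. -/
theorem slice_mul_self_eq (hX : X ⊆ Λ) (hY : Y ⊆ Λ) (hd : Disjoint X Y) (b : Obs d Y)
    (M : Obs d Λ) : slice X hY (b * b) M = reduced X (embed hY b * M * embed hY b) := by
  rw [reduced_mul_comm hX hY hd, slice, embed_mul, mul_assoc]

theorem slice_nonneg (hX : X ⊆ Λ) (hY : Y ⊆ Λ) (hd : Disjoint X Y) {τ : Obs d Y} (hτ : IsState τ)
    {M : Obs d Λ} (hM : 0 ≤ M) : 0 ≤ slice X hY τ M := by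
  obtain ⟨-, b, hb, rfl⟩ := hτ
  rw [slice_mul_self_eq hX hY hd, nonneg_iff_posSemidef]
  have := (nonneg_iff_posSemidef.1 hM).conjTranspose_mul_mul_same (embed hY b)
  rw [(embed_isHermitian hY hb).eq] at this
  exact reduced_posSemidef this

theorem slice_mono (hX : X ⊆ Λ) (hY : Y ⊆ Λ) (hd : Disjoint X Y) {τ : Obs d Y} (hτ : IsState τ)
    {M N : Obs d Λ} (hMN : M ≤ N) : slice X hY τ M ≤ slice X hY τ N := by
  have := slice_nonneg hX hY hd hτ (sub_nonneg.2 hMN)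
  rwa [slice_sub, sub_nonneg] at this

theorem reduced_conjTranspose (M : Obs d Λ) : reduced X Mᴴ = (reduced X M)ᴴ := by
  ext s t
  simp [reduced]

theorem slice_isHermitian (hX : X ⊆ Λ) (hY : Y ⊆ Λ) (hd : Disjoint X Y) {τ : Obs d Y}
    (hτ : IsState τ) {M : Obs d Λ} (hM : M.IsHermitian) : (slice X hY τ M).IsHermitian := by
  obtain ⟨-, b, hb, rfl⟩ := hτ
  rw [slice_mul_self_eq hX hY hd, IsHermitian, ← reduced_conjTranspose, conjTranspose_mul,
    conjTranspose_mul, (embed_isHermitian hY hb).eq, hM.eq, mul_assoc]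

/-- The map is positive and unital, so it preserves -‖M‖ ≤ M ≤ ‖M‖. -/
theorem norm_slice_le (hX : X ⊆ Λ) (hY : Y ⊆ Λ) (hd : Disjoint X Y) (hu : Λ ⊆ X ∪ Y)
    {τ : Obs d Y} (hτ : IsState τ) {M : Obs d Λ} (hM : M.IsHermitian) :
    ‖slice X hY τ M‖ ≤ ‖M‖ := by
  refine norm_le_of_neg_le_of_le (norm_nonneg _) (slice_isHermitian hX hY hd hτ hM) ?_ ?_
  · have := slice_mono hX hY hd hτ (neg_norm_smul_one_le hM)
    rwa [← neg_smul, slice_smul, slice_one hX hY hd hu hτ, neg_smul] at this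
  · have := slice_mono hX hY hd hτ (le_norm_smul_one hM)
    rwa [slice_smul, slice_one hX hY hd hu hτ] at this

theorem smul_one_le_slice (hX : X ⊆ Λ) (hY : Y ⊆ Λ) (hd : Disjoint X Y) (hu : Λ ⊆ X ∪ Y)
    {τ : Obs d Y} (hτ : IsState τ) {M : Obs d Λ} {g : ℝ}
    (hM : (g : ℂ) • (1 : Obs d Λ) ≤ M) : (g : ℂ) • (1 : Obs d X) ≤ slice X hY τ M := by
  have := slice_mono hX hY hd hτ hM
  rwa [slice_smul, slice_one hX hY hd hu hτ] at this

/-- An expectation value is the slice onto the empty set of sites, whose algebra consists of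
scalars. -/
theorem norm_trace_mul_le [NeZero d] {τ : Obs d Y} (hτ : IsState τ) {M : Obs d Y}
    (hM : M.IsHermitian) : ‖(τ * M).trace‖ ≤ ‖M‖ := by
  have h := norm_slice_le (empty_subset Y) (subset_refl Y) (disjoint_empty_left Y)
    (by simp) hτ (embed_isHermitian (subset_refl Y) hM)
  rwa [slice_embed (empty_subset Y) _ (disjoint_empty_left Y) (by simp), norm_smul, norm_embed,
    CStarRing.norm_one, mul_one] at h

end Slice

/-! ### From an approximate product to the product of the marginals. -/

section TwoSided

variable {d : ℕ} [NeZero d] {A C : Finset ℤ}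

/-- The two marginals of `S` almost factorize it if `S` is almost a product. -/
theorem norm_marginal_sub_le (hd : Disjoint A C) {τA : Obs d A} {τC : Obs d C} (hA : IsState τA)
    (hC : IsState τC) {S : Obs d (A ∪ C)} (hS : S.IsHermitian) {P : Obs d A} {Q : Obs d C}
    (hP : P.IsHermitian) (hQ : Q.IsHermitian) {k ε : ℝ} (hSk : ‖S‖ ≤ k ^ 2) (hPk : ‖P‖ ≤ k)
    (hQk : ‖Q‖ ≤ k)
    (hε : ‖S - embed subset_union_left P * embed subset_union_right Q‖ ≤ ε) :
    ‖(τA * slice A subset_union_right τC S).trace • S -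
      embed subset_union_left (slice A subset_union_right τC S) *
        embed subset_union_right (slice C subset_union_left τA S)‖ ≤ 4 * k ^ 2 * ε := by
  have hAs : A ⊆ A ∪ C := subset_union_left
  have hCs : C ⊆ A ∪ C := subset_union_right
  have hcomm : A ∪ C ⊆ C ∪ A := by rw [union_comm]
  set SA := slice A hCs τC S with hSA
  set SC := slice C hAs τA S with hSC
  set p := (τA * P).trace with hp
  set q := (τC * Q).trace with hq
  have hk : 0 ≤ k := (norm_nonneg _).trans hPk
  have hε0 : 0 ≤ ε := (norm_nonneg _).trans hε
  have hpk : ‖p‖ ≤ k := (norm_trace_mul_le hA hP).trans hPk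
  have hqk : ‖q‖ ≤ k := (norm_trace_mul_le hC hQ).trans hQk
  have hPQ := embed_commute hAs hCs hd P Q
  have hH : (S - embed hAs P * embed hCs Q).IsHermitian := by
    refine hS.sub ?_
    rw [IsHermitian, conjTranspose_mul, (embed_isHermitian hAs hP).eq,
      (embed_isHermitian hCs hQ).eq, hPQ.eq]
  have e1 : ‖SA - q • P‖ ≤ ε := by
    have h := (norm_slice_le hAs hCs hd (subset_refl _) hC hH).trans hε
    rwa [slice_sub, slice_embed_mul hAs hCs hd, slice_embed hAs hCs hd (subset_refl _),
      mul_smul_comm, mul_one] at h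
  have e2 : ‖SC - p • Q‖ ≤ ε := by
    have h := (norm_slice_le hCs hAs hd.symm hcomm hA hH).trans hε
    rwa [slice_sub, hPQ.eq, slice_embed_mul hCs hAs hd.symm, slice_embed hCs hAs hd.symm hcomm,
      mul_smul_comm, mul_one] at h
  have hSAk : ‖SA‖ ≤ k ^ 2 := (norm_slice_le hAs hCs hd (subset_refl _) hC hS).trans hSk
  have hqP : (q • P).IsHermitian := by
    have := slice_isHermitian hAs hCs hd hC (M := embed hAs P * embed hCs Q) (by
      rw [IsHermitian, conjTranspose_mul, (embed_isHermitian hAs hP).eq,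
        (embed_isHermitian hCs hQ).eq, hPQ.eq])
    rwa [slice_embed_mul hAs hCs hd, slice_embed hAs hCs hd (subset_refl _), mul_smul_comm,
      mul_one] at this
  have e3 : ‖(τA * SA).trace - p * q‖ ≤ ε := by
    have h := (norm_trace_mul_le hA
      ((slice_isHermitian hAs hCs hd hC hS).sub hqP)).trans e1
    rwa [mul_sub, trace_sub, mul_smul_comm, trace_smul, smul_eq_mul, mul_comm q] at h
  -- With p and q the expectations of P and Q, the marginals are close to qP and pQ, and the total
  -- expectation is close to pq. Passing through pq P ⊗ Q gives four errors, each at most k² ε.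
  have key : (τA * SA).trace • S - embed hAs SA * embed hCs SC =
      ((τA * SA).trace - p * q) • S + (p * q) • (S - embed hAs P * embed hCs Q) +
      (embed hAs (q • P - SA) * embed hCs (p • Q) + embed hAs SA * embed hCs (p • Q - SC)) := by
    rw [embed_sub, embed_sub, embed_smul, embed_smul]
    simp only [sub_mul, mul_sub, sub_smul, smul_sub, smul_mul_smul_comm, mul_comm p q]
    abel
  rw [key]
  have n1 : ‖((τA * SA).trace - p * q) • S‖ ≤ ε * k ^ 2 := by
    rw [norm_smul]; gcongr
  have n2 : ‖(p * q) • (S - embed hAs P * embed hCs Q)‖ ≤ (k * k) * ε := by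
    rw [norm_smul, norm_mul]; gcongr
  have n3 : ‖embed hAs (q • P - SA) * embed hCs (p • Q)‖ ≤ ε * (k * k) := by
    refine (norm_mul_le _ _).trans ?_
    rw [norm_embed, norm_embed, norm_smul, norm_sub_rev]
    gcongr
  have n4 : ‖embed hAs SA * embed hCs (p • Q - SC)‖ ≤ k ^ 2 * ε := by
    refine (norm_mul_le _ _).trans ?_
    rw [norm_embed, norm_embed, norm_sub_rev]
    gcongr
  calc _ ≤ ε * k ^ 2 + (k * k) * ε + (ε * (k * k) + k ^ 2 * ε) :=
        norm_add_le_of_le (norm_add_le_of_le n1 n2) (norm_add_le_of_le n3 n4)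
    _ = _ := by ring

/-- The bound without any decay, for middle pieces too short for clustering to help. -/
theorem norm_marginal_sub_le_two (hd : Disjoint A C) {τA : Obs d A} {τC : Obs d C}
    (hA : IsState τA) (hC : IsState τC) {S : Obs d (A ∪ C)} (hS : S.IsHermitian) {k : ℝ}
    (hSk : ‖S‖ ≤ k) :
    ‖(τA * slice A subset_union_right τC S).trace • S -
      embed subset_union_left (slice A subset_union_right τC S) *
        embed subset_union_right (slice C subset_union_left τA S)‖ ≤ 2 * k ^ 2 := by
  have hAs : A ⊆ A ∪ C := subset_union_left
  have hCs : C ⊆ A ∪ C := subset_union_right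
  have hcomm : A ∪ C ⊆ C ∪ A := by rw [union_comm]
  have hk : 0 ≤ k := (norm_nonneg _).trans hSk
  have h1 := (norm_slice_le hAs hCs hd (subset_refl _) hC hS).trans hSk
  have h2 := (norm_slice_le hCs hAs hd.symm hcomm hA hS).trans hSk
  have h3 := (norm_trace_mul_le hA (slice_isHermitian hAs hCs hd hC hS)).trans h1
  refine (norm_sub_le _ _).trans ?_
  rw [norm_smul]
  have h4 := norm_mul_le (embed hAs (slice A hCs τC S)) (embed hCs (slice C hAs τA S))
  rw [norm_embed, norm_embed] at h4
  calc _ ≤ k * k + k * k := by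
        refine add_le_add (by gcongr) (h4.trans (by gcongr))
    _ = _ := by ring

end TwoSided

end SpinChain
end

noncomputable section

namespace SpinChain

open Matrix Finset NormedSpace
open scoped ComplexOrder MatrixOrder

/-! ### From norm estimates to operator inequalities. -/

section MaxRelative

variable {d : ℕ} {A C Y : Finset ℤ}

theorem le_trace_mul_of_smul_one_le {τ : Obs d Y} (hτ : IsState τ) {M : Obs d Y} {g : ℝ}
    (hM : (g : ℂ) • (1 : Obs d Y) ≤ M) : (g : ℂ) ≤ (τ * M).trace := by
  have h1 : (g : ℂ) • (1 : Obs d Y) ≤ embed (subset_refl Y) M := by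
    have := embed_nonneg (subset_refl Y) (sub_nonneg.2 hM)
    rwa [embed_sub, embed_smul, embed_one, sub_nonneg] at this
  have h := smul_one_le_slice (empty_subset Y) (subset_refl Y) (disjoint_empty_left Y)
    (by simp) hτ h1
  rw [slice_embed (empty_subset Y) _ (disjoint_empty_left Y) (by simp), le_iff, ← sub_smul] at h
  have := h.diag_nonneg (i := fun x => absurd x.2 (notMem_empty _))
  simpa using this

/-- MN - g² = (M - g) N + g (N - g), a sum of two nonnegative operators because M and N commute. -/
theorem smul_one_mul_le {d : ℕ} {Λ : Finset ℤ} {M N : Obs d Λ} (hc : Commute M N) {g : ℝ} (hg : 0 ≤ g)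
    (hM : (g : ℂ) • (1 : Obs d Λ) ≤ M) (hN : (g : ℂ) • (1 : Obs d Λ) ≤ N) :
    ((g ^ 2 : ℝ) : ℂ) • (1 : Obs d Λ) ≤ M * N := by
  have hgC : (0 : ℂ) ≤ g := Complex.zero_le_real.2 hg
  have hg1 : (0 : Obs d Λ) ≤ (g : ℂ) • (1 : Obs d Λ) := smul_nonneg hgC zero_le_one
  have h1 : 0 ≤ (M - (g : ℂ) • (1 : Obs d Λ)) * N :=
    (hc.sub_left ((Commute.one_left N).smul_left _)).mul_nonneg (sub_nonneg.2 hM) (hg1.trans hN)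
  have h2 : 0 ≤ (g : ℂ) • (N - (g : ℂ) • (1 : Obs d Λ)) := smul_nonneg hgC (sub_nonneg.2 hN)
  rw [← sub_nonneg]
  refine (add_nonneg h1 h2).trans_eq ?_
  rw [sub_mul, smul_sub, smul_mul_assoc, one_mul, smul_smul, Complex.ofReal_pow, pow_two]
  abel

/-- M ≤ T + δ ≤ (1 + δ/g) T: the lower bound on T makes an additive error multiplicative, as the
max-relative entropy requires. -/
theorem smul_le_smul_of_norm_sub_le {n : Type*} [Fintype n] [DecidableEq n]
    {M T : Matrix n n ℂ} (hM : M.IsHermitian) (hT : T.IsHermitian) {g δ : ℝ} (hg : 0 < g)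
    (hTg : (g : ℂ) • (1 : Matrix n n ℂ) ≤ T) (hδ : ‖M - T‖ ≤ δ) :
    M ≤ ((1 + δ / g : ℝ) : ℂ) • T := by
  have hδ0 : 0 ≤ δ := (norm_nonneg _).trans hδ
  have h1 := le_norm_smul_one (hM.sub hT)
  have h2 : ((‖M - T‖ : ℝ) : ℂ) • (1 : Matrix n n ℂ) ≤ (δ : ℂ) • (1 : Matrix n n ℂ) := by
    refine smul_le_smul_of_nonneg_right ?_ zero_le_one
    exact_mod_cast hδ
  have h3 : (δ : ℂ) • (1 : Matrix n n ℂ) ≤ ((δ / g : ℝ) : ℂ) • T := by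
    have h0 : (0 : ℂ) ≤ ((δ / g : ℝ) : ℂ) := Complex.zero_le_real.2 (by positivity)
    have := smul_le_smul_of_nonneg_left hTg h0
    rwa [smul_smul, ← Complex.ofReal_mul, div_mul_cancel₀ _ hg.ne'] at this
  have h4 := (h1.trans h2).trans h3
  rw [sub_le_iff_le_add] at h4
  refine h4.trans_eq ?_
  rw [Complex.ofReal_add, add_smul, Complex.ofReal_one, one_smul, add_comm]

end MaxRelative

/-! ### Square roots of Gibbs weights. -/

section Gibbs

variable {d : ℕ}

/-- The nonempty subsets of `X`. -/
def subsets (X : Finset ℤ) : Finset (Finset ℤ) := X.powerset.erase ∅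

theorem mem_subsets {X Z : Finset ℤ} : Z ∈ subsets X ↔ Z ≠ ∅ ∧ Z ⊆ X := by
  rw [subsets, mem_erase, mem_powerset]

/-- The square root `e^{-H/2}` of the unnormalized Gibbs state, without the constant term. -/
def boltz (Φ : Interaction d) (X : Finset ℤ) : Obs d X := exp (-halfSum Φ X (subsets X))

theorem exp_isHermitian {n : Type*} [Fintype n] [DecidableEq n] {M : Matrix n n ℂ}
    (hM : M.IsHermitian) : (exp M).IsHermitian := IsHermitian.exp hM

theorem boltz_isHermitian (Φ : Interaction d) (X : Finset ℤ) : (boltz Φ X).IsHermitian :=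
  exp_isHermitian (halfSum_isHermitian Φ X _).neg

theorem isUnit_boltz (Φ : Interaction d) (X : Finset ℤ) : IsUnit (boltz Φ X) :=
  IsUnit.of_mul_eq_one _ (exp_neg_mul_exp (halfSum Φ X (subsets X)))

/-- The empty set is a subset of every piece and has no position relative to a cut. Its term is a
scalar, so it is split off here and then cancels in the normalized state. -/
theorem hamiltonian_eq (Φ : Interaction d) (X : Finset ℤ) :
    Φ.hamiltonian X = halfSum Φ X (subsets X) + halfSum Φ X (subsets X) +
      Φ.term ∅ (fun x => absurd x.2 (notMem_empty _)) (fun x => absurd x.2 (notMem_empty _)) •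
        (1 : Obs d X) := by
  have h1 : Φ.hamiltonian X = ∑ Z ∈ X.powerset, (halfTerm Φ X Z + halfTerm Φ X Z) := by
    rw [Interaction.hamiltonian, ← sum_attach X.powerset]
    refine sum_congr rfl fun Z _ => ?_
    rw [halfTerm, dif_pos (mem_powerset.1 Z.2), ← embed_add, ← add_smul]
    norm_num
  have h2 : halfTerm Φ X ∅ + halfTerm Φ X ∅ =
      Φ.term ∅ (fun x => absurd x.2 (notMem_empty _)) (fun x => absurd x.2 (notMem_empty _)) •
        (1 : Obs d X) := by
    rw [halfTerm, dif_pos (empty_subset X), ← embed_add, ← add_smul]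
    norm_num
    rw [← embed_one (empty_subset X), ← embed_smul]
    congr 1
    ext s t
    have hs : s = fun x => absurd x.2 (notMem_empty _) := funext fun x => absurd x.2 (notMem_empty _)
    have ht : t = fun x => absurd x.2 (notMem_empty _) := funext fun x => absurd x.2 (notMem_empty _)
    subst hs ht
    simp
  rw [h1, ← add_sum_erase _ _ (empty_mem_powerset X), h2, sum_add_distrib, add_comm]
  rfl

theorem gibbs_eq (Φ : Interaction d) (X : Finset ℤ) :
    Φ.gibbs X = (boltz Φ X * boltz Φ X).trace⁻¹ • (boltz Φ X * boltz Φ X) := by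
  have h : exp (-Φ.hamiltonian X) =
      Complex.exp (-(Φ.term ∅ (fun x => absurd x.2 (notMem_empty _))
        (fun x => absurd x.2 (notMem_empty _)))) • (boltz Φ X * boltz Φ X) := by
    rw [hamiltonian_eq]
    generalize Φ.term ∅ (fun x => absurd x.2 (notMem_empty _))
        (fun x => absurd x.2 (notMem_empty _)) = c
    have hs : exp (-(c • (1 : Obs d X))) = Complex.exp (-c) • (1 : Obs d X) := by
      rw [← neg_smul, ← Algebra.algebraMap_eq_smul_one, ← Algebra.algebraMap_eq_smul_one,
        ← algebraMap_exp_comm, Complex.exp_eq_exp_ℂ]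
    rw [neg_add, exp_add_of_commute_real, neg_add, exp_add_of_commute_real (Commute.refl _), hs,
      mul_smul_comm, mul_one, boltz]
    rw [← neg_smul]
    exact (Commute.one_right _).smul_right _
  have hk := Complex.exp_ne_zero (-(Φ.term ∅ (fun x => absurd x.2 (notMem_empty _))
        (fun x => absurd x.2 (notMem_empty _))))
  rw [Interaction.gibbs, h, trace_smul, smul_smul, smul_eq_mul, mul_inv, mul_right_comm,
    inv_mul_cancel₀ hk, one_mul]

theorem boltz_mul_boltz_posDef (Φ : Interaction d) (X : Finset ℤ) :
    (boltz Φ X * boltz Φ X).PosDef := by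
  have := (PosDef.one (n := Config d X) (R := ℂ)).conjTranspose_mul_mul_same
    (mulVec_injective_of_isUnit (isUnit_boltz Φ X))
  rwa [mul_one, (boltz_isHermitian Φ X).eq] at this

variable [NeZero d]

theorem trace_boltz_pos (Φ : Interaction d) (X : Finset ℤ) :
    0 < (boltz Φ X * boltz Φ X).trace := (boltz_mul_boltz_posDef Φ X).trace_pos

theorem isState_gibbs (Φ : Interaction d) (X : Finset ℤ) : IsState (Φ.gibbs X) := by
  have hpos := trace_boltz_pos Φ X
  obtain ⟨z, hz0, hz⟩ : ∃ z : ℝ, 0 < z ∧ (z : ℂ) = (boltz Φ X * boltz Φ X).trace :=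
    ⟨_, (Complex.pos_iff.1 hpos).1, Complex.ext rfl (Complex.pos_iff.1 hpos).2⟩
  rw [IsState, gibbs_eq, trace_smul, smul_eq_mul, inv_mul_cancel₀ hpos.ne']
  refine ⟨rfl, (((Real.sqrt z)⁻¹ : ℝ) : ℂ) • boltz Φ X, ?_, ?_⟩
  · rw [IsHermitian, conjTranspose_smul, (boltz_isHermitian Φ X).eq]
    simp
  · rw [smul_mul_smul_comm, ← Complex.ofReal_mul, ← mul_inv, Real.mul_self_sqrt hz0.le, ← hz]
    simp

end Gibbs

end SpinChain
end

noncomputable section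

namespace SpinChain

open Matrix Finset NormedSpace
open scoped ComplexOrder MatrixOrder

/-! ### Marginals of the Gibbs state and the max-relative entropy bound. -/

section Marginals

variable {d : ℕ}

theorem slice_smul_left {X Y Λ : Finset ℤ} (hY : Y ⊆ Λ) (τ : Obs d Y) (c : ℂ) (M : Obs d Λ) :
    slice X hY (c • τ) M = c • slice X hY τ M := by
  rw [slice, slice, embed_smul, smul_mul_assoc, reduced_smul]

/-- The factor on X passes out of the partial trace, while cyclicity collects the two factors on Y
into b². With b a Boltzmann root, b² is a multiple of a Gibbs state. -/
theorem reduced_conj {X Y Λ : Finset ℤ} (hX : X ⊆ Λ) (hY : Y ⊆ Λ) (hd : Disjoint X Y) (a : Obs d X)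
    (b : Obs d Y) (M : Obs d Λ) :
    reduced X (embed hX a * embed hY b * M * (embed hX a * embed hY b)) =
      a * slice X hY (b * b) M * a := by
  rw [slice_mul_self_eq hX hY hd, ← reduced_embed_mul hX, ← reduced_mul_embed hX]
  conv_lhs => rw [(embed_commute hX hY hd a b).eq]
  rw [← (embed_commute hX hY hd a b).eq]
  simp only [mul_assoc]
  rw [(embed_commute hX hY hd a b).eq]

variable [NeZero d] {Φ : Interaction d}

theorem boltz_mul_boltz_eq (Φ : Interaction d) (X : Finset ℤ) :
    boltz Φ X * boltz Φ X = (boltz Φ X * boltz Φ X).trace • Φ.gibbs X := by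
  rw [gibbs_eq, smul_smul, mul_inv_cancel₀ (trace_boltz_pos Φ X).ne', one_smul]

/-- The chain of mutual informations of the Gibbs state, bounded by the deviation of an effective
operator `S` on `A ∪ C` from its product form. -/
theorem mutualInfo_chain {I A B C : Finset ℤ} (hAC : A ∪ C ⊆ I) (hB : B ⊆ I) (hd : Disjoint A C)
    (hdB : Disjoint (A ∪ C) B) (hu : I ⊆ (A ∪ C) ∪ B) {W : Obs d I}
    (hW : boltz Φ I * boltz Φ I =
      embed hAC (embed subset_union_left (boltz Φ A) * embed subset_union_right (boltz Φ C)) *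
        embed hB (boltz Φ B) * W *
      (embed hAC (embed subset_union_left (boltz Φ A) * embed subset_union_right (boltz Φ C)) *
        embed hB (boltz Φ B))) {g : ℝ} (hg : 0 < g)
    (hWh : W.IsHermitian) (hWg : (g : ℂ) • (1 : Obs d I) ≤ W) {S : Obs d (A ∪ C)}
    (hS : S = slice (A ∪ C) hB (Φ.gibbs B) W) {δ : ℝ}
    (hδ : ‖(Φ.gibbs A * slice A subset_union_right (Φ.gibbs C) S).trace • S -
      embed subset_union_left (slice A subset_union_right (Φ.gibbs C) S) *
        embed subset_union_right (slice C subset_union_left (Φ.gibbs A) S)‖ ≤ δ)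
    {q : ℝ} (hq : 1 ≤ q) :
    mutualInfo (Φ.gibbs I) A C ≤ bsMutualInfo (Φ.gibbs I) A C ∧
      bsMutualInfo (Φ.gibbs I) A C ≤ renyiMutualInfo q (Φ.gibbs I) A C ∧
      renyiMutualInfo q (Φ.gibbs I) A C ≤ δ / g ^ 2 := by
  have hAs : A ⊆ A ∪ C := subset_union_left
  have hCs : C ⊆ A ∪ C := subset_union_right
  have hcomm : A ∪ C ⊆ C ∪ A := by rw [union_comm]
  have hτA := isState_gibbs Φ A
  have hτB := isState_gibbs Φ B
  have hτC := isState_gibbs Φ C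
  have hSh : S.IsHermitian := hS ▸ slice_isHermitian hAC hB hdB hτB hWh
  have hSg : (g : ℂ) • (1 : Obs d (A ∪ C)) ≤ S := hS ▸ smul_one_le_slice hAC hB hdB hu hτB hWg
  set SA := slice A hCs (Φ.gibbs C) S with hSA
  set SC := slice C hAs (Φ.gibbs A) S with hSC
  have hSAh : SA.IsHermitian := slice_isHermitian hAs hCs hd hτC hSh
  have hSCh : SC.IsHermitian := slice_isHermitian hCs hAs hd.symm hτA hSh
  have hSAg : (g : ℂ) • (1 : Obs d A) ≤ SA :=
    smul_one_le_slice hAs hCs hd (subset_refl _) hτC hSg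
  have hSCg : (g : ℂ) • (1 : Obs d C) ≤ SC :=
    smul_one_le_slice hCs hAs hd.symm hcomm hτA hSg
  set s := (Φ.gibbs A * SA).trace with hs
  have hgC : (0 : ℂ) < g := Complex.zero_lt_real.2 hg
  have hspos : 0 < s := hgC.trans_le (le_trace_mul_of_smul_one_le hτA hSAg)
  obtain ⟨a, ha⟩ : ∃ a, a = boltz Φ A := ⟨_, rfl⟩
  obtain ⟨c, hc⟩ : ∃ c, c = boltz Φ C := ⟨_, rfl⟩
  set Za := (boltz Φ A * boltz Φ A).trace with hZa
  set Zb := (boltz Φ B * boltz Φ B).trace with hZb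
  set Zc := (boltz Φ C * boltz Φ C).trace with hZc
  set Z := (boltz Φ I * boltz Φ I).trace with hZ
  have hZapos : 0 < Za := trace_boltz_pos Φ A
  have hZbpos : 0 < Zb := trace_boltz_pos Φ B
  have hZcpos : 0 < Zc := trace_boltz_pos Φ C
  have hZpos : 0 < Z := trace_boltz_pos Φ I
  obtain ⟨k, hk⟩ : ∃ k, k = Z⁻¹ * Zb := ⟨_, rfl⟩
  have hkpos : 0 < k := hk ▸ mul_pos (inv_pos.2 hZpos) hZbpos
  obtain ⟨ac, hac⟩ : ∃ ac, ac = embed hAs a * embed hCs c := ⟨_, rfl⟩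
  have hac' : ac = embed hCs c * embed hAs a := by rw [hac, (embed_commute hAs hCs hd a c).eq]
  have hach : ac.IsHermitian := by
    rw [IsHermitian]
    nth_rewrite 1 [hac]
    rw [conjTranspose_mul, (embed_isHermitian hAs (ha ▸ boltz_isHermitian Φ A)).eq,
      (embed_isHermitian hCs (hc ▸ boltz_isHermitian Φ C)).eq, hac']
  have hacu : IsUnit ac := by
    rw [hac, ha, hc]
    exact ((isUnit_boltz Φ A).map (embedHom d hAs)).mul ((isUnit_boltz Φ C).map (embedHom d hCs))
  have hρ : reduced (A ∪ C) (Φ.gibbs I) = k • (ac * S * ac) := by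
    rw [gibbs_eq, reduced_smul, ← hZ, hW, ← ha, ← hc, ← hac, reduced_conj hAC hB hdB,
      boltz_mul_boltz_eq, slice_smul_left, ← hS, mul_smul_comm, smul_mul_assoc, smul_smul, ← hZb, hk]
  have hρA : reduced A (Φ.gibbs I) = (k * Zc) • (a * SA * a) := by
    rw [← reduced_reduced hAs hAC, hρ, reduced_smul, hac, reduced_conj hAs hCs hd, hc,
      boltz_mul_boltz_eq, slice_smul_left, mul_smul_comm, smul_mul_assoc, smul_smul]
  have hρC : reduced C (Φ.gibbs I) = (k * Za) • (c * SC * c) := by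
    rw [← reduced_reduced hCs hAC, hρ, reduced_smul, hac', reduced_conj hCs hAs hd.symm, ha,
      boltz_mul_boltz_eq, slice_smul_left, mul_smul_comm, smul_mul_assoc, smul_smul]
  have htr : (reduced (A ∪ C) (Φ.gibbs I)).trace = 1 := by
    rw [trace_reduced hAC]
    exact (isState_gibbs Φ I).1
  have hnorm : k * Zc * (Za * s) = 1 := by
    have h1 : (reduced A (Φ.gibbs I)).trace = 1 := by
      rw [trace_reduced (hAs.trans hAC)]
      exact (isState_gibbs Φ I).1
    rw [hρA, trace_smul, trace_mul_comm, ← mul_assoc, ha, boltz_mul_boltz_eq, smul_mul_assoc,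
      trace_smul] at h1
    exact h1
  obtain ⟨T, hT⟩ : ∃ T, T = embed hAs SA * embed hCs SC := ⟨_, rfl⟩
  have hTc := embed_commute hAs hCs hd SA SC
  have hTh : T.IsHermitian := by
    rw [IsHermitian, hT, conjTranspose_mul, (embed_isHermitian hAs hSAh).eq,
      (embed_isHermitian hCs hSCh).eq, hTc.eq]
  have hTg : ((g ^ 2 : ℝ) : ℂ) • (1 : Obs d (A ∪ C)) ≤ T := by
    have e : ∀ {X : Finset ℤ} (hX : X ⊆ A ∪ C) {M : Obs d X}, (g : ℂ) • (1 : Obs d X) ≤ M →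
        (g : ℂ) • (1 : Obs d (A ∪ C)) ≤ embed hX M := by
      intro X hX M hM
      have := embed_nonneg hX (sub_nonneg.2 hM)
      rwa [embed_sub, embed_smul, embed_one, sub_nonneg] at this
    rw [hT]
    exact smul_one_mul_le hTc hg.le (e hAs hSAg) (e hCs hSCg)
  have hσ : tensor (reduced A (Φ.gibbs I)) (reduced C (Φ.gibbs I)) = (k * s⁻¹) • (ac * T * ac) := by
    have h1 : embed hAs (a * SA * a) * embed hCs (c * SC * c) = ac * T * ac := by
      rw [embed_mul, embed_mul, embed_mul, embed_mul, hac, hT]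
      have c1 := embed_commute hAs hCs hd a c
      have c2 := embed_commute hAs hCs hd SA c
      have c3 := embed_commute hAs hCs hd a SC
      calc embed hAs a * embed hAs SA * embed hAs a * (embed hCs c * embed hCs SC * embed hCs c)
          = embed hAs a * embed hAs SA * (embed hAs a * embed hCs c) * embed hCs SC * embed hCs c := by
            simp only [mul_assoc]
        _ = embed hAs a * (embed hAs SA * embed hCs c) * (embed hAs a * embed hCs SC) *
            embed hCs c := by rw [c1.eq]; simp only [mul_assoc]
        _ = _ := by rw [c2.eq, c3.eq]; simp only [mul_assoc]
    -- Tr ρ_A = 1 eliminates the partition functions. Then ρ_AC and ρ_A ⊗ ρ_C are the same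
    -- conjugation, with the same prefactor k/s, of sS and of the product T of the marginals of S.
    have h2 : k * Zc * (k * Za) = k * s⁻¹ := by
      rw [eq_mul_inv_iff_mul_eq₀ hspos.ne']
      calc k * Zc * (k * Za) * s = k * (k * Zc * (Za * s)) := by ring
        _ = k := by rw [hnorm, mul_one]
    rw [hρA, hρC, tensor_eq hd, embed_smul, embed_smul, smul_mul_smul_comm, h1, h2]
  have hpd : ∀ {M : Obs d (A ∪ C)} {γ : ℝ} {x : ℂ}, 0 < γ → 0 < x →
      (γ : ℂ) • (1 : Obs d (A ∪ C)) ≤ M → (x • (ac * M * ac)).PosDef := by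
    intro M γ x hγ hx hM
    have h1 : M.PosDef := by
      have := (PosDef.one (n := Config d (A ∪ C)) (R := ℂ)).smul (Complex.zero_lt_real.2 hγ)
      have := this.add_posSemidef (le_iff.1 hM)
      rwa [add_sub_cancel] at this
    have h2 := h1.conjTranspose_mul_mul_same (mulVec_injective_of_isUnit hacu)
    rw [hach.eq] at h2
    exact h2.smul hx
  have hkey := smul_le_smul_of_norm_sub_le (M := s • S) (T := T)
    (by
      rw [IsHermitian, conjTranspose_smul, hSh.eq, RCLike.star_def,
        Complex.conj_eq_iff_im.2 (Complex.pos_iff.1 hspos).2.symm]) hTh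
    (by positivity) hTg (hT ▸ hδ)
  have hΛ : (((1 + δ / g ^ 2 : ℝ) : ℂ) •
      tensor (reduced A (Φ.gibbs I)) (reduced C (Φ.gibbs I)) -
        reduced (A ∪ C) (Φ.gibbs I)).PosSemidef := by
    have h1 := (le_iff.1 hkey).conjTranspose_mul_mul_same ac
    have h2 : (0 : ℂ) ≤ k * s⁻¹ := (mul_pos hkpos (inv_pos.2 hspos)).le
    have h3 := h1.smul h2
    rw [hach.eq, mul_sub, sub_mul, smul_sub] at h3
    have e1 : ((1 + δ / g ^ 2 : ℝ) : ℂ) •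
        tensor (reduced A (Φ.gibbs I)) (reduced C (Φ.gibbs I)) =
        (k * s⁻¹) • (ac * ((1 + δ / g ^ 2 : ℝ) : ℂ) • T * ac) := by
      rw [hσ, mul_smul_comm, smul_mul_assoc, smul_comm]
    have e2 : reduced (A ∪ C) (Φ.gibbs I) = (k * s⁻¹) • (ac * s • S * ac) := by
      rw [hρ, mul_smul_comm, smul_mul_assoc, smul_smul, mul_assoc k, inv_mul_cancel₀ hspos.ne',
        mul_one]
    rw [e1, e2]
    exact h3
  obtain ⟨h1, h2, h3⟩ := relEntropy_le_bsEntropy_le_geomRenyi_le (ρ := reduced (A ∪ C) (Φ.gibbs I))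
    (σ := tensor (reduced A (Φ.gibbs I)) (reduced C (Φ.gibbs I)))
    (by rw [hρ]; exact hpd hg hkpos hSg)
    (by rw [hσ]; exact hpd (by positivity) (mul_pos hkpos (inv_pos.2 hspos)) hTg) htr hΛ hq
  refine ⟨h1, h2, h3.trans ?_⟩
  have hδ0 : 0 ≤ δ / g ^ 2 := by
    have := (norm_nonneg _).trans hδ
    positivity
  have := Real.log_le_sub_one_of_pos (x := 1 + δ / g ^ 2) (by positivity)
  linarith

end Marginals

end SpinChain
end

noncomputable section

namespace SpinChain

open Matrix Finset NormedSpace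
open scoped ComplexOrder MatrixOrder

/-! ### The effective operator W of the two cuts. -/

section Effective

variable {d : ℕ}

theorem embed_halfSum {X I : Finset ℤ} (h : X ⊆ I) (Φ : Interaction d) :
    embed h (halfSum Φ X (subsets X)) = halfSum Φ I (subsets X) := by
  rw [halfSum, halfSum, ← embedHom_apply, map_sum]
  refine sum_congr rfl fun Z hZ => ?_
  have hZX := (mem_subsets.1 hZ).2
  rw [embedHom_apply, halfTerm, halfTerm, dif_pos hZX, dif_pos (hZX.trans h), embed_embed]

theorem embed_boltz {X I : Finset ℤ} (h : X ⊆ I) (Φ : Interaction d) :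
    embed h (boltz Φ X) = exp (-halfSum Φ I (subsets X)) := by
  rw [boltz, embed_exp, ← embed_halfSum h]
  exact congrArg exp (map_neg (embedHom d h) _)

theorem disjoint_subsets {X Y : Finset ℤ} (h : Disjoint X Y) :
    Disjoint (subsets X) (subsets Y) := by
  refine disjoint_left.2 fun Z h1 h2 => ?_
  obtain ⟨hne, hX⟩ := mem_subsets.1 h1
  exact hne (subset_empty.1 (h hX (mem_subsets.1 h2).2))

theorem commute_halfSum {X Y I : Finset ℤ} (hX : X ⊆ I) (hY : Y ⊆ I) (h : Disjoint X Y)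
    (Φ : Interaction d) : Commute (halfSum Φ I (subsets X)) (halfSum Φ I (subsets Y)) := by
  rw [← embed_halfSum hX, ← embed_halfSum hY]
  exact embed_commute hX hY h _ _

theorem exp_neg_halfSum {I A B C : Finset ℤ} (hAC : A ∪ C ⊆ I) (hB : B ⊆ I) (hd : Disjoint A C)
    (hdB : Disjoint (A ∪ C) B) (Φ : Interaction d) :
    exp (-halfSum Φ I (subsets A ∪ subsets C ∪ subsets B)) =
      embed hAC (embed subset_union_left (boltz Φ A) * embed subset_union_right (boltz Φ C)) *
        embed hB (boltz Φ B) := by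
  have hA : A ⊆ I := subset_union_left.trans hAC
  have hC : C ⊆ I := subset_union_right.trans hAC
  have dAB : Disjoint A B := hdB.mono_left subset_union_left
  have dCB : Disjoint C B := hdB.mono_left subset_union_right
  have h1 : halfSum Φ I (subsets A ∪ subsets C ∪ subsets B) = halfSum Φ I (subsets A) +
      halfSum Φ I (subsets C) + halfSum Φ I (subsets B) := by
    rw [halfSum, sum_union (disjoint_union_left.2 ⟨disjoint_subsets dAB, disjoint_subsets dCB⟩),
      sum_union (disjoint_subsets hd)]
    rfl
  have c1 := commute_halfSum hA hC hd Φ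
  have c2 := commute_halfSum hA hB dAB Φ
  have c3 := commute_halfSum hC hB dCB Φ
  rw [h1, neg_add, neg_add, exp_add_of_commute_real, exp_add_of_commute_real, embed_mul,
    embed_embed, embed_embed, embed_boltz, embed_boltz, embed_boltz]
  · exact c1.neg_left.neg_right
  · exact (c2.neg_left.add_left c3.neg_left).neg_right

theorem conjTranspose_exp_mul_exp_neg {n : Type*} [Fintype n] [DecidableEq n] {H K : Matrix n n ℂ}
    (hH : H.IsHermitian) (hK : K.IsHermitian) :
    (exp H * exp (-K))ᴴ = exp (-K) * exp H := by
  rw [conjTranspose_mul, (exp_isHermitian hH).eq, (exp_isHermitian hK.neg).eq]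

/-- Bounds on `F F†` for a product `F` of two expansionals with bounded inverses. -/
theorem expansional_mul_conjTranspose_bounds {n : Type*} [Fintype n] [DecidableEq n] [Nonempty n]
    {H₀ Hm H₁ : Matrix n n ℂ} (h₀ : H₀.IsHermitian) (h₁ : H₁.IsHermitian) {G : ℝ}
    (n1 : ‖exp Hm * exp (-H₁)‖ ≤ G) (n1' : ‖exp H₁ * exp (-Hm)‖ ≤ G)
    (n2 : ‖exp H₀ * exp (-Hm)‖ ≤ G) (n2' : ‖exp Hm * exp (-H₀)‖ ≤ G) {W : Matrix n n ℂ}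
    (hW : W = exp H₀ * exp (-Hm) * (exp Hm * exp (-H₁)) *
      (exp H₀ * exp (-Hm) * (exp Hm * exp (-H₁)))ᴴ) :
    (((G ^ 4)⁻¹ : ℝ) : ℂ) • (1 : Matrix n n ℂ) ≤ W ∧ ‖W‖ ≤ G ^ 4 ∧
      exp (-H₁) * exp (-H₁) = exp (-H₀) * W * exp (-H₀) := by
  have hF : exp H₀ * exp (-Hm) * (exp Hm * exp (-H₁)) = exp H₀ * exp (-H₁) := by
    rw [mul_assoc, ← mul_assoc (exp (-Hm)), exp_neg_mul_exp, one_mul]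
  obtain ⟨F, hFd⟩ : ∃ F, F = exp H₀ * exp (-Hm) * (exp Hm * exp (-H₁)) := ⟨_, rfl⟩
  obtain ⟨F', hF'⟩ : ∃ F, F = exp H₁ * exp (-Hm) * (exp Hm * exp (-H₀)) := ⟨_, rfl⟩
  have hFF' : F * F' = 1 := by
    have e : F' = exp H₁ * exp (-H₀) := by
      rw [hF', mul_assoc, ← mul_assoc (exp (-Hm)), exp_neg_mul_exp, one_mul]
    rw [hFd, hF, e, mul_assoc, ← mul_assoc (exp (-H₁)), exp_neg_mul_exp, one_mul, exp_mul_exp_neg]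
  have hG0 : 0 ≤ G := (norm_nonneg _).trans n1
  have nF : ‖F‖ ≤ G ^ 2 := by
    rw [hFd, pow_two]
    exact (norm_mul_le _ _).trans (by gcongr)
  have nF' : ‖F'‖ ≤ G ^ 2 := by
    rw [hF', pow_two]
    exact (norm_mul_le _ _).trans (by gcongr)
  have nFs : ‖Fᴴ‖ ≤ G ^ 2 := by rwa [l2_opNorm_conjTranspose]
  have nFs' : ‖F'ᴴ‖ ≤ G ^ 2 := by rwa [l2_opNorm_conjTranspose]
  have e4 : G ^ 2 * G ^ 2 = G ^ 4 := by ring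
  have hG1 : 0 < G ^ 4 := by
    have h : (1 : ℝ) ≤ G ^ 4 := by
      calc (1 : ℝ) = ‖F * F'‖ := by rw [hFF', CStarRing.norm_one]
        _ ≤ G ^ 2 * G ^ 2 := (norm_mul_le _ _).trans (by gcongr)
        _ = G ^ 4 := e4
    linarith
  rw [← hFd] at hW
  subst hW
  refine ⟨?_, ?_, ?_⟩
  -- Conjugating F' F'* ≤ G⁴ by F, where F' = F⁻¹, gives 1 ≤ G⁴ F F*.
  · have h1 := le_norm_smul_one (isHermitian_mul_conjTranspose_self F')
    have h2 : ((‖F' * F'ᴴ‖ : ℝ) : ℂ) • (1 : Matrix n n ℂ) ≤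
        ((G ^ 4 : ℝ) : ℂ) • (1 : Matrix n n ℂ) := by
      refine smul_le_smul_of_nonneg_right ?_ zero_le_one
      rw [Complex.real_le_real, ← e4]
      exact (norm_mul_le _ _).trans (by gcongr)
    have h3 := (le_iff.1 (h1.trans h2)).mul_mul_conjTranspose_same F
    have h4 : F * (((G ^ 4 : ℝ) : ℂ) • (1 : Matrix n n ℂ) - F' * F'ᴴ) * Fᴴ =
        ((G ^ 4 : ℝ) : ℂ) • (F * Fᴴ) - 1 := by
      rw [mul_sub, sub_mul, mul_smul_comm, smul_mul_assoc, mul_one]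
      congr 1
      rw [← mul_assoc F, hFF', one_mul, ← conjTranspose_mul, hFF', conjTranspose_one]
    rw [h4] at h3
    have h5 : (0 : ℂ) ≤ (((G ^ 4)⁻¹ : ℝ) : ℂ) := Complex.zero_le_real.2 (by positivity)
    have h6 := smul_le_smul_of_nonneg_left (le_iff.2 h3) h5
    rwa [smul_smul, ← Complex.ofReal_mul, inv_mul_cancel₀ hG1.ne', Complex.ofReal_one,
      one_smul] at h6
  · rw [← e4]
    exact (norm_mul_le _ _).trans (by gcongr)
  · rw [hFd, hF, conjTranspose_exp_mul_exp_neg h₀ h₁]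
    calc exp (-H₁) * exp (-H₁)
        = (exp (-H₀) * exp H₀) * exp (-H₁) * (exp (-H₁) * (exp H₀ * exp (-H₀))) := by
          rw [exp_neg_mul_exp, exp_mul_exp_neg, one_mul, mul_one]
      _ = _ := by simp only [mul_assoc]

theorem norm_mul_mul_conjTranspose_sub_le {n : Type*} [Fintype n] [DecidableEq n]
    {F₁ F₂ e₁ e₂ : Matrix n n ℂ} {G η : ℝ} (n1 : ‖F₁‖ ≤ G) (n2 : ‖F₂‖ ≤ G) (m1 : ‖e₁‖ ≤ G)
    (m2 : ‖e₂‖ ≤ G) (h1 : ‖F₁ - e₁‖ ≤ G * η) (h2 : ‖F₂ - e₂‖ ≤ G * η) :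
    ‖F₂ * F₁ * (F₂ * F₁)ᴴ - e₂ * e₁ * (e₂ * e₁)ᴴ‖ ≤ 4 * G ^ 4 * η := by
  have hG0 : 0 ≤ G := (norm_nonneg _).trans n1
  have hη : 0 ≤ G * η := (norm_nonneg _).trans h1
  have nF : ‖(F₂ * F₁)ᴴ‖ ≤ G * G := by
    rw [l2_opNorm_conjTranspose]
    exact (norm_mul_le _ _).trans (by gcongr)
  have nE : ‖e₂ * e₁‖ ≤ G * G := (norm_mul_le _ _).trans (by gcongr)
  have nD : ‖F₂ * F₁ - e₂ * e₁‖ ≤ G * η * G + G * (G * η) := by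
    have e : F₂ * F₁ - e₂ * e₁ = (F₂ - e₂) * F₁ + e₂ * (F₁ - e₁) := by noncomm_ring
    rw [e]
    exact norm_add_le_of_le ((norm_mul_le _ _).trans (by gcongr))
      ((norm_mul_le _ _).trans (by gcongr))
  have nDs : ‖(F₂ * F₁ - e₂ * e₁)ᴴ‖ ≤ G * η * G + G * (G * η) := by
    rwa [l2_opNorm_conjTranspose]
  have e : F₂ * F₁ * (F₂ * F₁)ᴴ - e₂ * e₁ * (e₂ * e₁)ᴴ =
      (F₂ * F₁ - e₂ * e₁) * (F₂ * F₁)ᴴ + e₂ * e₁ * (F₂ * F₁ - e₂ * e₁)ᴴ := by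
    rw [conjTranspose_sub, mul_sub, sub_mul]
    abel
  rw [e]
  calc _ ≤ (G * η * G + G * (G * η)) * (G * G) + G * G * (G * η * G + G * (G * η)) :=
        norm_add_le_of_le ((norm_mul_le _ _).trans (by gcongr))
          ((norm_mul_le _ _).trans (by gcongr))
    _ = _ := by ring

variable [NeZero d] {Φ : Interaction d} {r J : ℝ}


/-- The effective operator that relates the Gibbs state on `I = ABC` to the Gibbs states on the
three pieces. -/
theorem exists_effective (hr : Φ.HasRange r) (hJ : Φ.HasStrength J) {x y z w : ℤ} (hxy : x ≤ y)
    (hyz : y ≤ z) (hzw : z ≤ w) (hAC : Ico x y ∪ Ico z w ⊆ Ico x w) (hB : Ico y z ⊆ Ico x w) :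
    ∃ W : Obs d (Ico x w), W.IsHermitian ∧
      (((expansionalBound r J ^ 4)⁻¹ : ℝ) : ℂ) • (1 : Obs d (Ico x w)) ≤ W ∧
      ‖W‖ ≤ expansionalBound r J ^ 4 ∧
      boltz Φ (Ico x w) * boltz Φ (Ico x w) =
        embed hAC (embed subset_union_left (boltz Φ (Ico x y)) *
          embed subset_union_right (boltz Φ (Ico z w))) * embed hB (boltz Φ (Ico y z)) * W *
        (embed hAC (embed subset_union_left (boltz Φ (Ico x y)) *
          embed subset_union_right (boltz Φ (Ico z w))) * embed hB (boltz Φ (Ico y z))) ∧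
      ∀ M : ℕ, Disjoint (nbhd r (Ico x w) y M) (nbhd r (Ico x w) z M) →
        ∃ (w₁ : Obs d (nbhd r (Ico x w) y M)) (w₂ : Obs d (nbhd r (Ico x w) z M)),
          w₁.IsHermitian ∧ w₂.IsHermitian ∧ ‖w₁‖ ≤ expansionalBound r J ^ 2 ∧
          ‖w₂‖ ≤ expansionalBound r J ^ 2 ∧
          ‖W - embed (nbhd_subset r _ y M) w₁ * embed (nbhd_subset r _ z M) w₂‖ ≤
            4 * expansionalBound r J ^ 4 * Real.exp (-M) := by
  set I := Ico x w with hI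
  set G := expansionalBound r J with hG
  have hd : Disjoint (Ico x y) (Ico z w) := by
    refine disjoint_left.2 fun a h1 h2 => ?_
    rw [mem_Ico] at h1 h2
    omega
  have hdB : Disjoint (Ico x y ∪ Ico z w) (Ico y z) := by
    refine disjoint_left.2 fun a h1 h2 => ?_
    simp only [mem_union, mem_Ico] at h1 h2
    omega
  -- The couplings are switched on one cut at a time: `T₀` has three separate pieces, `Tm` joins the
  -- last two across z, and `T₁` joins everything across y. Each step adds only sets that straddle
  -- one cut.
  let T₀ := subsets (Ico x y) ∪ subsets (Ico z w) ∪ subsets (Ico y z)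
  let Tm := subsets (Ico x y) ∪ subsets (Ico y w)
  let T₁ := subsets I
  have h0m : T₀ ⊆ Tm := by
    intro Z hZ
    simp only [T₀, Tm, mem_union, mem_subsets] at hZ ⊢
    rcases hZ with (hZ | hZ) | hZ
    · exact Or.inl hZ
    · exact Or.inr ⟨hZ.1, hZ.2.trans (Ico_subset_Ico hyz le_rfl)⟩
    · exact Or.inr ⟨hZ.1, hZ.2.trans (Ico_subset_Ico le_rfl hzw)⟩
  have hm1 : Tm ⊆ T₁ := by
    intro Z hZ
    simp only [T₁, Tm, mem_union, mem_subsets] at hZ ⊢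
    rcases hZ with hZ | hZ
    · exact ⟨hZ.1, hZ.2.trans (Ico_subset_Ico le_rfl (hyz.trans hzw))⟩
    · exact ⟨hZ.1, hZ.2.trans (Ico_subset_Ico hxy le_rfl)⟩
  have hT₁ : ∀ Z ∈ T₁, Z ⊆ I ∧ Z.Nonempty := fun Z hZ =>
    ⟨(mem_subsets.1 hZ).2, nonempty_iff_ne_empty.2 (mem_subsets.1 hZ).1⟩
  have hcross1 : ∀ Z ∈ T₁ \ Tm, (∃ a ∈ Z, a < y) ∧ ∃ b ∈ Z, y ≤ b := by
    intro Z hZ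
    simp only [T₁, Tm, mem_sdiff, mem_union, mem_subsets, not_or, not_and, not_subset] at hZ
    obtain ⟨⟨hne, hZI⟩, h1, h2⟩ := hZ
    obtain ⟨b, hb, hb'⟩ := h1 hne
    obtain ⟨a, ha, ha'⟩ := h2 hne
    have hbI := mem_Ico.1 (hZI hb)
    have haI := mem_Ico.1 (hZI ha)
    rw [mem_Ico] at hb' ha'
    exact ⟨⟨a, ha, by omega⟩, b, hb, by omega⟩
  have hcross0 : ∀ Z ∈ Tm \ T₀, (∃ a ∈ Z, a < z) ∧ ∃ b ∈ Z, z ≤ b := by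
    intro Z hZ
    simp only [T₀, Tm, mem_sdiff, mem_union, mem_subsets, not_or, not_and, not_subset] at hZ
    obtain ⟨hZm, ⟨h1, h2⟩, h3⟩ := hZ
    rcases hZm with ⟨hne, hZA⟩ | ⟨hne, hZB⟩
    · obtain ⟨b, hb, hb'⟩ := h1 hne
      exact absurd (hZA hb) hb'
    obtain ⟨a, ha, ha'⟩ := h2 hne
    obtain ⟨b, hb, hb'⟩ := h3 hne
    have hbI := mem_Ico.1 (hZB hb)
    have haI := mem_Ico.1 (hZB ha)
    rw [mem_Ico] at hb' ha'
    exact ⟨⟨a, ha, by omega⟩, b, hb, by omega⟩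
  obtain ⟨n1, n1', loc1⟩ := expansional_estimates hr hJ hm1 hT₁ hcross1
  obtain ⟨n2, n2', loc2⟩ := expansional_estimates (I := I) hr hJ h0m
    (fun Z hZ => hT₁ Z (hm1 hZ)) hcross0
  rw [← hG] at n1 n1' n2 n2' loc1 loc2
  obtain ⟨b1, b2, b3⟩ := expansional_mul_conjTranspose_bounds (halfSum_isHermitian Φ I T₀)
    (halfSum_isHermitian Φ I T₁) n1 n1' n2 n2' rfl
  rw [exp_neg_halfSum hAC hB hd hdB] at b3
  refine ⟨_, isHermitian_mul_conjTranspose_self _, b1, b2, b3, fun M hdis => ?_⟩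
  obtain ⟨f1, nf1, hf1⟩ := loc1 M
  obtain ⟨f2, nf2, hf2⟩ := loc2 M
  obtain ⟨e1, he1⟩ : ∃ e, e = embed (nbhd_subset r I y M) f1 := ⟨_, rfl⟩
  obtain ⟨e2, he2⟩ : ∃ e, e = embed (nbhd_subset r I z M) f2 := ⟨_, rfl⟩
  have ne1 : ‖e1‖ ≤ G := by rw [he1, norm_embed]; exact nf1
  have ne2 : ‖e2‖ ≤ G := by rw [he2, norm_embed]; exact nf2
  rw [← he1] at hf1
  rw [← he2] at hf2
  have hG0 : 0 ≤ G := (norm_nonneg _).trans n1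
  refine ⟨f1 * f1ᴴ, f2 * f2ᴴ, isHermitian_mul_conjTranspose_self _,
    isHermitian_mul_conjTranspose_self _, ?_, ?_, ?_⟩
  · rw [pow_two]
    exact (norm_mul_le _ _).trans (by rw [l2_opNorm_conjTranspose]; gcongr)
  · rw [pow_two]
    exact (norm_mul_le _ _).trans (by rw [l2_opNorm_conjTranspose]; gcongr)
  -- Disjoint neighbourhoods let e2 pass e1 e1*, so e2 e1 (e2 e1)* splits into e1 e1* times e2 e2*.
  · have c1 : Commute (e1 * e1ᴴ) e2 := by
      rw [he1, he2, ← embed_conjTranspose, ← embed_mul]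
      exact embed_commute _ _ hdis _ _
    have hW : embed (nbhd_subset r I y M) (f1 * f1ᴴ) * embed (nbhd_subset r I z M) (f2 * f2ᴴ) =
        e2 * e1 * (e2 * e1)ᴴ := by
      rw [embed_mul, embed_mul, embed_conjTranspose, embed_conjTranspose, ← he1, ← he2,
        conjTranspose_mul, ← mul_assoc, c1.eq]
      simp only [mul_assoc]
    rw [hW]
    exact norm_mul_mul_conjTranspose_sub_le n1 n2 ne1 ne2 hf1 hf2

end Effective

/-! ### Decoupling of the two cuts by clustering. -/

section Clustering

variable {d : ℕ}

theorem single_eq_embed_mul_embed {X X' X'' : Finset ℤ} (h' : X' ⊆ X) (h'' : X'' ⊆ X)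
    (hd : Disjoint X' X'') (hu : X ⊆ X' ∪ X'') (s t : Config d X) :
    single s t (1 : ℂ) = embed h' (single (restr h' s) (restr h' t) 1) *
      embed h'' (single (restr h'' s) (restr h'' t) 1) := by
  ext u v
  rw [embed_mul_embed_apply h' h'' hd, if_pos fun x h1 h2 =>
    ((mem_union.1 (hu x.2)).elim h1 h2).elim]
  have e : ∀ a b : Config d X, a = b ↔ restr h' a = restr h' b ∧ restr h'' a = restr h'' b := by
    intro a b
    rw [← (configEquiv d h' h'' hd hu).injective.eq_iff]
    exact Prod.ext_iff
  simp only [single_apply, e]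
  by_cases h1 : restr h' s = restr h' u <;> by_cases h2 : restr h'' s = restr h'' u <;>
    by_cases h3 : restr h' t = restr h' v <;> by_cases h4 : restr h'' t = restr h'' v <;>
    simp [h1, h2, h3, h4]

/-- An operator straddling a cut is split into products of one-sided matrix units. These have norm
one, and the coefficients are entries of w, so the cost of the splitting is the number d^{2|X|} of
terms. -/
theorem embed_eq_sum {I A B X : Finset ℤ} (hA : A ⊆ I) (hB : B ⊆ I) (hX : X ⊆ I)
    (hd : Disjoint A B) (hXu : X ⊆ A ∪ B) (w : Obs d X) :
    embed hX w = ∑ p : Config d X × Config d X, w p.1 p.2 •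
      (embed hA (embed inter_subset_right
        (single (restr (inter_subset_left (s₂ := A)) p.1) (restr inter_subset_left p.2) (1 : ℂ))) *
      embed hB (embed inter_subset_right
        (single (restr (inter_subset_left (s₂ := B)) p.1) (restr inter_subset_left p.2) (1 : ℂ)))) := by
  conv_lhs => rw [matrix_eq_sum_single w]
  rw [← embedHom_apply, map_sum, Fintype.sum_prod_type]
  refine sum_congr rfl fun s _ => ?_
  rw [map_sum]
  refine sum_congr rfl fun t _ => ?_
  have h1 : single s t (w s t) = w s t • single s t (1 : ℂ) := by rw [smul_single, smul_eq_mul, mul_one]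
  rw [h1, map_smul, embedHom_apply, single_eq_embed_mul_embed (X' := X ∩ A) (X'' := X ∩ B)
    inter_subset_left inter_subset_left (hd.mono inter_subset_right inter_subset_right)
    (by rw [← inter_union_distrib_left]; exact subset_inter (subset_refl _) hXu),
    embed_mul, embed_embed, embed_embed, embed_embed, embed_embed]

/-- Averaging over B turns each factor on B into its expectation. The failure of the slice to be
multiplicative on W₁ W₂ is thus exactly a sum of covariances of the B-factors at the two ends. -/
theorem slice_mul_sub_eq {I A B C : Finset ℤ} (hAC : A ∪ C ⊆ I) (hB : B ⊆ I)
    (hdB : Disjoint (A ∪ C) B) (hu : I ⊆ (A ∪ C) ∪ B) (τ : Obs d B) {ι κ : Type*} [Fintype ι]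
    [Fintype κ] (x : ι → ℂ) (y : κ → ℂ) (a : ι → Obs d A) (b : ι → Obs d B) (c : κ → Obs d C)
    (b' : κ → Obs d B) (W₁ W₂ : Obs d I)
    (hW₁ : W₁ = ∑ i, x i • (embed (subset_union_left.trans hAC) (a i) * embed hB (b i)))
    (hW₂ : W₂ = ∑ j, y j • (embed (subset_union_right.trans hAC) (c j) * embed hB (b' j))) :
    slice (A ∪ C) hB τ W₁ = embed subset_union_left (∑ i, (x i * (τ * b i).trace) • a i) ∧
    slice (A ∪ C) hB τ W₂ = embed subset_union_right (∑ j, (y j * (τ * b' j).trace) • c j) ∧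
    slice (A ∪ C) hB τ (W₁ * W₂) - slice (A ∪ C) hB τ W₁ * slice (A ∪ C) hB τ W₂ =
      ∑ i, ∑ j, (x i * y j * ((τ * (b i * b' j)).trace - (τ * b i).trace * (τ * b' j).trace)) •
        (embed subset_union_left (a i) * embed subset_union_right (c j)) := by
  have hAs : A ⊆ A ∪ C := subset_union_left
  have hCs : C ⊆ A ∪ C := subset_union_right
  have key : ∀ (m : Obs d (A ∪ C)) (n : Obs d B),
      slice (A ∪ C) hB τ (embed hAC m * embed hB n) = (τ * n).trace • m := by
    intro m n
    rw [slice_embed_mul hAC hB hdB, slice_embed hAC hB hdB hu, mul_smul_comm, mul_one]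
  have h1 : slice (A ∪ C) hB τ W₁ = ∑ i, (x i * (τ * b i).trace) • embed hAs (a i) := by
    rw [hW₁, slice_sum]
    refine sum_congr rfl fun i _ => ?_
    rw [slice_smul, ← embed_embed hAs hAC, key, smul_smul]
  have h2 : slice (A ∪ C) hB τ W₂ = ∑ j, (y j * (τ * b' j).trace) • embed hCs (c j) := by
    rw [hW₂, slice_sum]
    refine sum_congr rfl fun i _ => ?_
    rw [slice_smul, ← embed_embed hCs hAC, key, smul_smul]
  refine ⟨?_, ?_, ?_⟩
  · rw [h1, ← embedHom_apply, map_sum]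
    exact sum_congr rfl fun i _ => (map_smul (embedHom d hAs) _ _).symm
  · rw [h2, ← embedHom_apply, map_sum]
    exact sum_congr rfl fun i _ => (map_smul (embedHom d hCs) _ _).symm
  · rw [h1, h2, hW₁, hW₂, sum_mul_sum, sum_mul_sum, slice_sum, ← sum_sub_distrib]
    refine sum_congr rfl fun i _ => ?_
    rw [slice_sum, ← sum_sub_distrib]
    refine sum_congr rfl fun j _ => ?_
    have e : embed (hAs.trans hAC) (a i) * embed hB (b i) *
        (embed (hCs.trans hAC) (c j) * embed hB (b' j)) =
        embed hAC (embed hAs (a i) * embed hCs (c j)) * embed hB (b i * b' j) := by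
      rw [embed_mul, embed_mul, embed_embed, embed_embed]
      have hc := embed_commute hB (hCs.trans hAC) (hdB.mono_left hCs).symm (b i) (c j)
      simp only [mul_assoc]
      rw [← mul_assoc (embed hB (b i)), hc.eq]
      simp only [mul_assoc]
    rw [smul_mul_smul_comm, e, slice_smul, key, smul_mul_smul_comm, smul_smul, ← sub_smul]
    congr 1
    ring

variable [NeZero d]

/-- An operator that is a product of operators near the two ends of `B` is mapped to an almost
product if the state of `B` clusters. -/
theorem exists_slice_approx {I A B C X₁ X₂ : Finset ℤ} (hAC : A ∪ C ⊆ I) (hB : B ⊆ I)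
    (hdB : Disjoint (A ∪ C) B) (hu : I ⊆ (A ∪ C) ∪ B) (τ : Obs d B)
    (hX₁ : X₁ ⊆ I) (hX₂ : X₂ ⊆ I) (hX₁' : X₁ ⊆ A ∪ B) (hX₂' : X₂ ⊆ C ∪ B) (w₁ : Obs d X₁)
    (w₂ : Obs d X₂) {k ε : ℝ} (hk₁ : ‖w₁‖ ≤ k) (hk₂ : ‖w₂‖ ≤ k)
    (hε : ∀ (s t : Config d (X₁ ∩ B)) (u v : Config d (X₂ ∩ B)),
      ‖(τ * (embed inter_subset_right (single s t 1) *
          embed inter_subset_right (single u v 1))).trace -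
        (τ * embed inter_subset_right (single s t 1)).trace *
          (τ * embed inter_subset_right (single u v 1)).trace‖ ≤ ε) :
    ∃ (P : Obs d A) (Q : Obs d C), slice (A ∪ C) hB τ (embed hX₁ w₁) = embed subset_union_left P ∧
      slice (A ∪ C) hB τ (embed hX₂ w₂) = embed subset_union_right Q ∧
      ‖slice (A ∪ C) hB τ (embed hX₁ w₁ * embed hX₂ w₂) -
          embed subset_union_left P * embed subset_union_right Q‖ ≤
        (d : ℝ) ^ (2 * (X₁.card + X₂.card)) * k ^ 2 * ε := by
  have hA : A ⊆ I := subset_union_left.trans hAC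
  have hC : C ⊆ I := subset_union_right.trans hAC
  obtain ⟨h1, h2, h3⟩ := slice_mul_sub_eq hAC hB hdB hu τ _ _ _ _ _ _ _ _
    (embed_eq_sum hA hB hX₁ (hdB.mono_left subset_union_left) hX₁' w₁)
    (embed_eq_sum hC hB hX₂ (hdB.mono_left subset_union_right) hX₂' w₂)
  refine ⟨_, _, h1, h2, ?_⟩
  rw [← h1, ← h2, h3]
  have hk : 0 ≤ k := (norm_nonneg _).trans hk₁
  calc _ ≤ ∑ p : Config d X₁ × Config d X₁, ∑ p' : Config d X₂ × Config d X₂, k * k * ε := by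
        refine norm_sum_le_of_le _ fun p _ => norm_sum_le_of_le _ fun p' _ => ?_
        rw [norm_smul, norm_mul, norm_mul]
        have h4 : ‖embed (subset_union_left (s₂ := C)) (embed inter_subset_right
            (single (restr (inter_subset_left (s₂ := A)) p.1) (restr inter_subset_left p.2)
              (1 : ℂ))) * embed (subset_union_right (s₁ := A)) (embed inter_subset_right
            (single (restr (inter_subset_left (s₂ := C)) p'.1) (restr inter_subset_left p'.2)
              (1 : ℂ)))‖ ≤ 1 := by
          refine (norm_mul_le _ _).trans ?_
          rw [norm_embed, norm_embed, norm_embed, norm_embed, norm_single_one, norm_single_one,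
            one_mul]
        have h5 := (norm_apply_le_norm w₁ p.1 p.2).trans hk₁
        have h6 := (norm_apply_le_norm w₂ p'.1 p'.2).trans hk₂
        refine (mul_le_of_le_one_right (by positivity) h4).trans ?_
        exact mul_le_mul (mul_le_mul h5 h6 (norm_nonneg _) hk) (hε _ _ _ _) (norm_nonneg _)
          (by positivity)
    _ = _ := by
        simp only [sum_const, card_univ, Fintype.card_prod, Fintype.card_fun, Fintype.card_fin,
          Fintype.card_coe, nsmul_eq_mul]
        push_cast
        ring

/-- Matrix units have norm one, so they are admissible in the supremum; duality of the partial trace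
rewrites its entries as covariances in τ. -/
theorem cov_le_corr {B X₁ X₂ : Finset ℤ} (h₁ : X₁ ⊆ B) (h₂ : X₂ ⊆ B) (hd : Disjoint X₁ X₂)
    (τ : Obs d B) (s t : Config d X₁) (u v : Config d X₂) :
    ‖(τ * (embed h₁ (single s t 1) * embed h₂ (single u v 1))).trace -
        (τ * embed h₁ (single s t 1)).trace * (τ * embed h₂ (single u v 1)).trace‖ ≤
      corr τ X₁ X₂ := by
  have hs : X₁ ∪ X₂ ⊆ B := union_subset h₁ h₂
  have e : ∀ (Q : Obs d X₁) (R : Obs d X₂), (tensor Q R * (reduced (X₁ ∪ X₂) τ -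
      tensor (reduced X₁ τ) (reduced X₂ τ))).trace =
      (τ * (embed h₁ Q * embed h₂ R)).trace - (τ * embed h₁ Q).trace * (τ * embed h₂ R).trace := by
    intro Q R
    have h1 : (tensor Q R * reduced (X₁ ∪ X₂) τ).trace = (τ * (embed h₁ Q * embed h₂ R)).trace := by
      rw [trace_mul_comm, trace_reduced_mul hs, tensor_eq hd, embed_mul, embed_embed, embed_embed]
    have h2 : (tensor Q R * tensor (reduced X₁ τ) (reduced X₂ τ)).trace =
        (τ * embed h₁ Q).trace * (τ * embed h₂ R).trace := by
      rw [tensor_eq hd, tensor_eq hd, mul_assoc, ← mul_assoc (embed subset_union_right R),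
        ← (embed_commute subset_union_left subset_union_right hd (reduced X₁ τ) R).eq, mul_assoc,
        ← mul_assoc, ← embed_mul, ← embed_mul, trace_embed_mul_embed _ _ hd (subset_refl _),
        trace_mul_comm, trace_reduced_mul h₁, trace_mul_comm R, trace_reduced_mul h₂]
    rw [mul_sub, trace_sub, h1, h2]
  refine le_csSup ?_ ⟨single s t 1, single u v 1, norm_single_one _ _, norm_single_one _ _, ?_⟩
  -- A real `sSup` is meaningful only for a bounded set. The sum of the absolute values of the
  -- entries of D is a bound, because entries of a tensor product of norm-one operators are at most
  -- 1 in modulus.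
  · obtain ⟨D, hD⟩ : ∃ D, D = reduced (X₁ ∪ X₂) τ - tensor (reduced X₁ τ) (reduced X₂ τ) := ⟨_, rfl⟩
    refine ⟨∑ i, ∑ j, ‖D j i‖, ?_⟩
    rintro _ ⟨Q, R, hQ, hR, rfl⟩
    rw [← hD, trace]
    refine norm_sum_le_of_le _ fun i _ => ?_
    rw [diag_apply, mul_apply]
    refine norm_sum_le_of_le _ fun j _ => ?_
    rw [norm_mul]
    refine mul_le_of_le_one_left (norm_nonneg _) ((norm_apply_le_norm _ _ _).trans ?_)
    rw [tensor_eq hd]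
    refine (norm_mul_le _ _).trans ?_
    rw [norm_embed, norm_embed, hQ, hR, one_mul]
  · rw [e]

end Clustering

end SpinChain
end

noncomputable section

namespace SpinChain

open Matrix Finset

/-! ### Quantitative decay and choice of scales. -/

section Decay

variable {d : ℕ} [NeZero d] {Φ : Interaction d} {r J : ℝ}

theorem expansionalBound_pos (r : ℝ) (hJ : 0 ≤ J) : 0 < expansionalBound r J := by
  have h1 : 0 ≤ shellBound r J := by rw [shellBound]; positivity
  have h2 : 0 ≤ shellConst (shellBound r J) := (Real.exp_pos _).le
  rw [expansionalBound]
  positivity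

theorem isHermitian_of_embed {X Λ : Finset ℤ} (h : X ⊆ Λ) {Q : Obs d X}
    (hQ : (embed h Q).IsHermitian) : Q.IsHermitian := by
  refine embed_injective h ?_
  rw [embed_conjTranspose, hQ.eq]

/-- The mutual informations of the end pieces of an interval are bounded uniformly, and decay with
the size of the middle piece. -/
theorem mutualInfo_chain_bounds (hr : Φ.HasRange r) (hJ : Φ.HasStrength J) {x y z w : ℤ}
    (hxy : x ≤ y) (hyz : y ≤ z) (hzw : z ≤ w) {q : ℝ} (hq : 1 ≤ q) :
    mutualInfo (Φ.gibbs (Ico x w)) (Ico x y) (Ico z w) ≤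
        bsMutualInfo (Φ.gibbs (Ico x w)) (Ico x y) (Ico z w) ∧
      bsMutualInfo (Φ.gibbs (Ico x w)) (Ico x y) (Ico z w) ≤
        renyiMutualInfo q (Φ.gibbs (Ico x w)) (Ico x y) (Ico z w) ∧
      renyiMutualInfo q (Φ.gibbs (Ico x w)) (Ico x y) (Ico z w) ≤
        2 * expansionalBound r J ^ 16 ∧
      ∀ (M m : ℕ) (ε : ℝ), m = (M + 1) * rangeLen r → y + m ≤ z - m →
        corr (Φ.gibbs (Ico y z)) (Ico y (y + m)) (Ico (z - m) z) ≤ ε →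
        renyiMutualInfo q (Φ.gibbs (Ico x w)) (Ico x y) (Ico z w) ≤
          16 * expansionalBound r J ^ 16 * (Real.exp (-M) + (d : ℝ) ^ (8 * m) * ε) := by
  have hAC : Ico x y ∪ Ico z w ⊆ Ico x w :=
    union_subset (Ico_subset_Ico le_rfl (hyz.trans hzw)) (Ico_subset_Ico (hxy.trans hyz) le_rfl)
  have hB : Ico y z ⊆ Ico x w := Ico_subset_Ico hxy hzw
  have hd : Disjoint (Ico x y) (Ico z w) := by
    refine disjoint_left.2 fun a h1 h2 => ?_
    rw [mem_Ico] at h1 h2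
    omega
  have hdB : Disjoint (Ico x y ∪ Ico z w) (Ico y z) := by
    refine disjoint_left.2 fun a h1 h2 => ?_
    simp only [mem_union, mem_Ico] at h1 h2
    omega
  have hu : Ico x w ⊆ (Ico x y ∪ Ico z w) ∪ Ico y z := by
    intro a ha
    simp only [mem_union, mem_Ico] at ha ⊢
    omega
  have hτA := isState_gibbs Φ (Ico x y)
  have hτB := isState_gibbs Φ (Ico y z)
  have hτC := isState_gibbs Φ (Ico z w)
  obtain ⟨W, hWh, hWg, hWn, hW, hloc⟩ := exists_effective hr hJ hxy hyz hzw hAC hB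
  obtain ⟨G, hG⟩ : ∃ G, G = expansionalBound r J := ⟨_, rfl⟩
  rw [← hG] at hWg hWn hloc ⊢
  have hG0 : 0 < G := hG ▸ expansionalBound_pos r ((norm_nonneg _).trans (hJ ∅))
  have hSh := slice_isHermitian hAC hB hdB hτB hWh
  have hSn := (norm_slice_le hAC hB hdB hu hτB hWh).trans hWn
  have key := fun (δ : ℝ) hδ => mutualInfo_chain (δ := δ) hAC hB hd hdB hu hW
    (inv_pos.2 (pow_pos hG0 4)) hWh hWg rfl hδ hq
  -- Here δ = 2 G⁸ and the lower bound on W is G⁻⁴, so the quotient is 2 G¹⁶.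
  have h2 := key _ (norm_marginal_sub_le_two hd hτA hτC hSh hSn)
  refine ⟨h2.1, h2.2.1, h2.2.2.trans_eq ?_, fun M m ε hm hlen hε => ?_⟩
  · field_simp
  have hX₁ := nbhd_subset r (Ico x w) y M
  have hX₂ := nbhd_subset r (Ico x w) z M
  have em : ((M : ℤ) + 1) * rangeLen r = m := by rw [hm]; push_cast; rfl
  have e₁ : nbhd r (Ico x w) y M = Ico x w ∩ Ico (y - m) (y + m) := by rw [nbhd, em]
  have e₂ : nbhd r (Ico x w) z M = Ico x w ∩ Ico (z - m) (z + m) := by rw [nbhd, em]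
  have i₁ : nbhd r (Ico x w) y M ∩ Ico y z = Ico y (y + m) := by
    ext a
    simp only [e₁, mem_inter, mem_Ico]
    omega
  have i₂ : nbhd r (Ico x w) z M ∩ Ico y z = Ico (z - m) z := by
    ext a
    simp only [e₂, mem_inter, mem_Ico]
    omega
  have hX₁' : nbhd r (Ico x w) y M ⊆ Ico x y ∪ Ico y z := by
    intro a
    simp only [e₁, mem_inter, mem_union, mem_Ico]
    omega
  have hX₂' : nbhd r (Ico x w) z M ⊆ Ico z w ∪ Ico y z := by
    intro a
    simp only [e₂, mem_inter, mem_union, mem_Ico]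
    omega
  have hdis : Disjoint (nbhd r (Ico x w) y M) (nbhd r (Ico x w) z M) := by
    refine disjoint_left.2 fun a h1 h2 => ?_
    simp only [e₁, e₂, mem_inter, mem_Ico] at h1 h2
    omega
  have c₁ : (nbhd r (Ico x w) y M).card ≤ 2 * m := by
    rw [e₁]
    refine (card_le_card inter_subset_right).trans ?_
    rw [Int.card_Ico]
    omega
  have c₂ : (nbhd r (Ico x w) z M).card ≤ 2 * m := by
    rw [e₂]
    refine (card_le_card inter_subset_right).trans ?_
    rw [Int.card_Ico]
    omega
  obtain ⟨w₁, w₂, h₁, h₂, n₁, n₂, hWw⟩ := hloc M hdis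
  have hcov := fun s t u v => (cov_le_corr (X₁ := nbhd r (Ico x w) y M ∩ Ico y z)
    (X₂ := nbhd r (Ico x w) z M ∩ Ico y z) inter_subset_right inter_subset_right
    (hdis.mono inter_subset_left inter_subset_left) (Φ.gibbs (Ico y z)) s t u v).trans
    ((congrArg₂ (corr (Φ.gibbs (Ico y z))) i₁ i₂).le.trans hε)
  obtain ⟨P, Q, hP, hQ, hPQ⟩ := exists_slice_approx hAC hB hdB hu (Φ.gibbs (Ico y z)) hX₁ hX₂ hX₁'
    hX₂' w₁ w₂ n₁ n₂ hcov
  have hW₁ := embed_isHermitian hX₁ h₁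
  have hW₂ := embed_isHermitian hX₂ h₂
  have hε0 : 0 ≤ ε := by
    have v : Config d (nbhd r (Ico x w) y M ∩ Ico y z) := fun _ => 0
    have v' : Config d (nbhd r (Ico x w) z M ∩ Ico y z) := fun _ => 0
    exact (norm_nonneg _).trans (hcov v v v' v')
  have hPh : P.IsHermitian := isHermitian_of_embed subset_union_left
    (hP ▸ slice_isHermitian hAC hB hdB hτB hW₁)
  have hQh : Q.IsHermitian := isHermitian_of_embed subset_union_right
    (hQ ▸ slice_isHermitian hAC hB hdB hτB hW₂)
  have hPn : ‖P‖ ≤ G ^ 2 := by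
    rw [← norm_embed subset_union_left P, ← hP]
    refine (norm_slice_le hAC hB hdB hu hτB hW₁).trans ?_
    rwa [norm_embed]
  have hQn : ‖Q‖ ≤ G ^ 2 := by
    rw [← norm_embed subset_union_right Q, ← hQ]
    refine (norm_slice_le hAC hB hdB hu hτB hW₂).trans ?_
    rwa [norm_embed]
  have hprod : (embed hX₁ w₁ * embed hX₂ w₂).IsHermitian := by
    rw [IsHermitian, conjTranspose_mul, hW₁.eq, hW₂.eq, (embed_commute hX₁ hX₂ hdis w₁ w₂).eq]
  have h3 := (norm_slice_le hAC hB hdB hu hτB (hWh.sub hprod)).trans hWw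
  rw [slice_sub] at h3
  have hd1 : (1 : ℝ) ≤ d := by exact_mod_cast NeZero.one_le
  -- Each neighbourhood has at most 2m sites, and matrix units are indexed by pairs of
  -- configurations; this gives the exponent 2(2m + 2m).
  have hpow : (d : ℝ) ^ (2 * ((nbhd r (Ico x w) y M).card + (nbhd r (Ico x w) z M).card)) ≤
      (d : ℝ) ^ (8 * m) := pow_le_pow_right₀ hd1 (by omega)
  have h4 := norm_add_le_of_le h3 hPQ
  rw [sub_add_sub_cancel] at h4
  have e4 : G ^ 4 = (G ^ 2) ^ 2 := by ring
  refine (key _ (norm_marginal_sub_le hd hτA hτC hSh hPh hQh (hSn.trans_eq e4) hPn hQn h4)).2.2.trans ?_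
  have e5 : ∀ t : ℝ, t / ((G ^ 4)⁻¹) ^ 2 = t * G ^ 8 := by
    intro t
    field_simp
  rw [e5]
  calc 4 * (G ^ 2) ^ 2 * (4 * G ^ 4 * Real.exp (-M) + (d : ℝ) ^ (2 *
        ((nbhd r (Ico x w) y M).card + (nbhd r (Ico x w) z M).card)) * (G ^ 2) ^ 2 * ε) * G ^ 8
      ≤ 4 * (G ^ 2) ^ 2 * (4 * G ^ 4 * Real.exp (-M) + (4 * (d : ℝ) ^ (8 * m)) *
        (G ^ 2) ^ 2 * ε) * G ^ 8 := by
        gcongr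
        exact hpow.trans (le_mul_of_one_le_left (by positivity) (by norm_num))
    _ = _ := by ring

/-- The choice of the size of the neighbourhoods of the cuts. -/
theorem exp_add_pow_mul_exp_le {d ρ : ℕ} (hd : 0 < d) (hρ : 0 < ρ) {K α η l : ℝ} (hK : 0 < K)
    (hη : η = min 1 α / (16 * ρ * (1 + Real.log d))) (hα : 0 < α) (hl : 1 ≤ η * l) :
    ∃ M : ℕ, (((M + 1) * ρ : ℕ) : ℝ) ≤ l ∧
      Real.exp (-M) + (d : ℝ) ^ (8 * ((M + 1) * ρ)) * (K * Real.exp (-α * l)) ≤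
        (Real.exp 2 + K) * Real.exp (-min η (α / 2) * l) := by
  have hd1 : (1 : ℝ) ≤ d := by exact_mod_cast hd
  have hρ1 : (1 : ℝ) ≤ ρ := by exact_mod_cast hρ
  have hlog : 0 ≤ Real.log d := Real.log_nonneg hd1
  have hmin : 0 < min 1 α := lt_min one_pos hα
  have hη0 : 0 < η := hη ▸ by positivity
  have hl0 : 0 < l := pos_of_mul_pos_right (one_pos.trans_le hl) hη0.le
  -- The denominator of η serves two ends: the 1 in the minimum gives m = (M + 1)ρ ≤ ℓ, and the term
  -- 16 log d gives 8 m log d ≤ αℓ/2, so the matrix-unit count uses at most half of the clustering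
  -- rate.
  have hηρ : η * ρ * (16 * (1 + Real.log d)) = min 1 α := by
    rw [hη]
    field_simp
  -- The floor is positive because ηℓ ≥ 1. The resulting bound M > ηℓ - 2 is the origin of the
  -- factor e².
  obtain ⟨M, hM⟩ : ∃ M, ⌊η * l⌋₊ = M + 1 :=
    Nat.exists_eq_succ_of_ne_zero (Nat.floor_pos.2 hl).ne'
  have hM1 : ((M : ℝ) + 1) ≤ η * l := by
    have := Nat.floor_le (a := η * l) (by positivity)
    rw [hM] at this
    exact_mod_cast this
  have hM2 : η * l < M + 2 := by
    have := Nat.lt_floor_add_one (η * l)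
    rw [hM] at this
    push_cast at this
    linarith
  have hm : ((M : ℝ) + 1) * ρ ≤ η * ρ * l := by
    calc ((M : ℝ) + 1) * ρ ≤ η * l * ρ := by gcongr
      _ = _ := by ring
  have hηρ0 : 0 < η * ρ := by positivity
  refine ⟨M, ?_, ?_⟩
  · push_cast
    refine hm.trans (mul_le_of_le_one_left hl0.le ?_)
    have h1 := min_le_left 1 α
    have h2 := mul_nonneg hηρ0.le hlog
    nlinarith
  · have h1 : Real.exp (-M) ≤ Real.exp 2 * Real.exp (-min η (α / 2) * l) := by
      rw [← Real.exp_add]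
      gcongr
      have : min η (α / 2) * l ≤ η * l := by gcongr; exact min_le_left _ _
      linarith
    have h2 : (d : ℝ) ^ (8 * ((M + 1) * ρ)) * Real.exp (-α * l) ≤
        Real.exp (-min η (α / 2) * l) := by
      rw [← Real.exp_log (one_pos.trans_le hd1), ← Real.exp_nat_mul, ← Real.exp_add]
      gcongr
      push_cast
      have h3 : min η (α / 2) * l ≤ α / 2 * l := by gcongr; exact min_le_right _ _
      have h4 : 8 * (((M : ℝ) + 1) * ρ) * Real.log d ≤ 8 * (η * ρ * l) * Real.log d := by gcongr
      have h5 : η * ρ * (16 * Real.log d) ≤ α := by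
        have := min_le_right 1 α
        linarith
      have h6 := mul_le_mul_of_nonneg_right h5 hl0.le
      linarith
    have h3 := mul_le_mul_of_nonneg_left h2 hK.le
    linarith

end Decay

end SpinChain
end

/-! ### The main theorem. -/

theorem theorem8p2 (d : ℕ) (hd : 0 < d) (r J K α : ℝ)
    (hr : 0 < r) (hJ : 0 < J) (hK : 0 < K) (hα : 0 < α) :
    ∃ K' α' : ℝ, 0 < K' ∧ 0 < α' ∧
      ∀ Φ : SpinChain.Interaction d, Φ.HasRange r → Φ.HasStrength J →
        Φ.UniformClustering (fun l => K * Real.exp (-α * l)) →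
        ∀ I A B C : Finset ℤ, SpinChain.IsSplit I A B C →
          ∀ l : ℝ, 0 ≤ l → 3 * l ≤ (B.card : ℝ) → ∀ q : ℝ, 1 ≤ q →
            SpinChain.mutualInfo (Φ.gibbs I) A C ≤ SpinChain.bsMutualInfo (Φ.gibbs I) A C ∧
            SpinChain.bsMutualInfo (Φ.gibbs I) A C
              ≤ SpinChain.renyiMutualInfo q (Φ.gibbs I) A C ∧
            SpinChain.renyiMutualInfo q (Φ.gibbs I) A C ≤ K' * Real.exp (-α' * l) := by
  have : NeZero d := ⟨hd.ne'⟩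
  have hG := SpinChain.expansionalBound_pos r hJ.le
  have hρ : 0 < SpinChain.rangeLen r := Nat.succ_pos _
  have hlog : 0 ≤ Real.log d := Real.log_natCast_nonneg d
  obtain ⟨η, hη⟩ : ∃ η, η = min 1 α / (16 * SpinChain.rangeLen r * (1 + Real.log d)) := ⟨_, rfl⟩
  have hmin : 0 < min 1 α := lt_min one_pos hα
  have hη0 : 0 < η := by
    rw [hη]
    positivity
  refine ⟨16 * SpinChain.expansionalBound r J ^ 16 * (Real.exp 2 + K), min η (α / 2),
    by positivity, lt_min hη0 (half_pos hα), ?_⟩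
  rintro Φ hΦr hΦJ ⟨-, -, hcl⟩ I A B C ⟨x, y, z, w, hxy, hyz, hzw, rfl, rfl, rfl, rfl⟩ l hl hlB q hq
  obtain ⟨h1, h2, h3, h4⟩ := SpinChain.mutualInfo_chain_bounds hΦr hΦJ hxy hyz hzw hq
  refine ⟨h1, h2, ?_⟩
  -- For ηℓ < 1 the choice of M is not available, but then e² e^{-α'ℓ} ≥ 1 and the uniform bound
  -- suffices.
  rcases lt_or_ge (η * l) 1 with hηl | hηl
  · refine h3.trans ?_
    have e1 : min η (α / 2) * l ≤ 1 := (mul_le_mul_of_nonneg_right (min_le_left _ _) hl).trans hηl.le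
    have e2 : 1 ≤ Real.exp 2 * Real.exp (-min η (α / 2) * l) := by
      rw [← Real.exp_add]
      refine Real.one_le_exp ?_
      linarith
    have e3 := mul_pos hK (Real.exp_pos (-min η (α / 2) * l))
    calc 2 * SpinChain.expansionalBound r J ^ 16
        ≤ 16 * SpinChain.expansionalBound r J ^ 16 *
          ((Real.exp 2 + K) * Real.exp (-min η (α / 2) * l)) := by
          have := pow_pos hG 16
          nlinarith
      _ = _ := by ring
  · obtain ⟨M, hM, hb⟩ := SpinChain.exp_add_pow_mul_exp_le hd hρ hK hη hα hηl
    obtain ⟨m, hm⟩ : ∃ m, m = (M + 1) * SpinChain.rangeLen r := ⟨_, rfl⟩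
    rw [← hm] at hM hb
    have hcard : (((Finset.Ico y z).card : ℕ) : ℝ) = z - y := by
      rw [Int.card_Ico]
      have : (((z - y).toNat : ℤ) : ℝ) = ((z - y : ℤ) : ℝ) := by
        rw [Int.toNat_of_nonneg (sub_nonneg.2 hyz)]
      push_cast at this
      exact this
    rw [hcard] at hlB
    have hlen : y + m ≤ z - m := by
      have : ((y + m : ℤ) : ℝ) ≤ ((z - m : ℤ) : ℝ) := by
        push_cast
        linarith
      exact_mod_cast this
    -- Clustering is applied to the Gibbs state of the interval B itself, with end pieces of length
    -- m ≤ ℓ. Since |B| ≥ 3ℓ, at least ℓ sites remain between them.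
    have hcorr := hcl _ _ _ _ ⟨y, y + m, z - m, z, by omega, hlen, by omega, rfl, rfl, rfl, rfl⟩ l hl
      (by
        rw [Int.card_Ico]
        have : (((z - m - (y + m)).toNat : ℤ) : ℝ) = ((z - m - (y + m) : ℤ) : ℝ) := by
          rw [Int.toNat_of_nonneg (sub_nonneg.2 hlen)]
        push_cast at this
        rw [this]
        linarith)
    refine (h4 M m _ hm hlen hcorr).trans ?_
    rw [mul_assoc _ (Real.exp 2 + K)]
    exact mul_le_mul_of_nonneg_left hb (by positivity)
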